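/- Let $n\ge 1$ and $k\ge 2$, let $M$ be a closed manifold of dimension $n+1$, and let $H=H_0:T^*M\to\mathbb R$ be a Hamiltonian of class $C^{k+1}$, for example a Tonelli Hamiltonian of this class. Let $a>0$ and let $\theta(t)=(\gamma(t),p(t))$, $t\in[0,a]$, be an arc of an orbit (for example of a closed orbit) of the Hamiltonian flow of $H$, in the energy level $H^{-1}(c)$. Let $(x_0,x)=(x_0,x_1,\dots,x_n):W\to\mathbb R\times\mathbb R^n$ be a smooth chart of $M$, defined on an open set $W\supset\gamma([0,a])$, such that $x_0(\gamma(t))=t$ and $x(\gamma(t))=0$ for $t\in[0,a]$, and let $(x_0,x,y_0,y)$, where $y=(y_1,\dots,y_n)$, be the natural coordinates of $T^*M$ over $W$, so that a covector is $\sum_{i=0}^n y_i\,dx_i$. Let $\epsilon>0$ be so small that the image of the chart contains $[0,a]\times\{x\in\mathbb R^n:|x|\le\epsilon\}$. Put $\Lambda(t)=\{x_0=t\}\subset T^*M$ and $\Sigma_0(t)=\Lambda(t)\cap H^{-1}(c)$. Near $\theta(t)$, the set $\Sigma_0(t)$ is a graph over the coordinates $(x,y)\in\mathbb R^{2n}$,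 in which its symplectic form is $dx\wedge dy$; these coordinates (translated, at $t=0$, so that $\theta(0)$ becomes the origin) are used on $\Sigma_0(t)$. For a smooth $u:M\to\mathbb R$ such that $\theta$ is also an orbit of $H_u=H+u$ (as it is for the $u$ considered below), let $\widehat P_{u,t}:\Lambda(0)\to\Lambda(t)$ be the Poincaré map of the flow of $H_u$, defined near $\theta(0)$ by following the orbits close to $\theta$, and let $R_{u,a}=\widehat P_{0,a}^{-1}\circ\widehat P_{u,a}$. Let $\mathcal F^k$ be the set of the smooth functions $u:M\to\mathbb R$, supported in $W$, that have the form $u=\delta(x_0)\beta(x)$ in $W$, where $\delta:\mathbb R\to\mathbb R$ and $\beta:\mathbb R^n\to\mathbb R$ are smooth, $\operatorname{supp}\delta\subset(0,a)$, $\operatorname{supp}\beta\subset B_\epsilon(0)$, and the $(k+1)$-jet of $\beta$ at $0$ is homogeneous of degree $k+1$. Let $\mathcal F^k_1\subset\mathcal F^k$ be the set of those $u=\delta(x_0)\beta(x)$ for which, moreover, the $(k+1)$-jet of $\beta$ at $0$ is equal to $x_1^{k+1}$. Let $J^k_s(n)$ be the group of the $k$-jets at $0$ of the smooth symplectic diffeomorphisms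 of $\mathbb R^{2n}$ that fix $0$, and let $\pi_k:J^k_s(n)\to J^{k-1}_s(n)$ be the projection. Suppose that the family $[0,a]\ni t\mapsto d_{\theta(0)}\widehat P_{0,t}|_{\Sigma_0(0)}\in Sp(n)$ is $(k+1)$-general: there are times $t_1,\dots,t_d\in[0,a]$, where $d=\binom{2n+k}{k+1}$, such that, with $\sigma_i=d_{\theta(0)}\widehat P_{0,t_i}|_{\Sigma_0(0)}$ and $F=x_1^{k+1}$, the polynomials $F\circ\sigma_1,\dots,F\circ\sigma_d$ form a basis of the space of the real homogeneous polynomials of degree $k+1$ in $(x,y)$. Then, for each $u\in\mathcal F^k$, the map $R_{u,a}|_{\Sigma_0(0)}$ is defined and of class $C^k$ near $\theta(0)$, and its $k$-jet $S_a^k(u)=j^k(R_{u,a}|_{\Sigma_0(0)})(\theta(0))$ belongs to $\ker\pi_k$. The map $S_a^k:\mathcal F^k\to\ker\pi_k$ is smooth, in the sense that it is smooth along every smooth finite-dimensional family of potentials in $\mathcal F^k$. Moreover $0\in\mathcal F_1^k$, and $S_a^k:\mathcal F_1^k\to\ker\pi_k$ is a submersion at $0$ and at every other point of $\mathcal F_1^k$: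 for each $u\in\mathcal F^k_1$ there is a smooth finite-dimensional family of potentials in $\mathcal F^k_1$ through $u$ along which the differential of $S_a^k$ at $u$ is onto the tangent space of $\ker\pi_k$ at $S_a^k(u)$. -/

import Mathlib

open scoped Manifold ContDiff Topology

noncomputable section

namespace ManeJets

/-! ### Phase space and Hamiltonian dynamics in natural coordinates -/

/-- The coordinate space `ℝ × ℝⁿ` of an `(n+1)`-dimensional manifold: the coordinate with
index `0` is `x₀`, the coordinate with index `i.succ` is the `i`-th coordinate of `x ∈ ℝⁿ`. -/
abbrev Coord (n : ℕ) : Type := EuclideanSpace ℝ (Fin (n + 1))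

/-- The cotangent bundle `T*M`: its points are pairs `⟨q, p⟩` with `p` a linear form on the
tangent space at `q`. -/
abbrev Cotangent (n : ℕ) (M : Type*) [TopologicalSpace M] [ChartedSpace (Coord n) M] : Type _ :=
  Bundle.TotalSpace (Coord n →L[ℝ] ℝ)
    (fun q : M => TangentSpace (𝓡 (n + 1)) q →L[ℝ] Bundle.Trivial M ℝ q)

/-- The model with corners of `T*M`. -/
abbrev cotangentModel (n : ℕ) :=
  (𝓡 (n + 1)).prod 𝓘(ℝ, Coord n →L[ℝ] ℝ)

/-- Points `(x₀, x, y₀, y)` of the natural chart of `T*M`, as pairs `((x₀, x), (y₀, y))`. -/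
abbrev Phase (n : ℕ) : Type := Coord n × Coord n

section Dynamics

variable {n : ℕ} {M : Type*} [TopologicalSpace M] [ChartedSpace (Coord n) M]

/-- The point of `T*M` with natural coordinates `(x, y)`: the covector `∑ yᵢ dxᵢ` at the point
with coordinates `x`. -/
def ofCoord (φ : OpenPartialHomeomorph M (Coord n)) (z : Phase n) : Cotangent n M :=
  ⟨φ.symm z.1, ∑ i : Fin (n + 1), z.2 i •
    (EuclideanSpace.proj i : Coord n →L[ℝ] ℝ).comp
      (mfderiv (𝓡 (n + 1)) 𝓘(ℝ, Coord n) φ (φ.symm z.1))⟩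

/-- The natural coordinates of a point `⟨q, p⟩` of `T*M`: `yᵢ = p(∂/∂xᵢ)`. -/
def toCoord (φ : OpenPartialHomeomorph M (Coord n)) (z : Cotangent n M) : Phase n :=
  (φ z.proj, WithLp.toLp 2 fun i : Fin (n + 1) =>
    z.snd (mfderiv 𝓘(ℝ, Coord n) (𝓡 (n + 1)) φ.symm (φ z.proj)
      (EuclideanSpace.single i (1 : ℝ))))

/-- The Hamiltonian vector field `∑ (∂K/∂yᵢ ∂/∂xᵢ - ∂K/∂xᵢ ∂/∂yᵢ)` of a function of the natural
coordinates, for the canonical form `∑ dxᵢ ∧ dyᵢ`. -/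
def hamField (K : Phase n → ℝ) (z : Phase n) : Phase n :=
  (WithLp.toLp 2 fun i : Fin (n + 1) => fderiv ℝ K z (0, EuclideanSpace.single i (1 : ℝ)),
   WithLp.toLp 2 fun i : Fin (n + 1) => - fderiv ℝ K z (EuclideanSpace.single i (1 : ℝ), 0))

/-- On the time set `s`, the curve `η` in `T*M` stays over the domain of the chart `φ` and is an
orbit of the Hamiltonian vector field of `H`. -/
def IsOrbitOn (φ : OpenPartialHomeomorph M (Coord n)) (H : Cotangent n M → ℝ)
    (η : ℝ → Cotangent n M) (s : Set ℝ) : Prop :=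
  ∀ t ∈ s, (η t).proj ∈ φ.source ∧
    HasDerivWithinAt (fun r => toCoord φ (η r))
      (hamField (fun z => H (ofCoord φ z)) (toCoord φ (η t))) s t

/-- The hypersurface `Λ(t) = {x₀ = t}` of `T*M`, over the domain of the chart. -/
def Lam (φ : OpenPartialHomeomorph M (Coord n)) (t : ℝ) : Set (Cotangent n M) :=
  {z | z.proj ∈ φ.source ∧ φ z.proj 0 = t}

/-- An orbit of `H` over the domain of the chart leads from `z ∈ Λ(s)` to `w ∈ Λ(t)` and is
between the two hypersurfaces at the times in between. For `H` of class `C²` each of `z` and `w`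
determines the other. -/
def Crosses (φ : OpenPartialHomeomorph M (Coord n)) (H : Cotangent n M → ℝ) (s t : ℝ)
    (z w : Cotangent n M) : Prop :=
  z ∈ Lam φ s ∧ w ∈ Lam φ t ∧ ∃ τ : ℝ, 0 ≤ τ ∧ ∃ η : ℝ → Cotangent n M,
    IsOrbitOn φ H η (Set.Icc 0 τ) ∧ η 0 = z ∧ η τ = w ∧
    ∀ r ∈ Set.Ioo 0 τ, φ (η r).proj 0 ∈ Set.Ioo s t

open Classical in
/-- The Poincaré map `P̂ : Λ(0) → Λ(t)` of the Hamiltonian flow of `H` (with value `z` at the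
points `z` where it is not defined). -/
def poincare (φ : OpenPartialHomeomorph M (Coord n)) (H : Cotangent n M → ℝ) (t : ℝ)
    (z : Cotangent n M) : Cotangent n M :=
  if h : ∃ w, Crosses φ H 0 t z w then h.choose else z

open Classical in
/-- The inverse map `P̂⁻¹ : Λ(t) → Λ(0)` (with value `w` where it is not defined). -/
def poincareInv (φ : OpenPartialHomeomorph M (Coord n)) (H : Cotangent n M → ℝ) (t : ℝ)
    (w : Cotangent n M) : Cotangent n M :=
  if h : ∃ z, Crosses φ H 0 t z w then h.choose else w

/-- The perturbed Hamiltonian `H_u = H + u`, for a potential `u` on `M`. -/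
def perturb (H : Cotangent n M → ℝ) (u : M → ℝ) : Cotangent n M → ℝ :=
  fun z => H z + u z.proj

/-- The relative Poincaré map `R_{u,t} = P̂_{0,t}⁻¹ ∘ P̂_{u,t} : Λ(0) → Λ(0)`. -/
def relPoincare (φ : OpenPartialHomeomorph M (Coord n)) (H : Cotangent n M → ℝ) (t : ℝ)
    (u : M → ℝ) (z : Cotangent n M) : Cotangent n M :=
  poincareInv φ H t (poincare φ (perturb H u) t z)

end Dynamics

/-! ### Coordinates on the sections `Λ(t) ∩ H⁻¹(c)` -/

/-- `ℝ²ⁿ` with its coordinates `x₁, …, xₙ` (left summand) and `y₁, …, yₙ` (right summand). -/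
abbrev Sect (n : ℕ) : Type := Fin n ⊕ Fin n → ℝ

section Sections

variable {n : ℕ} {M : Type*} [TopologicalSpace M] [ChartedSpace (Coord n) M]

/-- The coordinates `(x, y) ∈ ℝ²ⁿ` of a point `(x₀, x, y₀, y)` of `T*M`. -/
def sectCoord (φ : OpenPartialHomeomorph M (Coord n)) (z : Cotangent n M) : Sect n :=
  Sum.elim (fun i : Fin n => (toCoord φ z).1 i.succ) (fun i : Fin n => (toCoord φ z).2 i.succ)

/-- The point `(0, x, α(x,y), y)` of the hypersurface `Λ(0)`. -/
def sectPoint (φ : OpenPartialHomeomorph M (Coord n)) (α : Sect n → ℝ) (ξ : Sect n) :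
    Cotangent n M :=
  ofCoord φ (WithLp.toLp 2 (Fin.cons (0 : ℝ) fun i : Fin n => ξ (Sum.inl i)),
    WithLp.toLp 2 (Fin.cons (α ξ) fun i : Fin n => ξ (Sum.inr i)))

/-- The function `α` parametrizes `Σ₀(0) = Λ(0) ∩ H⁻¹(c)` near its point `z₀` by the coordinates
`(x, y)`, where `c = H z₀`; it is of class `C^r`. -/
def IsSectParam (φ : OpenPartialHomeomorph M (Coord n)) (H : Cotangent n M → ℝ) (r : ℕ)
    (z₀ : Cotangent n M) (α : Sect n → ℝ) : Prop :=
  ContDiffAt ℝ r α (sectCoord φ z₀) ∧ α (sectCoord φ z₀) = (toCoord φ z₀).2 0 ∧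
    ∀ᶠ ξ in 𝓝 (sectCoord φ z₀), H (sectPoint φ α ξ) = H z₀

/-- The Poincaré map `P̂_{0,t}|Σ₀(0) : Σ₀(0) → Σ₀(t)` in the coordinates `(x, y)`. -/
def sectPoincare (φ : OpenPartialHomeomorph M (Coord n)) (H : Cotangent n M → ℝ)
    (α : Sect n → ℝ) (t : ℝ) (ξ : Sect n) : Sect n :=
  sectCoord φ (poincare φ H t (sectPoint φ α ξ))

/-- The matrix, in the coordinates `(x, y)`, of the differential of `P̂_{0,t}|Σ₀(0)` at the
point `z₀`. -/
def linPoincare (φ : OpenPartialHomeomorph M (Coord n)) (H : Cotangent n M → ℝ)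
    (α : Sect n → ℝ) (z₀ : Cotangent n M) (t : ℝ) : Matrix (Fin n ⊕ Fin n) (Fin n ⊕ Fin n) ℝ :=
  LinearMap.toMatrix' (fderiv ℝ (sectPoincare φ H α t) (sectCoord φ z₀) : Sect n →ₗ[ℝ] Sect n)

/-- The map `R_{u,a}|Σ₀(0)` in the coordinates `(x, y)`, translated so that the point `z₀` is at
the origin of `ℝ²ⁿ`. -/
def sectRel (φ : OpenPartialHomeomorph M (Coord n)) (H : Cotangent n M → ℝ) (a : ℝ)
    (α : Sect n → ℝ) (z₀ : Cotangent n M) (u : M → ℝ) (h : Sect n) : Sect n :=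
  sectCoord φ (relPoincare φ H a u (sectPoint φ α (sectCoord φ z₀ + h))) - sectCoord φ z₀

end Sections

/-! ### Families in general position -/

/-- `F ∘ σ` for a polynomial `F` in the `2n` variables `(x, y)` and a matrix `σ`. -/
def polyComp {n : ℕ} (F : MvPolynomial (Fin n ⊕ Fin n) ℝ)
    (σ : Matrix (Fin n ⊕ Fin n) (Fin n ⊕ Fin n) ℝ) : MvPolynomial (Fin n ⊕ Fin n) ℝ :=
  MvPolynomial.bind₁ (fun i => ∑ j, MvPolynomial.C (σ i j) * MvPolynomial.X j) F

/-- The number `d(2n, k)`, the dimension of the space `ℝ_k[x, y]` of homogeneous polynomials of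
degree `k` in `2n` variables. -/
def polyDim (n k : ℕ) : ℕ := (2 * n - 1 + k).choose k

/-- The set `G_k` of the tuples `(σ₁, …, σ_d)` of symplectic matrices such that
`F ∘ σ₁, …, F ∘ σ_d` is a basis of `ℝ_k[x, y]`, where `F = x₁ᵏ`. -/
def generalSet (n k : ℕ) [NeZero n] :
    Set (Fin (polyDim n k) → Matrix (Fin n ⊕ Fin n) (Fin n ⊕ Fin n) ℝ) :=
  {σ | (∀ i, σ i ∈ Matrix.symplecticGroup (Fin n) ℝ) ∧
    LinearIndependent ℝ (fun i => polyComp (MvPolynomial.X (Sum.inl 0) ^ k) (σ i)) ∧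
    Submodule.span ℝ (Set.range fun i => polyComp (MvPolynomial.X (Sum.inl 0) ^ k) (σ i)) =
      MvPolynomial.homogeneousSubmodule (Fin n ⊕ Fin n) ℝ k}

/-- A family of symplectic matrices, parametrized by `[a, b]`, is `k`-general. -/
def IsGeneral {n : ℕ} [NeZero n] (k : ℕ) (a b : ℝ)
    (σ : ℝ → Matrix (Fin n ⊕ Fin n) (Fin n ⊕ Fin n) ℝ) : Prop :=
  ∃ t : Fin (polyDim n k) → ℝ, (∀ i, t i ∈ Set.Icc a b) ∧
    (fun i => σ (t i)) ∈ generalSet n k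

/-! ### Jets -/

/-- The `k`-jets of maps `ℝ²ⁿ → ℝ²ⁿ` at a point, given by the derivatives of order at
most `k`. -/
abbrev Jet (n k : ℕ) : Type :=
  (i : Fin (k + 1)) → ContinuousMultilinearMap ℝ (fun _ : Fin (i : ℕ) => Sect n) (Sect n)

/-- The `k`-jet of `f` at the origin. -/
def jet {n : ℕ} (k : ℕ) (f : Sect n → Sect n) : Jet n k :=
  fun i => iteratedFDeriv ℝ (i : ℕ) f 0

/-- The map `f` is a smooth symplectic diffeomorphism of `ℝ²ⁿ` that fixes the origin. -/
def IsSymplecticDiffeo {n : ℕ} (f : Sect n → Sect n) : Prop :=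
  f 0 = 0 ∧ ContDiff ℝ ∞ f ∧
    (∃ g : Sect n → Sect n, ContDiff ℝ ∞ g ∧ Function.LeftInverse g f ∧
      Function.RightInverse g f) ∧
    ∀ ξ, LinearMap.toMatrix' (fderiv ℝ f ξ : Sect n →ₗ[ℝ] Sect n) ∈
      Matrix.symplecticGroup (Fin n) ℝ

/-- The space `J^k_s(n)` of symplectic `k`-jets. -/
def symplecticJets (n k : ℕ) : Set (Jet n k) :=
  {j | ∃ f : Sect n → Sect n, IsSymplecticDiffeo f ∧ jet k f = j}

/-- The projection `π_k` from `k`-jets to `(k-1)`-jets. -/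
def jetProj {n k : ℕ} (j : Jet n k) : Jet n (k - 1) :=
  fun i => j ⟨(i : ℕ), by omega⟩

/-- The kernel of the homomorphism `π_k : J^k_s(n) → J^{k-1}_s(n)`, that is, the set of the
symplectic `k`-jets whose `(k-1)`-jet is the one of the identity. -/
def jetKer (n k : ℕ) : Set (Jet n k) :=
  {j | j ∈ symplecticJets n k ∧ jetProj j = jet (k - 1) (id : Sect n → Sect n)}

/-! ### Potentials -/

section Potentials

variable {n : ℕ} {M : Type*} [TopologicalSpace M] [ChartedSpace (Coord n) M]

/-- The smooth function `u` on `M` is supported in the domain of the chart and has there the form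
`δ(x₀) β(x)`, with `δ` and `β` smooth, `supp δ ⊆ (0, a)` and `supp β ⊆ B_ε(0)`. -/
def IsProductPotential (φ : OpenPartialHomeomorph M (Coord n)) (a ε : ℝ)
    (δ : ℝ → ℝ) (β : EuclideanSpace ℝ (Fin n) → ℝ) (u : M → ℝ) : Prop :=
  ContMDiff (𝓡 (n + 1)) 𝓘(ℝ, ℝ) ∞ u ∧ tsupport u ⊆ φ.source ∧
    ContDiff ℝ ∞ δ ∧ tsupport δ ⊆ Set.Ioo 0 a ∧
    ContDiff ℝ ∞ β ∧ tsupport β ⊆ Metric.ball 0 ε ∧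
    ∀ q ∈ φ.source, u q = δ (φ q 0) * β (WithLp.toLp 2 fun i : Fin n => φ q i.succ)

/-- The set `𝓕^k`: the potentials `δ(x₀) β(x)` such that the `(k+1)`-jet of `β` at `0` is
homogeneous of degree `k + 1`. -/
def potentials (φ : OpenPartialHomeomorph M (Coord n)) (a ε : ℝ) (k : ℕ) : Set (M → ℝ) :=
  {u | ∃ (δ : ℝ → ℝ) (β : EuclideanSpace ℝ (Fin n) → ℝ), IsProductPotential φ a ε δ β u ∧
    ∀ i ≤ k, iteratedFDeriv ℝ i β 0 = 0}

/-- The potentials `δ(x₀) β(x)` in `𝓕^k` such that the `(k+1)`-jet of `β` at `0` is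
`x₁^(k+1)`. -/
def normalPotentials [NeZero n] (φ : OpenPartialHomeomorph M (Coord n)) (a ε : ℝ) (k : ℕ) :
    Set (M → ℝ) :=
  {u | ∃ (δ : ℝ → ℝ) (β : EuclideanSpace ℝ (Fin n) → ℝ), IsProductPotential φ a ε δ β u ∧
    (∀ i ≤ k, iteratedFDeriv ℝ i β 0 = 0) ∧
    ∀ v : EuclideanSpace ℝ (Fin n),
      iteratedFDeriv ℝ (k + 1) β 0 (fun _ => v) = ((k + 1).factorial : ℝ) * v 0 ^ (k + 1)}

/-- The map `S_a^k`, which sends `u` to the `k`-jet of `R_{u,a}|Σ₀(0)` at `z₀`. -/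
def jetMap (φ : OpenPartialHomeomorph M (Coord n)) (H : Cotangent n M → ℝ) (a : ℝ)
    (α : Sect n → ℝ) (z₀ : Cotangent n M) (k : ℕ) (u : M → ℝ) : Jet n k :=
  jet k (sectRel φ H a α z₀ u)

/-! ### Smooth maps and submersions on sets of smooth functions -/

/-- The functions `w s`, for `s` in the subset `U` of `ℝᵐ`, belong to `𝓕` and form a smooth
family of functions on `M`. -/
def IsSmoothFamily (n : ℕ) {M : Type*} [TopologicalSpace M] [ChartedSpace (Coord n) M]
    {m : ℕ} (𝓕 : Set (M → ℝ)) (U : Set (Fin m → ℝ)) (w : (Fin m → ℝ) → M → ℝ) : Prop :=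
  (∀ s ∈ U, w s ∈ 𝓕) ∧
    ContMDiffOn (𝓘(ℝ, Fin m → ℝ).prod (𝓡 (n + 1))) 𝓘(ℝ, ℝ) ∞
      (fun p : (Fin m → ℝ) × M => w p.1 p.2) (U ×ˢ Set.univ)

variable {J : Type*} [NormedAddCommGroup J] [NormedSpace ℝ J]

/-- The map `S` is smooth on the set `𝓕` of functions on `M`: it is smooth along every smooth
finite-dimensional family in `𝓕`. -/
def IsSmoothMapOn (n : ℕ) {M : Type*} [TopologicalSpace M] [ChartedSpace (Coord n) M]
    (𝓕 : Set (M → ℝ)) (S : (M → ℝ) → J) : Prop :=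
  ∀ (m : ℕ) (U : Set (Fin m → ℝ)) (w : (Fin m → ℝ) → M → ℝ), IsOpen U →
    IsSmoothFamily n 𝓕 U w → ContDiffOn ℝ ∞ (fun s => S (w s)) U

/-- The tangent vectors at `j` of a subset `N` of a normed space. -/
def tangentVectors (N : Set J) (j : J) : Set J :=
  {v | ∃ c : ℝ → J, c 0 = j ∧ (∀ s, c s ∈ N) ∧ HasDerivAt c v 0}

/-- The map `S` from `𝓕` to `N` is a submersion at `u`: there is a smooth finite-dimensional
family in `𝓕` through `u` along which `S` is differentiable, with a differential at `u` that is
onto the tangent space of `N` at `S u`. -/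
def IsSubmersionAt (n : ℕ) {M : Type*} [TopologicalSpace M] [ChartedSpace (Coord n) M]
    (𝓕 : Set (M → ℝ)) (N : Set J) (S : (M → ℝ) → J) (u : M → ℝ) : Prop :=
  ∃ (m : ℕ) (U : Set (Fin m → ℝ)) (w : (Fin m → ℝ) → M → ℝ), IsOpen U ∧ 0 ∈ U ∧
    IsSmoothFamily n 𝓕 U w ∧ w 0 = u ∧ DifferentiableAt ℝ (fun s => S (w s)) 0 ∧
    Set.range (fderiv ℝ (fun s => S (w s)) 0) = tangentVectors N (S u)

end Potentials

end ManeJets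

end

open ManeJets

/-! In natural coordinates along the arc `x₀` grows at rate one, so near it the Hamiltonian field
can be divided by its `x₀`-component. For the rescaled field `X` the Poincaré map `Λ(0) → Λ(t)` is
simply the time-`t` map. A potential `V(x₀, x)` adds to the Hamiltonian field a vertical vector. The
rescaling factor `g` is thus unaffected, and the perturbed rescaled field is exactly `X + g •
potGrad (dV)` (`IsArc.isClockField_add`). If the derivatives of `V` of order at most `k` vanish on
the axis, this perturbation vanishes there with its derivatives of order less than `k`, and its
leading term is the derivative of order `k + 1` of `V`.

Flows are treated as maps into the Banach space of paths. The equation `η = b + ∫ X(η)` is solved by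
the inverse function theorem (`exists_solution_operator`), because the derivative of `η - ∫ X(η)` is
the identity minus a Volterra operator. First order perturbation theory
(`perturbed_solution_expansion`) then gives `R(ξ) = ξ + q(ξ) + o(‖ξ‖^k)` in the section coordinates,
where `q` is obtained by transporting the leading term back to time `0` with the linearized flow.
That flow preserves `dx₀`, `dH`, and the symplectic form on `ker dH`. Pairing `q` with a tangent
vector therefore produces an integral along the arc (`IsArc.exists_variation`), and the `k`-jet of
`R` is the identity plus the Hamiltonian vector field of the symmetric form `B = ∫ N_t^* D^(k+1)V
dt`, where `N_t` is the base component of the linearized flow (`exists_jet_formula`). The formula is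
affine in the derivatives of `u` along the axis, which yields smoothness of the jet map.

The kernel of `π_k` is an affine space: the identity plus the Hamiltonian fields of all symmetric
`(k+1)`-forms. Symplecticity to lowest order gives one inclusion (`exists_form_of_mem_jetKer`). For
the other, generality writes a symmetric form as a sum of powers of linear forms, and composing the
corresponding symplectic shears realizes the jet (`mem_jetKer_of_sum_powForm`).

For a normalized potential, `B = (k+1)! ∫ δ(t) l_t^(k+1) dt`, where `l_t` is the first row of the
linearized Poincaré map. Varying only `δ` keeps the potential normalized and moves the jet affinely.
By the fundamental lemma of the calculus of variations (`mem_span_weighted_integral`) these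
integrals span every power `l_t^(k+1)`, `t ∈ [0, a]`, hence by generality all symmetric forms. This
argument does not depend on the base point `u`, so the submersion property holds everywhere. -/

namespace ManeJets

open Asymptotics

universe u

/-! ### Symmetric multilinear forms and Taylor expansions with Peano remainder -/

section Taylor

variable {E F : Type u} [NormedAddCommGroup E] [NormedSpace ℝ E] [NormedAddCommGroup F]
  [NormedSpace ℝ F]

/-- A continuous multilinear map is symmetric. -/
def IsSymmForm {n : ℕ} (B : ContinuousMultilinearMap ℝ (fun _ : Fin n => E) F) : Prop :=
  ∀ (σ : Equiv.Perm (Fin n)) (v : Fin n → E), B (v ∘ σ) = B v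

/-- Polarization: the `n`-th derivative of `x ↦ D(x, …, x)` is the sum of `D` over all permutations
of its arguments, that is `n! • D` when `D` is symmetric, so the diagonal determines the form. -/
theorem IsSymmForm.ext {n : ℕ} {B C : ContinuousMultilinearMap ℝ (fun _ : Fin n => E) F}
    (hB : IsSymmForm B) (hC : IsSymmForm C) (h : ∀ x, B (fun _ => x) = C (fun _ => x)) :
    B = C := by
  ext v
  have key : ∀ D : ContinuousMultilinearMap ℝ (fun _ : Fin n => E) F, IsSymmForm D →
      iteratedFDeriv ℝ n (fun x => D (fun _ => x)) 0 v = (n.factorial : ℝ) • D v := by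
    intro D hD
    rw [ContinuousMultilinearMap.iteratedFDeriv_comp_diagonal]
    simp_rw [show ∀ σ : Equiv.Perm (Fin n), (D fun i => v (σ i)) = D v from fun σ => hD σ v]
    simp [Fintype.card_perm, Nat.cast_smul_eq_nsmul]
  have h1 := key B hB
  have h2 := key C hC
  rw [show (fun x => B (fun _ => x)) = fun x => C (fun _ => x) from funext h, h2] at h1
  exact (smul_right_injective F (by positivity : (n.factorial : ℝ) ≠ 0) h1).symm

/-- The iterated derivatives of a `C^n` function are symmetric. -/
theorem isSymmForm_iteratedFDeriv {n : ℕ} {f : E → F} {x : E} (hf : ContDiffAt ℝ n f x) :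
    IsSymmForm (iteratedFDeriv ℝ n f x) := by
  induction n generalizing x with
  | zero => intro σ v; congr 1; ext i; exact i.elim0
  | succ n ih =>
    intro σ
    -- Adjacent transpositions generate the permutations. The one of the first two slots is the
    -- symmetry of the second derivative of `iteratedFDeriv ℝ n f`. The others leave the first slot
    -- alone and follow by differentiating the induction hypothesis, which must therefore hold at
    -- all points near `x`.
    have hσ : σ ∈ Submonoid.closure
        (Set.range fun i : Fin n => Equiv.swap i.castSucc i.succ) := by
      rw [Equiv.Perm.mclosure_swap_castSucc_succ]; trivial
    induction hσ using Submonoid.closure_induction with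
    | one => intro v; rfl
    | mul σ τ _ _ h1 h2 =>
      intro v
      have : v ∘ (σ * τ : Equiv.Perm _) = (v ∘ σ) ∘ τ := rfl
      rw [this, h2, h1]
    | mem σ hσ =>
      obtain ⟨i, rfl⟩ := hσ
      intro v
      obtain _ | n := n
      · exact i.elim0
      have hd : DifferentiableAt ℝ (iteratedFDeriv ℝ (n + 1) f) x :=
        hf.differentiableAt_iteratedFDeriv (by exact_mod_cast Nat.lt_succ_self _)
      rcases Fin.eq_zero_or_eq_succ i with rfl | ⟨j, rfl⟩
      · have key : ∀ w : Fin (n + 2) → E, iteratedFDeriv ℝ (n + 2) f x w =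
            fderiv ℝ (fderiv ℝ (iteratedFDeriv ℝ n f)) x (w 0) (w 1)
              (Fin.tail (Fin.tail w)) := by
          intro w
          have h1 : ContDiffAt ℝ 1 (fderiv ℝ (iteratedFDeriv ℝ n f)) x :=
            (hf.iteratedFDeriv_right (m := 2) (by norm_cast; omega)).fderiv_right
              (by norm_num)
          have h2 := h1.differentiableAt (by simp)
          have e : (fun y => iteratedFDeriv ℝ (n + 1) f y (Fin.tail w)) =
              fun y => fderiv ℝ (iteratedFDeriv ℝ n f) y (w 1) (Fin.tail (Fin.tail w)) := by
            ext y
            rw [iteratedFDeriv_succ_apply_left]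
            rfl
          rw [hd.iteratedFDeriv_succ_apply_left', e,
            fderiv_continuousMultilinear_apply_const
              (h2.clm_apply (differentiableAt_const _)),
            fderiv_clm_apply h2 (differentiableAt_const _)]
          simp
        have h2 : ContDiffAt ℝ 2 (iteratedFDeriv ℝ n f) x :=
          hf.iteratedFDeriv_right (by norm_cast; omega)
        have hs := h2.isSymmSndFDerivAt (by simp)
        rw [key, key]
        have t0 : (v ∘ (Equiv.swap (0 : Fin (n + 1)).castSucc (0 : Fin (n + 1)).succ)) 0 = v 1 := by
          simp
        have t1 : (v ∘ (Equiv.swap (0 : Fin (n + 1)).castSucc (0 : Fin (n + 1)).succ)) 1 = v 0 := by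
          simp
        have t2 : Fin.tail (Fin.tail
            (v ∘ (Equiv.swap (0 : Fin (n + 1)).castSucc (0 : Fin (n + 1)).succ))) =
              Fin.tail (Fin.tail v) := by
          ext l
          simp only [Fin.tail, Function.comp]
          rw [Equiv.swap_apply_of_ne_of_ne]
          · exact (Fin.succ_ne_zero _)
          · intro h
            exact Fin.succ_ne_zero _ (Fin.succ_injective _ h)
        rw [t0, t1, t2, hs.eq]
      · rw [hd.iteratedFDeriv_succ_apply_left', hd.iteratedFDeriv_succ_apply_left']
        have t0 : (v ∘ (Equiv.swap j.succ.castSucc j.succ.succ)) 0 = v 0 := by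
          simp only [Function.comp]
          rw [Equiv.swap_apply_of_ne_of_ne]
          · rw [← Fin.succ_castSucc]; exact (Fin.succ_ne_zero _).symm
          · exact (Fin.succ_ne_zero _).symm
        have t1 : Fin.tail (v ∘ (Equiv.swap j.succ.castSucc j.succ.succ)) =
            Fin.tail v ∘ Equiv.swap j.castSucc j.succ := by
          ext l
          simp only [Fin.tail, Function.comp]
          congr 1
          rw [← Fin.succ_castSucc]
          exact ((Fin.succ_injective _).map_swap _ _ _).symm
        rw [t0, t1]
        have hn : ∀ᶠ y in 𝓝 x, ContDiffAt ℝ (n + 1 : ℕ) f y :=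
          (hf.of_le (by exact_mod_cast Nat.le_succ _)).eventually (by simp)
        have : (fun y => iteratedFDeriv ℝ (n + 1) f y (Fin.tail v ∘ Equiv.swap j.castSucc j.succ))
            =ᶠ[𝓝 x] fun y => iteratedFDeriv ℝ (n + 1) f y (Fin.tail v) :=
          hn.mono fun y hy => ih hy _ _
        rw [this.fderiv_eq]

theorem IsSymmForm.update_diag {n : ℕ}
    {T : ContinuousMultilinearMap ℝ (fun _ : Fin (n + 1) => E) F} (hT : IsSymmForm T)
    (x w : E) (i : Fin (n + 1)) :
    T (Function.update (fun _ => x) i w) = T (Fin.snoc (fun _ => x) w) := by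
  rw [← hT (Equiv.swap i (Fin.last n)) (Fin.snoc (fun _ => x) w)]
  congr 1
  ext j
  by_cases hj : j = i
  · subst hj; simp
  · rw [Function.update_of_ne hj]
    simp only [Function.comp]
    by_cases hl : j = Fin.last n
    · subst hl
      rw [Equiv.swap_apply_right]
      obtain ⟨i', rfl⟩ := Fin.exists_castSucc_eq.2 (Ne.symm hj)
      simp
    · rw [Equiv.swap_apply_of_ne_of_ne hj hl]
      obtain ⟨j', rfl⟩ := Fin.exists_castSucc_eq.2 hl
      simp

/-- By symmetry the `n + 1` partial derivatives contribute equally. -/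
theorem IsSymmForm.fderiv_diag {n : ℕ}
    {T : ContinuousMultilinearMap ℝ (fun _ : Fin (n + 1) => E) F} (hT : IsSymmForm T) (x w : E) :
    fderiv ℝ (fun y => T (fun _ => y)) x w = ((n : ℝ) + 1) • T (Fin.snoc (fun _ => x) w) := by
  have h1 : HasFDerivAt (fun y : E => (fun _ : Fin (n + 1) => y))
      (ContinuousLinearMap.pi fun _ => ContinuousLinearMap.id ℝ E) x :=
    hasFDerivAt_pi.2 fun _ => hasFDerivAt_id x
  have h2 := (T.hasFDerivAt (fun _ => x)).comp x h1
  have h3 : fderiv ℝ (fun y => T (fun _ => y)) x = _ := h2.fderiv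
  rw [h3]
  simp only [ContinuousLinearMap.comp_apply, ContinuousMultilinearMap.linearDeriv_apply]
  rw [Finset.sum_congr rfl (fun i _ => hT.update_diag x _ i)]
  simp only [ContinuousLinearMap.coe_pi', ContinuousLinearMap.coe_id', id_eq, Finset.sum_const,
    Finset.card_univ, Fintype.card_fin]
  rw [← Nat.cast_smul_eq_nsmul ℝ]
  push_cast
  rfl

theorem contDiff_diag {n : ℕ} {m : WithTop ℕ∞}
    (T : ContinuousMultilinearMap ℝ (fun _ : Fin n => E) F) :
    ContDiff ℝ m (fun y : E => T (fun _ => y)) :=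
  T.contDiff.comp (contDiff_pi.2 fun _ => contDiff_id)

/-- Mean value inequality on the closed ball of radius `‖x‖`, where the derivative is bounded by `c
* ‖x‖ ^ k`. -/
theorem isLittleO_of_fderiv {g : E → F} {k : ℕ} (hg : ∀ᶠ x in 𝓝 (0 : E), DifferentiableAt ℝ g x)
    (h0 : g 0 = 0) (h : fderiv ℝ g =o[𝓝 0] fun x : E => ‖x‖ ^ k) :
    g =o[𝓝 0] fun x : E => ‖x‖ ^ (k + 1) := by
  rw [isLittleO_iff] at h ⊢
  intro c hc
  have h1 := (hg.and (h hc))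
  obtain ⟨r, hr, hb⟩ := Metric.eventually_nhds_iff_ball.1 h1
  filter_upwards [Metric.ball_mem_nhds (0 : E) hr] with x hx
  have hxr : ‖x‖ < r := by simpa using hx
  have := Convex.norm_image_sub_le_of_norm_fderiv_le (𝕜 := ℝ) (f := g) (C := c * ‖x‖ ^ k)
    (s := Metric.closedBall 0 ‖x‖) (x := 0) (y := x)
    (fun y hy => (hb y (by
      have : ‖y‖ ≤ ‖x‖ := by simpa using hy
      simpa using this.trans_lt hxr)).1)
    (fun y hy => by
      have hy' : ‖y‖ ≤ ‖x‖ := by simpa using hy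
      refine ((hb y (by simpa using hy'.trans_lt hxr)).2).trans ?_
      simp only [norm_pow, norm_norm]
      gcongr)
    (convex_closedBall _ _) (by simp) (by simp)
  rw [h0, sub_zero, sub_zero] at this
  simp only [norm_pow, norm_norm]
  rw [pow_succ, ← mul_assoc]
  exact this

/-- Taylor's formula with Peano remainder for a function whose derivatives of order less than `k`
vanish. -/
theorem taylor_peano {k : ℕ} {f : E → F} (hf : ContDiffAt ℝ k f 0)
    (h0 : ∀ i < k, iteratedFDeriv ℝ i f 0 = 0) :
    (fun x => f x - ((k.factorial : ℝ)⁻¹) • iteratedFDeriv ℝ k f 0 (fun _ => x))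
      =o[𝓝 0] fun x : E => ‖x‖ ^ k := by
  induction k generalizing F with
  | zero =>
    simp only [Nat.factorial_zero, Nat.cast_one, inv_one, one_smul, iteratedFDeriv_zero_apply,
      pow_zero]
    rw [isLittleO_one_iff, tendsto_sub_nhds_zero_iff]
    exact hf.continuousAt
  | succ k ih =>
    have hfd : ContDiffAt ℝ k (fderiv ℝ f) 0 := hf.fderiv_right (by norm_cast)
    have hz : ∀ i < k, iteratedFDeriv ℝ i (fderiv ℝ f) 0 = 0 := by
      intro i hi
      ext v w
      have := iteratedFDeriv_succ_apply_right (𝕜 := ℝ) (f := f) (x := 0)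
        (Fin.snoc v w : Fin (i + 1) → E)
      rw [h0 (i + 1) (by omega)] at this
      simpa using this.symm
    have hI := ih hfd hz
    set T := iteratedFDeriv ℝ (k + 1) f 0 with hT
    have hTs : IsSymmForm T := isSymmForm_iteratedFDeriv hf
    have hdiff : ∀ᶠ x in 𝓝 (0 : E), DifferentiableAt ℝ f x := by
      have := hf.eventually (by simp)
      exact this.mono fun x hx => hx.differentiableAt (by norm_cast)
    have hdT : ∀ x, DifferentiableAt ℝ
        (fun x => (((k + 1).factorial : ℝ)⁻¹) • T (fun _ => x)) x := fun x =>
      (((contDiff_diag (m := 1) T).differentiable (by simp)) x).const_smul _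
    -- The derivative of the remainder of `f` is the remainder of order `k` of `fderiv ℝ f`: the
    -- factor `k + 1` from differentiating the diagonal turns `1 / (k+1)!` into `1 / k!`.
    refine isLittleO_of_fderiv (hdiff.mono fun x hx => hx.sub (hdT x)) ?_ ?_
    · have h00 : f 0 = 0 := by
        have := h0 0 (by omega)
        have := congrArg (fun B => B (fun _ => (0 : E))) this
        simpa using this
      rw [h00]
      have : T (fun _ => 0) = 0 := T.map_coord_zero 0 rfl
      rw [this]; simp
    · refine hI.congr' ?_ Filter.EventuallyEq.rfl
      filter_upwards [hdiff] with x hx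
      rw [fderiv_fun_sub hx (hdT x)]
      congr 1
      ext w
      rw [fderiv_fun_const_smul (((contDiff_diag (m := 1) T).differentiable (by simp)) x)]
      simp only [smul_apply]
      rw [hTs.fderiv_diag, hT, iteratedFDeriv_succ_apply_right, Nat.factorial_succ, smul_smul]
      simp only [Fin.init_snoc, Fin.snoc_last]
      congr 1
      push_cast
      field_simp

/-- A `C^k` function that vanishes to order `k` has zero `k`-jet. -/
theorem iteratedFDeriv_eq_zero_of_isLittleO {k : ℕ} {g : E → F} (hg : ContDiffAt ℝ k g 0)
    (h : g =o[𝓝 0] fun x : E => ‖x‖ ^ k) {i : ℕ} (hi : i ≤ k) : iteratedFDeriv ℝ i g 0 = 0 := by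
  induction i using Nat.strong_induction_on with
  | _ i ih =>
    have hgi : ContDiffAt ℝ i g 0 := hg.of_le (by exact_mod_cast hi)
    have h1 := taylor_peano hgi (fun j hj => ih j hj (by omega))
    have h2 : g =o[𝓝 0] fun x : E => ‖x‖ ^ i := by
      refine h.trans_isBigO (IsBigO.of_bound 1 ?_)
      filter_upwards [Metric.ball_mem_nhds (0 : E) one_pos] with x hx
      have hx : ‖x‖ ≤ 1 := by simpa using (show ‖x‖ < 1 by simpa using hx).le
      simp only [norm_pow, norm_norm, one_mul]
      exact pow_le_pow_of_le_one (norm_nonneg _) hx hi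
    have h3 : (fun x => ((i.factorial : ℝ)⁻¹) • iteratedFDeriv ℝ i g 0 (fun _ => x))
        =o[𝓝 0] fun x : E => ‖x‖ ^ i := by
      simpa using h2.sub h1
    set T := iteratedFDeriv ℝ i g 0
    have hTs : IsSymmForm T := isSymmForm_iteratedFDeriv hgi
    refine hTs.ext (C := 0) (fun _ _ => rfl) fun x => ?_
    have hlim : Filter.Tendsto (fun t : ℝ => t • x) (𝓝 0) (𝓝 0) := by
      have : Continuous fun t : ℝ => t • x := by fun_prop
      simpa using this.tendsto 0
    have h4 := (h3.comp_tendsto hlim)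
    -- A homogeneous term of degree `i` that is `o(‖x‖^i)` vanishes: evaluate at `t • x` for some
    -- small `t > 0` and divide by `t ^ i`.
    have h5 : ∀ c > 0, ‖((i.factorial : ℝ)⁻¹) • T (fun _ => x)‖ ≤ c * ‖x‖ ^ i := by
      intro c hc
      have h6 := (h4.def hc)
      have h7 : ∀ᶠ t : ℝ in 𝓝[>] 0, ‖(((fun x => ((i.factorial : ℝ)⁻¹) • T (fun _ => x)) ∘
          fun t : ℝ => t • x) t)‖ ≤ c * ‖((fun x : E => ‖x‖ ^ i) ∘ fun t : ℝ => t • x) t‖ :=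
        h6.filter_mono nhdsWithin_le_nhds
      obtain ⟨t, ht, htp⟩ := (h7.and self_mem_nhdsWithin).exists
      have htp : 0 < t := htp
      simp only [Function.comp] at ht
      rw [T.map_smul_univ (fun _ => t) (fun _ => x)] at ht
      simp only [Finset.prod_const, Finset.card_univ, Fintype.card_fin, norm_smul, norm_pow,
        norm_mul, norm_norm, mul_pow] at ht
      rw [norm_smul]
      have hti : 0 < ‖t‖ ^ i := pow_pos (norm_pos_iff.2 htp.ne') i
      refine le_of_mul_le_mul_left ?_ hti
      calc _ = _ := by ring
        _ ≤ _ := ht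
        _ = _ := by ring
    have h8 : ‖((i.factorial : ℝ)⁻¹) • T (fun _ => x)‖ ≤ 0 := by
      have hl : Filter.Tendsto (fun c : ℝ => c * ‖x‖ ^ i) (𝓝[>] 0) (𝓝 0) := by
        have : Continuous fun c : ℝ => c * ‖x‖ ^ i := by fun_prop
        have := this.tendsto 0
        rw [zero_mul] at this
        exact this.mono_left nhdsWithin_le_nhds
      exact ge_of_tendsto hl (Filter.eventually_of_mem self_mem_nhdsWithin fun c hc => h5 c hc)
    have h9 := norm_le_zero_iff.1 h8
    rw [smul_eq_zero] at h9
    rcases h9 with h9 | h9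
    · exact absurd h9 (by positivity)
    · simpa using h9

theorem isBigO_diag {k : ℕ} (T : ContinuousMultilinearMap ℝ (fun _ : Fin k => E) F) :
    (fun x => T (fun _ => x)) =O[𝓝 0] fun x : E => ‖x‖ ^ k := by
  refine IsBigO.of_bound ‖T‖ (Filter.Eventually.of_forall fun x => ?_)
  have := T.le_opNorm (fun _ => x)
  simpa using this

theorem iteratedFDeriv_diag_of_lt {k i : ℕ} (hi : i < k)
    (T : ContinuousMultilinearMap ℝ (fun _ : Fin k => E) F) :
    iteratedFDeriv ℝ i (fun x => T (fun _ => x)) 0 = 0 := by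
  refine iteratedFDeriv_eq_zero_of_isLittleO (contDiff_diag T).contDiffAt ?_ le_rfl
  exact (isBigO_diag T).trans_isLittleO (isLittleO_norm_pow_norm_pow hi)

theorem IsSymmForm.iteratedFDeriv_diag {k : ℕ}
    {T : ContinuousMultilinearMap ℝ (fun _ : Fin k => E) F} (hT : IsSymmForm T) (x : E) :
    iteratedFDeriv ℝ k (fun x => T (fun _ => x)) x = (k.factorial : ℝ) • T := by
  ext v
  rw [ContinuousMultilinearMap.iteratedFDeriv_comp_diagonal]
  simp_rw [show ∀ σ : Equiv.Perm (Fin k), (T fun i => v (σ i)) = T v from fun σ => hT σ v]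
  simp [Fintype.card_perm, Nat.cast_smul_eq_nsmul]

/-- The derivatives of a map that agrees to order `k` with the sum of a smooth map and a
homogeneous polynomial map of degree `k`. -/
theorem iteratedFDeriv_of_expansion {k : ℕ} {f g : E → F} (hf : ContDiffAt ℝ k f 0)
    (hg : ContDiffAt ℝ k g 0)
    {T : ContinuousMultilinearMap ℝ (fun _ : Fin k => E) F} (hT : IsSymmForm T)
    (h : (fun x => f x - g x - ((k.factorial : ℝ)⁻¹) • T (fun _ => x))
      =o[𝓝 0] fun x : E => ‖x‖ ^ k) :
    (∀ i < k, iteratedFDeriv ℝ i f 0 = iteratedFDeriv ℝ i g 0) ∧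
      iteratedFDeriv ℝ k f 0 = iteratedFDeriv ℝ k g 0 + T := by
  have hQ : ContDiff ℝ k (fun x : E => ((k.factorial : ℝ)⁻¹) • T (fun _ => x)) :=
    contDiff_const.smul (contDiff_diag T)
  have key : ∀ i ≤ k, iteratedFDeriv ℝ i f 0 = iteratedFDeriv ℝ i g 0 +
      iteratedFDeriv ℝ i (fun x : E => ((k.factorial : ℝ)⁻¹) • T (fun _ => x)) 0 := by
    intro i hi
    have hik : (i : WithTop ℕ∞) ≤ k := by exact_mod_cast hi
    have h1 := iteratedFDeriv_eq_zero_of_isLittleO ((hf.sub hg).sub hQ.contDiffAt) h hi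
    have h2 := iteratedFDeriv_sub_apply ((hf.sub hg).of_le hik) (hQ.contDiffAt.of_le hik)
    have h3 := iteratedFDeriv_sub_apply (hf.of_le hik) (hg.of_le hik)
    have h1' : iteratedFDeriv ℝ i ((fun x => f x - g x) -
      fun x : E => ((k.factorial : ℝ)⁻¹) • T (fun _ => x)) 0 = 0 := h1
    rw [h1'] at h2
    have h2' := sub_eq_zero.1 h2.symm
    have h3' : iteratedFDeriv ℝ i (fun x => f x - g x) 0 = _ := h3
    rw [h3'] at h2'
    rw [← h2']; abel
  have hsm : ∀ i ≤ k, iteratedFDeriv ℝ i (fun x : E => ((k.factorial : ℝ)⁻¹) • T (fun _ => x)) 0 =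
      ((k.factorial : ℝ)⁻¹) • iteratedFDeriv ℝ i (fun x : E => T (fun _ => x)) 0 := fun i hi =>
    iteratedFDeriv_const_smul_apply (contDiff_diag T).contDiffAt
  refine ⟨fun i hi => ?_, ?_⟩
  · rw [key i hi.le, hsm i hi.le, iteratedFDeriv_diag_of_lt hi]; simp
  · rw [key k le_rfl, hsm k le_rfl, hT.iteratedFDeriv_diag, smul_smul, inv_mul_cancel₀, one_smul]
    positivity

end Taylor

end ManeJets


namespace ManeJets

universe u

/-! ### Composition operators on spaces of continuous functions -/

section CompositionOperator

variable {X : Type*} [TopologicalSpace X] [CompactSpace X]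
  {E F : Type u} [NormedAddCommGroup E] [NormedSpace ℝ E] [NormedAddCommGroup F] [NormedSpace ℝ F]

/-- Pointwise application of a continuous family of operators to continuous functions. -/
noncomputable def pointwiseApply :
    C(X, E →L[ℝ] F) →L[ℝ] C(X, E) →L[ℝ] C(X, F) :=
  LinearMap.mkContinuous₂
    (LinearMap.mk₂ ℝ
      (fun (A : C(X, E →L[ℝ] F)) (h : C(X, E)) => (⟨fun x => A x (h x), by fun_prop⟩ : C(X, F)))
      (fun _ _ _ => by ext; simp) (fun _ _ _ => by ext; simp)
      (fun _ _ _ => by ext; simp) (fun _ _ _ => by ext; simp)) 1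
    (fun A h => by
      rw [one_mul]
      refine (ContinuousMap.norm_le _ (mul_nonneg (norm_nonneg A) (norm_nonneg h))).2 fun x => ?_
      exact (A x).le_of_opNorm_le_of_le (A.norm_coe_le_norm x) (h.norm_coe_le_norm x))

@[simp]
theorem pointwiseApply_apply (A : C(X, E →L[ℝ] F)) (h : C(X, E)) (x : X) :
    pointwiseApply A h x = A x (h x) := rfl

/-- The derivative of a `C¹` function, as a continuous map. -/
noncomputable def fderivMap (f : C(E, F)) (hf : ContDiff ℝ 1 f) : C(E, E →L[ℝ] F) :=
  ⟨fderiv ℝ f, hf.continuous_fderiv (by simp)⟩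

@[simp]
theorem fderivMap_apply (f : C(E, F)) (hf : ContDiff ℝ 1 f) (x : E) :
    fderivMap f hf x = fderiv ℝ f x := rfl

theorem hasFDerivAt_comp (f : C(E, F)) (hf : ContDiff ℝ 1 f) (η : C(X, E)) :
    HasFDerivAt (fun η : C(X, E) => f.comp η) (pointwiseApply ((fderivMap f hf).comp η)) η := by
  rw [hasFDerivAt_iff_isLittleO_nhds_zero, Asymptotics.isLittleO_iff]
  intro c hc
  have hcont : Continuous fun η : C(X, E) => (fderivMap f hf).comp η :=
    ContinuousMap.continuous_postcomp _
  have h1 := (hcont.tendsto η).eventually (Metric.closedBall_mem_nhds ((fderivMap f hf).comp η) hc)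
  obtain ⟨r, hr, hb⟩ := Metric.eventually_nhds_iff_ball.1 h1
  filter_upwards [Metric.ball_mem_nhds (0 : C(X, E)) hr] with h hh
  have hhr : ‖h‖ < r := by simpa using hh
  refine (ContinuousMap.norm_le _ (by positivity)).2 fun x => ?_
  have hx : ‖h x‖ < r := (h.norm_coe_le_norm x).trans_lt hhr
  -- A bound uniform in `x`, for `E` of any dimension: the continuity of postcomposition with
  -- `fderiv ℝ f` is tested on the translate of `η` by the constant `y - η x`.
  have key : ∀ y ∈ Metric.ball (η x) r, ‖fderiv ℝ f y - fderiv ℝ f (η x)‖ ≤ c := by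
    intro y hy
    have h2 : (η + ContinuousMap.const X (y - η x)) ∈ Metric.ball η r := by
      rw [mem_ball_iff_norm, add_sub_cancel_left]
      refine (ContinuousMap.norm_lt_iff _ hr).2 fun _ => ?_
      simpa [dist_eq_norm] using hy
    have h3 := hb _ h2
    have h4 := (ContinuousMap.dist_le hc.le).1 h3 x
    simpa [dist_eq_norm] using h4
  have := Convex.norm_image_sub_le_of_norm_fderiv_le' (𝕜 := ℝ) (f := f) (C := c)
    (s := Metric.ball (η x) r) (x := η x) (y := η x + h x) (φ := fderiv ℝ f (η x))
    (fun y _ => (hf.differentiable (by simp)) y) key (convex_ball _ _)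
    (Metric.mem_ball_self hr) (by simpa using hx)
  rw [add_sub_cancel_left] at this
  calc _ = ‖f (η x + h x) - f (η x) - (fderiv ℝ f (η x)) (h x)‖ := by simp
    _ ≤ c * ‖h x‖ := this
    _ ≤ c * ‖h‖ := by gcongr; exact h.norm_coe_le_norm x

/-- The derivative is again a composition operator, that of `fderiv ℝ f`, followed by the bounded
linear map `pointwiseApply`. The induction generalizes `F` because the target becomes `E →L[ℝ] F`.
-/
theorem contDiff_comp_nat (n : ℕ) (f : C(E, F)) (hf : ContDiff ℝ n f) :
    ContDiff ℝ n (fun η : C(X, E) => f.comp η) := by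
  induction n generalizing F with
  | zero =>
    exact contDiff_zero.2 (ContinuousMap.continuous_postcomp f)
  | succ n ih =>
    have h1 : ContDiff ℝ 1 f := hf.of_le (by norm_cast; omega)
    have h2 : ContDiff ℝ n (fderivMap f h1) := by
      have : ContDiff ℝ n (fderiv ℝ f) := hf.fderiv_right (by norm_cast)
      exact this
    rw [show ((n + 1 : ℕ) : WithTop ℕ∞) = (n : WithTop ℕ∞) + 1 by norm_cast,
      contDiff_succ_iff_fderiv]
    refine ⟨fun η => (hasFDerivAt_comp f h1 η).differentiableAt, by simp, ?_⟩
    have : fderiv ℝ (fun η : C(X, E) => f.comp η) =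
        fun η => pointwiseApply ((fderivMap f h1).comp η) :=
      funext fun η => (hasFDerivAt_comp f h1 η).fderiv
    rw [this]
    exact pointwiseApply.contDiff.comp (ih _ h2)

/-- Composition on the left with a `C^n` map is a `C^n` map between spaces of continuous
functions. -/
theorem contDiff_comp {n : ℕ∞} (f : C(E, F)) (hf : ContDiff ℝ n f) :
    ContDiff ℝ n (fun η : C(X, E) => f.comp η) := by
  rw [contDiff_iff_forall_nat_le]
  intro m hm
  exact contDiff_comp_nat m f (hf.of_le (by exact_mod_cast hm))

end CompositionOperator

/-! ### Volterra operators and the solution operator of an autonomous equation -/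

section Volterra

open MeasureTheory intervalIntegral

variable {E : Type u} [NormedAddCommGroup E] [NormedSpace ℝ E]

/-- The primitive that vanishes at `0`, on the interval `[0, a]`. -/
noncomputable def primitive {a : ℝ} (ha : 0 ≤ a) :
    C(Set.Icc (0 : ℝ) a, E) →L[ℝ] C(Set.Icc (0 : ℝ) a, E) :=
  LinearMap.mkContinuous
    { toFun := fun h => ⟨fun t => ∫ r in (0 : ℝ)..t, Set.IccExtend ha h r,
        (continuous_primitive (fun _ _ => h.continuous.Icc_extend'.intervalIntegrable _ _)
          0).comp continuous_subtype_val⟩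
      map_add' := fun h g => by
        ext t
        simp only [ContinuousMap.coe_mk, ContinuousMap.add_apply]
        rw [← integral_add (h.continuous.Icc_extend'.intervalIntegrable _ _)
          (g.continuous.Icc_extend'.intervalIntegrable _ _)]
        rfl
      map_smul' := fun c h => by
        ext t
        simp only [ContinuousMap.coe_mk, ContinuousMap.smul_apply, RingHom.id_apply]
        rw [← intervalIntegral.integral_smul]
        rfl } a
    (fun h => by
      refine (ContinuousMap.norm_le _ (by positivity)).2 fun t => ?_
      have := norm_integral_le_of_norm_le_const (a := 0) (b := (t : ℝ)) (C := ‖h‖)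
        (f := Set.IccExtend ha h) fun r _ => h.norm_coe_le_norm _
      refine this.trans ?_
      rw [sub_zero, abs_of_nonneg t.2.1, mul_comm]
      gcongr
      exact t.2.2)

theorem primitive_apply {a : ℝ} (ha : 0 ≤ a) (h : C(Set.Icc (0 : ℝ) a, E)) (t : Set.Icc (0 : ℝ) a) :
    primitive ha h t = ∫ r in (0 : ℝ)..t, Set.IccExtend ha h r := rfl

theorem primitive_zero {a : ℝ} (ha : 0 ≤ a) (h : C(Set.Icc (0 : ℝ) a, E)) :
    primitive ha h ⟨0, le_rfl, ha⟩ = 0 := by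
  simp [primitive_apply]

theorem hasDerivWithinAt_primitive [CompleteSpace E] {a : ℝ} (ha : 0 ≤ a)
    (h : C(Set.Icc (0 : ℝ) a, E)) (t : Set.Icc (0 : ℝ) a) :
    HasDerivWithinAt (Set.IccExtend ha (primitive ha h)) (h t) (Set.Icc 0 a) t := by
  have hc : Continuous (Set.IccExtend ha h) := h.continuous.Icc_extend'
  have h1 : HasDerivAt (fun s => ∫ r in (0 : ℝ)..s, Set.IccExtend ha h r) (h t) t := by
    have := integral_hasDerivAt_right (hc.intervalIntegrable 0 t)
      (hc.stronglyMeasurableAtFilter _ _) hc.continuousAt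
    rwa [Set.IccExtend_val] at this
  refine h1.hasDerivWithinAt.congr (fun s hs => ?_) ?_
  · rw [Set.IccExtend_of_mem ha _ hs, primitive_apply]
  · rw [Set.IccExtend_val, primitive_apply]

theorem eq_primitive_of_hasDerivWithinAt [CompleteSpace E] {a : ℝ} (ha : 0 ≤ a)
    (η h : C(Set.Icc (0 : ℝ) a, E))
    (hη : ∀ t : Set.Icc (0 : ℝ) a,
      HasDerivWithinAt (Set.IccExtend ha η) (h t) (Set.Icc 0 a) t) :
    η = ContinuousMap.const _ (η ⟨0, le_rfl, ha⟩) + primitive ha h := by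
  ext t
  have hc : Continuous (Set.IccExtend ha h) := h.continuous.Icc_extend'
  have := integral_eq_sub_of_hasDeriv_right_of_le (a := 0) (b := (t : ℝ)) t.2.1
    (f := Set.IccExtend ha η) (f' := Set.IccExtend ha h)
    (η.continuous.Icc_extend'.continuousOn) (fun r hr => ?_) (hc.intervalIntegrable _ _)
  · simp only [ContinuousMap.add_apply, ContinuousMap.const_apply, primitive_apply]
    rw [this, Set.IccExtend_val, Set.IccExtend_of_mem ha _ ⟨le_rfl, ha⟩]
    abel
  · have hr' : r ∈ Set.Icc 0 a := ⟨hr.1.le, hr.2.le.trans t.2.2⟩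
    have h1 := hη ⟨r, hr'⟩
    rw [Set.IccExtend_of_mem ha _ hr']
    refine (h1.hasDerivAt (Icc_mem_nhds hr.1 (hr.2.trans_le t.2.2))).hasDerivWithinAt

/-- The Volterra operator with kernel `A`. -/
noncomputable def volterra {a : ℝ} (ha : 0 ≤ a) (A : C(Set.Icc (0 : ℝ) a, E →L[ℝ] E)) :
    C(Set.Icc (0 : ℝ) a, E) →L[ℝ] C(Set.Icc (0 : ℝ) a, E) :=
  (primitive ha).comp (pointwiseApply A)

/-- Keeping the bound dependent on `t` is what produces the factorial: each integration of `r ^ n`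
gains a factor `1 / (n + 1)`. -/
theorem volterra_pow_bound {a : ℝ} (ha : 0 ≤ a) (A : C(Set.Icc (0 : ℝ) a, E →L[ℝ] E)) (n : ℕ)
    (h : C(Set.Icc (0 : ℝ) a, E)) (t : Set.Icc (0 : ℝ) a) :
    ‖(volterra ha A ^ n) h t‖ ≤ (‖A‖ * t) ^ n / n.factorial * ‖h‖ := by
  induction n generalizing t with
  | zero => simpa using h.norm_coe_le_norm t
  | succ n ih =>
    rw [pow_succ', mul_apply_eq_comp, volterra, ContinuousLinearMap.comp_apply,
      primitive_apply]
    have hb : ∀ r ∈ Set.Icc (0 : ℝ) t, ‖Set.IccExtend ha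
        (pointwiseApply A ((volterra ha A ^ n) h)) r‖ ≤
          (‖A‖ ^ (n + 1) / n.factorial * ‖h‖) * r ^ n := by
      intro r hr
      have hr' : r ∈ Set.Icc 0 a := ⟨hr.1, hr.2.trans t.2.2⟩
      rw [Set.IccExtend_of_mem ha _ hr', pointwiseApply_apply]
      refine ((A _).le_of_opNorm_le_of_le (A.norm_coe_le_norm _) (ih ⟨r, hr'⟩)).trans ?_
      rw [mul_pow, pow_succ]
      apply le_of_eq
      ring
    have := norm_integral_le_of_norm_le t.2.1 (f := Set.IccExtend ha
        (pointwiseApply A ((volterra ha A ^ n) h)))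
        (g := fun r => (‖A‖ ^ (n + 1) / n.factorial * ‖h‖) * r ^ n)
        (μ := volume) (Filter.Eventually.of_forall fun r hr => hb r ⟨hr.1.le, hr.2⟩)
        ((by fun_prop : Continuous _).intervalIntegrable _ _)
    refine this.trans (le_of_eq ?_)
    rw [intervalIntegral.integral_const_mul, integral_pow, Nat.factorial_succ]
    push_cast
    field_simp
    ring

/-- Some power of the operator has norm less than one, whatever the length of the interval. Then `1
- volterra ^ N` is invertible, and `1 - volterra` is a commuting factor of it through the geometric
sum. -/
theorem isUnit_one_sub_volterra [CompleteSpace E] {a : ℝ} (ha : 0 ≤ a)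
    (A : C(Set.Icc (0 : ℝ) a, E →L[ℝ] E)) : IsUnit (1 - volterra ha A) := by
  have h1 : ∀ n : ℕ, ‖volterra ha A ^ n‖ ≤ (‖A‖ * a) ^ n / n.factorial := by
    intro n
    refine ContinuousLinearMap.opNorm_le_bound _ (by positivity) fun h => ?_
    refine (ContinuousMap.norm_le _ (by positivity)).2 fun t => ?_
    refine (volterra_pow_bound ha A n h t).trans ?_
    have := t.2.1
    gcongr
    exact t.2.2
  have h2 := FloorSemiring.tendsto_pow_div_factorial_atTop (‖A‖ * a)
  obtain ⟨N, hN⟩ := (h2.eventually (gt_mem_nhds one_pos)).exists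
  have h3 : IsUnit (1 - volterra ha A ^ N) :=
    (Units.oneSub (volterra ha A ^ N) ((h1 N).trans_lt hN)).isUnit
  have h4 : (1 - volterra ha A) * ∑ i ∈ Finset.range N, volterra ha A ^ i =
      1 - volterra ha A ^ N := mul_neg_geom_sum _ _
  have h5 : Commute (1 - volterra ha A) (∑ i ∈ Finset.range N, volterra ha A ^ i) :=
    (Commute.sum_right _ _ _ fun i _ =>
      ((Commute.one_left _).sub_left ((Commute.refl _).pow_right _)))
  rw [← h4, h5.isUnit_mul_iff] at h3
  exact h3.1

/-- The defect of a path as a solution of the integral equation of the vector field `X`. -/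
noncomputable def odeDefect {a : ℝ} (ha : 0 ≤ a) (X : C(E, E)) (η : C(Set.Icc (0 : ℝ) a, E)) :
    C(Set.Icc (0 : ℝ) a, E) :=
  η - primitive ha (X.comp η)

/-- The solution operator of the integral equation `η = b + ∫ X(η)` near a given path. -/
theorem exists_solution_operator [CompleteSpace E] {a : ℝ} (ha : 0 ≤ a) {k : ℕ} (hk : 1 ≤ k)
    (X : C(E, E)) (hX : ContDiff ℝ k X) (hX1 : ContDiff ℝ 1 X) (θ : C(Set.Icc (0 : ℝ) a, E)) :
    ∃ G : C(Set.Icc (0 : ℝ) a, E) → C(Set.Icc (0 : ℝ) a, E),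
      ContDiffAt ℝ k G (odeDefect ha X θ) ∧ G (odeDefect ha X θ) = θ ∧
      (∀ᶠ b in 𝓝 (odeDefect ha X θ), odeDefect ha X (G b) = b) ∧
      (∀ᶠ η in 𝓝 θ, G (odeDefect ha X η) = η) ∧
      ∀ b, fderiv ℝ G (odeDefect ha X θ) b = b + primitive ha
        (pointwiseApply ((fderivMap X hX1).comp θ) (fderiv ℝ G (odeDefect ha X θ) b)) := by
  have hk0 : (k : WithTop ℕ∞) ≠ 0 := by
    have : k ≠ 0 := by omega
    exact_mod_cast this
  have hS : ContDiff ℝ k (odeDefect ha X) :=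
    contDiff_id.sub ((primitive ha).contDiff.comp (contDiff_comp_nat k X hX))
  have hd : HasFDerivAt (odeDefect ha X)
      (1 - volterra ha ((fderivMap X hX1).comp θ)) θ := by
    have h1 : HasFDerivAt (fun η => primitive ha (X.comp η))
        (volterra ha ((fderivMap X hX1).comp θ)) θ :=
      ((primitive (E := E) ha).hasFDerivAt (x := X.comp θ)).comp θ (hasFDerivAt_comp X hX1 θ)
    exact (hasFDerivAt_id θ).sub h1
  -- Invertibility of the derivative on the whole of `[0, a]` allows a single application of the
  -- inverse function theorem, without a subdivision of the interval. The last clause of the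
  -- statement is the integrated linearized equation.
  obtain ⟨U, hU⟩ := isUnit_one_sub_volterra ha ((fderivMap X hX1).comp θ)
  set L := ContinuousLinearEquiv.ofUnit U
  have hL : (L : _ →L[ℝ] _) = 1 - volterra ha ((fderivMap X hX1).comp θ) := by
    rw [← hU]; rfl
  have hd' : HasFDerivAt (odeDefect ha X)
      (L : C(Set.Icc (0 : ℝ) a, E) →L[ℝ] C(Set.Icc (0 : ℝ) a, E)) θ := by rwa [hL]
  have hSa : ContDiffAt ℝ k (odeDefect ha X) θ := hS.contDiffAt
  have hs := hSa.hasStrictFDerivAt' hd' hk0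
  refine ⟨hSa.localInverse hd' hk0, hSa.to_localInverse hd' hk0,
    hSa.localInverse_apply_image hd' hk0, hs.eventually_right_inverse,
    hs.eventually_left_inverse, ?_⟩
  set G := hSa.localInverse hd' hk0
  have hG : HasFDerivAt G (L.symm : _ →L[ℝ] _) (odeDefect ha X θ) :=
    hs.to_localInverse.hasFDerivAt
  intro b
  rw [hG.fderiv]
  have h1 : L (L.symm b) = b := L.apply_symm_apply b
  have h2 : L (L.symm b) = L.symm b - volterra ha ((fderivMap X hX1).comp θ) (L.symm b) := by
    have := congrArg (fun T : C(Set.Icc (0 : ℝ) a, E) →L[ℝ] C(Set.Icc (0 : ℝ) a, E) =>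
      T (L.symm b)) hL
    simpa using this
  rw [h1] at h2
  exact (eq_add_of_sub_eq h2.symm)

end Volterra

end ManeJets


namespace ManeJets

universe u

/-! ### First order perturbation of the solutions -/

section Perturbation

open Asymptotics

variable {E E' : Type u} [NormedAddCommGroup E] [NormedSpace ℝ E] [NormedAddCommGroup E']

/-- A homogeneous polynomial map, applied to two curves that are equal to first order. -/
theorem isLittleO_diag_sub {F : Type u} [NormedAddCommGroup F] [NormedSpace ℝ F] {k : ℕ}
    (T : ContinuousMultilinearMap ℝ (fun _ : Fin k => E) F) {x y : E' → E}
    (hx : x =O[𝓝 0] fun h : E' => ‖h‖) (hy : y =O[𝓝 0] fun h : E' => ‖h‖)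
    (hxy : (fun h => x h - y h) =o[𝓝 0] fun h : E' => ‖h‖) :
    (fun h => T (fun _ => x h) - T (fun _ => y h)) =o[𝓝 0] fun h : E' => ‖h‖ ^ k := by
  obtain _ | k := k
  · have : (fun h => T (fun _ => x h) - T (fun _ => y h)) = fun _ => 0 := by
      ext h
      rw [sub_eq_zero]
      congr 1
      ext i
      exact i.elim0
    rw [this]
    exact isLittleO_zero _ _
  obtain ⟨c, hc, hcx⟩ := hx.exists_pos
  obtain ⟨d, hd, hdy⟩ := hy.exists_pos
  have hb : (fun h => T (fun _ => x h) - T (fun _ => y h)) =O[𝓝 0]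
      fun h : E' => ‖h‖ ^ k * ‖x h - y h‖ := by
    refine IsBigO.of_bound (‖T‖ * (k + 1) * (max c d) ^ k) ?_
    filter_upwards [hcx.bound, hdy.bound] with h h1 h2
    rw [norm_norm] at h1 h2
    have h3 := T.norm_image_sub_le (fun _ => x h) (fun _ => y h)
    refine h3.trans ?_
    simp only [Fintype.card_fin, Nat.add_sub_cancel, norm_mul, norm_pow, norm_norm]
    have h4 : ‖(fun _ : Fin (k + 1) => x h) - fun _ => y h‖ ≤ ‖x h - y h‖ :=
      (pi_norm_le_iff_of_nonneg (norm_nonneg _)).2 fun _ => le_rfl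
    have h5 : max ‖fun _ : Fin (k + 1) => x h‖ ‖fun _ : Fin (k + 1) => y h‖ ≤
        max c d * ‖h‖ := by
      refine max_le ((pi_norm_le_iff_of_nonneg (by positivity)).2 fun _ => h1.trans ?_)
        ((pi_norm_le_iff_of_nonneg (by positivity)).2 fun _ => h2.trans ?_)
      · gcongr; exact le_max_left _ _
      · gcongr; exact le_max_right _ _
    push_cast
    calc _ ≤ ‖T‖ * (k + 1) * (max c d * ‖h‖) ^ k * ‖x h - y h‖ := by gcongr
      _ = _ := by ring
  refine hb.trans_isLittleO ?_
  simp_rw [pow_succ]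
  exact (isBigO_refl _ _).mul_isLittleO hxy.norm_left

variable [NormedSpace ℝ E'] {a : ℝ}

variable (a) in
/-- The constant paths, as a linear function of their value. -/
noncomputable def constPath : E →L[ℝ] C(Set.Icc (0 : ℝ) a, E) :=
  LinearMap.mkContinuous
    { toFun := fun v => ContinuousMap.const _ v
      map_add' := fun _ _ => rfl
      map_smul' := fun _ _ => rfl } 1
    (fun v => (ContinuousMap.norm_le _ (by positivity)).2 fun _ => by
      rw [one_mul]; exact le_rfl)

theorem constPath_apply (v : E) : constPath a v = ContinuousMap.const _ v := rfl

/-- The first order effect, on the solutions with given initial values, of a perturbation of a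
vector field that vanishes to order `k` along a solution. -/
theorem perturbed_solution_expansion (ha : 0 ≤ a) {k : ℕ} (hk : 2 ≤ k) {X Xu : C(E, E)}
    {θ : C(Set.Icc (0 : ℝ) a, E)} {z₀ : E}
    {G : C(Set.Icc (0 : ℝ) a, E) → C(Set.Icc (0 : ℝ) a, E)}
    {D : C(Set.Icc (0 : ℝ) a, E) →L[ℝ] C(Set.Icc (0 : ℝ) a, E)}
    (hG : HasStrictFDerivAt G D (ContinuousMap.const _ z₀))
    (hGθ : G (ContinuousMap.const _ z₀) = θ)
    (hGr : ∀ᶠ η in 𝓝 θ, G (odeDefect ha X η) = η)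
    {p : E' → E} {p' : E' →L[ℝ] E} (hp : HasFDerivAt p p' 0) (hp0 : p 0 = z₀)
    {ηu : E' → C(Set.Icc (0 : ℝ) a, E)} {ηu' : E' →L[ℝ] C(Set.Icc (0 : ℝ) a, E)}
    (hηu' : HasFDerivAt ηu ηu' 0) (hηu0 : ηu 0 = θ)
    (hηu : ∀ᶠ h in 𝓝 0, odeDefect ha Xu (ηu h) = ContinuousMap.const _ (p h))
    (T : ContinuousMultilinearMap ℝ (fun _ : Fin k => C(Set.Icc (0 : ℝ) a, E))
      C(Set.Icc (0 : ℝ) a, E))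
    (hT : (fun v : C(Set.Icc (0 : ℝ) a, E) => Xu.comp (θ + v) - X.comp (θ + v) -
      T (fun _ => v)) =o[𝓝 0] fun v => ‖v‖ ^ k) :
    (fun h => ηu h - G (ContinuousMap.const _ (p h)) -
      D (primitive ha (T fun _ => D (ContinuousMap.const _ (p' h))))) =o[𝓝 0]
        fun h : E' => ‖h‖ ^ k := by
  have hk0 : (fun h : E' => ‖h‖ ^ k) =o[𝓝 0] fun h : E' => ‖h‖ := by
    simpa using isLittleO_norm_pow_norm_pow (E' := E') (show 1 < k by omega)
  set Z : E' → C(Set.Icc (0 : ℝ) a, E) := fun h => Xu.comp (ηu h) - X.comp (ηu h) with hZ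
  set m : E' →L[ℝ] C(Set.Icc (0 : ℝ) a, E) := D.comp ((constPath a).comp p') with hm
  have hcont : Filter.Tendsto ηu (𝓝 0) (𝓝 θ) := by
    simpa [hηu0] using hηu'.continuousAt.tendsto
  -- A perturbed solution solves the unperturbed integral equation with `∫ Z` added to the initial
  -- value, `Z` being the perturbation evaluated along it.
  have h1 : ∀ᶠ h in 𝓝 0, ηu h = G (constPath a (p h) + primitive ha (Z h)) := by
    filter_upwards [hηu, hcont.eventually hGr] with h h1 h2
    have : odeDefect ha X (ηu h) = constPath a (p h) + primitive ha (Z h) := by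
      rw [constPath_apply, ← h1, hZ, odeDefect, odeDefect, map_sub]
      abel
    rw [← this, h2]
  have h2 : (fun h => ηu h - θ) =O[𝓝 0] fun h : E' => ‖h‖ := by
    simpa [hηu0] using hηu'.isBigO_sub.norm_right
  have h3 : (fun h => Z h - T fun _ => ηu h - θ) =o[𝓝 0] fun h : E' => ‖h‖ ^ k := by
    have ht : Filter.Tendsto (fun h => ηu h - θ) (𝓝 0) (𝓝 0) := by
      simpa using hcont.sub_const θ
    have := hT.comp_tendsto ht
    refine (IsLittleO.trans_isBigO ?_ (h2.norm_left.pow k))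
    refine this.congr_left fun h => ?_
    simp [hZ]
  have h4 : Z =O[𝓝 0] fun h : E' => ‖h‖ ^ k := by
    have hT2 : (fun h => T fun _ => ηu h - θ) =O[𝓝 0] fun h : E' => ‖h‖ ^ k := by
      refine IsBigO.trans ?_ (h2.norm_left.pow k)
      refine IsBigO.of_bound ‖T‖ (Filter.Eventually.of_forall fun h => ?_)
      have := T.le_opNorm (fun _ => ηu h - θ)
      simpa using this
    refine (h3.isBigO.add hT2).congr_left fun h => ?_
    simp
  have h5 : (fun h => primitive ha (Z h)) =O[𝓝 0] fun h : E' => ‖h‖ ^ k :=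
    ((primitive ha).isBigO_comp Z _).trans h4
  have hpow : Filter.Tendsto (fun h : E' => ‖h‖ ^ k) (𝓝 0) (𝓝 0) := by
    have : Continuous fun h : E' => ‖h‖ ^ k := by fun_prop
    have := this.tendsto 0
    rwa [norm_zero, zero_pow (by omega)] at this
  have hcp : Filter.Tendsto (fun h => constPath a (p h)) (𝓝 0) (𝓝 (constPath a z₀)) := by
    have := ((constPath a).continuous.tendsto (p 0)).comp hp.continuousAt.tendsto
    rwa [hp0] at this
  -- Both arguments of `G` move with `h`, so strict differentiability is needed: the error is small
  -- compared with their difference `∫ Z`, which is `O(‖h‖^k)`.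
  have h6 : (fun h => ηu h - G (constPath a (p h)) - D (primitive ha (Z h))) =o[𝓝 0]
      fun h : E' => ‖h‖ ^ k := by
    have ht : Filter.Tendsto (fun h => (constPath a (p h) + primitive ha (Z h),
        constPath a (p h))) (𝓝 0) (𝓝 (constPath a z₀, constPath a z₀)) := by
      refine Filter.Tendsto.prodMk_nhds ?_ hcp
      simpa using hcp.add (h5.trans_tendsto hpow)
    have hs := hG.isLittleO.comp_tendsto ht
    have := hs.trans_isBigO (k := fun h => primitive ha (Z h))
      (IsBigO.of_bound 1 (Filter.Eventually.of_forall fun h => by simp))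
    refine (this.trans_isBigO h5).congr' ?_ Filter.EventuallyEq.rfl
    filter_upwards [h1] with h h1
    simp only [Function.comp]
    rw [← h1]
    simp
  have h7 : (fun h => ηu h - G (constPath a (p h))) =o[𝓝 0] fun h : E' => ‖h‖ := by
    have e := h6.isBigO.add ((D.isBigO_comp _ _).trans h5)
    refine (IsBigO.trans_isLittleO ?_ hk0)
    exact e.congr_left fun h => by simp
  have h8 : (fun h => G (constPath a (p h)) - θ - m h) =o[𝓝 0] fun h : E' => ‖h‖ := by
    have hGp : HasFDerivAt (fun h => G (constPath a (p h))) m 0 := by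
      refine HasFDerivAt.comp (0 : E') (g := G) (f := fun h => constPath a (p h)) ?_ ?_
      · rw [hp0]; exact hG.hasFDerivAt
      · exact (constPath a).hasFDerivAt.comp (0 : E') hp
    have := hGp.isLittleO.norm_right
    simpa [hp0, constPath_apply, hGθ] using this
  -- To first order the perturbed solutions follow the unperturbed linearized flow `m`. Substituting
  -- `m h` in the homogeneous term `T` then costs only `o(‖h‖^k)`.
  have h9 : (fun h => (ηu h - θ) - m h) =o[𝓝 0] fun h : E' => ‖h‖ :=
    (h7.add h8).congr_left fun h => by abel
  have hmO : (fun h => m h) =O[𝓝 0] fun h : E' => ‖h‖ := (m.isBigO_id _).norm_right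
  have h10 := isLittleO_diag_sub T h2 hmO h9
  have h11 : (fun h => D (primitive ha (Z h - T fun _ => m h))) =o[𝓝 0]
      fun h : E' => ‖h‖ ^ k := by
    refine ((D.comp (primitive ha)).isBigO_comp _ _).trans_isLittleO ?_
    exact (h3.add h10).congr_left fun h => by abel
  refine (h6.add h11).congr_left fun h => ?_
  simp only [map_sub, constPath_apply]
  have : m h = D (ContinuousMap.const _ (p' h)) := rfl
  rw [this]
  abel

end Perturbation

/-! ### Conserved forms along linear equations -/

section Linear

open MeasureTheory intervalIntegral

variable {E : Type u} [NormedAddCommGroup E] [NormedSpace ℝ E] {a : ℝ}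

theorem hasDerivWithinAt_of_eq_primitive [CompleteSpace E] (ha : 0 ≤ a) {η h : C(Set.Icc (0 : ℝ) a, E)} {v : E}
    (hη : η = ContinuousMap.const _ v + primitive ha h) (t : Set.Icc (0 : ℝ) a) :
    HasDerivWithinAt (Set.IccExtend ha η) (h t) (Set.Icc 0 a) t := by
  have h1 := (hasDerivWithinAt_primitive ha h t).const_add v
  refine h1.congr (fun s hs => ?_) ?_
  · rw [hη, Set.IccExtend_of_mem ha _ hs, Set.IccExtend_of_mem ha _ hs]; rfl
  · rw [hη, Set.IccExtend_val, Set.IccExtend_val]; rfl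

theorem apply_zero_of_eq_primitive (ha : 0 ≤ a) {η h : C(Set.Icc (0 : ℝ) a, E)} {v : E}
    (hη : η = ContinuousMap.const _ v + primitive ha h) : η ⟨0, le_rfl, ha⟩ = v := by
  rw [hη, ContinuousMap.add_apply, primitive_zero]; simp

theorem sub_eq_integral_of_hasDerivWithinAt (ha : 0 ≤ a) {g : ℝ → ℝ} (g' : C(Set.Icc (0 : ℝ) a, ℝ))
    (hg : ∀ t : Set.Icc (0 : ℝ) a, HasDerivWithinAt g (g' t) (Set.Icc 0 a) t) :
    ∀ t : Set.Icc (0 : ℝ) a, g t - g 0 = ∫ r in (0 : ℝ)..t, Set.IccExtend ha g' r := by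
  intro t
  have hc : Continuous (Set.IccExtend ha g') := g'.continuous.Icc_extend'
  refine (integral_eq_sub_of_hasDeriv_right_of_le (a := 0) (b := (t : ℝ)) t.2.1
    (fun r hr => ?_) (fun r hr => ?_) (hc.intervalIntegrable _ _)).symm
  · exact ((hg ⟨r, hr.1, hr.2.trans t.2.2⟩).continuousWithinAt).mono
      (Set.Icc_subset_Icc le_rfl t.2.2)
  · have hr' : r ∈ Set.Icc 0 a := ⟨hr.1.le, hr.2.le.trans t.2.2⟩
    have h1 := hg ⟨r, hr'⟩
    rw [Set.IccExtend_of_mem ha _ hr']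
    exact (h1.hasDerivAt (Icc_mem_nhds hr.1 (hr.2.trans_le t.2.2))).hasDerivWithinAt

/-- The variation of a bilinear form along solutions of a linear equation that preserves it. -/
theorem bilinear_variation [CompleteSpace E] (ha : 0 ≤ a) (B : E →L[ℝ] E →L[ℝ] ℝ)
    (A : C(Set.Icc (0 : ℝ) a, E →L[ℝ] E)) {η₁ η₂ f : C(Set.Icc (0 : ℝ) a, E)} {v₁ v₂ : E}
    (h₁ : η₁ = ContinuousMap.const _ v₁ + primitive ha (pointwiseApply A η₁ + f))
    (h₂ : η₂ = ContinuousMap.const _ v₂ + primitive ha (pointwiseApply A η₂))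
    (hB : ∀ t, B (A t (η₁ t)) (η₂ t) + B (η₁ t) (A t (η₂ t)) = 0) (t : Set.Icc (0 : ℝ) a) :
    B (η₁ t) (η₂ t) = B v₁ v₂ +
      ∫ r in (0 : ℝ)..t, B (Set.IccExtend ha f r) (Set.IccExtend ha η₂ r) := by
  have h := sub_eq_integral_of_hasDerivWithinAt ha
    (g := fun r => B (Set.IccExtend ha η₁ r) (Set.IccExtend ha η₂ r))
    ⟨fun t => B (f t) (η₂ t), by fun_prop⟩ (fun t => ?_) t
  · simp only [Set.IccExtend_val] at h
    rw [Set.IccExtend_of_mem ha η₁ (x := 0) ⟨le_rfl, ha⟩,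
      Set.IccExtend_of_mem ha η₂ (x := 0) ⟨le_rfl, ha⟩,
      apply_zero_of_eq_primitive ha h₁, apply_zero_of_eq_primitive ha h₂] at h
    rw [sub_eq_iff_eq_add'] at h
    exact h
  · have d1 := hasDerivWithinAt_of_eq_primitive ha h₁ t
    have d2 := hasDerivWithinAt_of_eq_primitive ha h₂ t
    have d3 := (B.hasFDerivAt.comp_hasDerivWithinAt (t : ℝ) d1).clm_apply d2
    refine d3.congr_deriv ?_
    have := hB t
    simp only [ContinuousMap.add_apply, pointwiseApply_apply, map_add, add_apply,
      ContinuousMap.coe_mk, Function.comp, Set.IccExtend_val]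
    linarith

/-- The variation of a time dependent linear form along solutions of a linear equation that
preserves it. -/
theorem linear_variation [CompleteSpace E] (ha : 0 ≤ a) (κ : ℝ → E →L[ℝ] ℝ) (κ' : Set.Icc (0 : ℝ) a → E →L[ℝ] ℝ)
    (hκ : ∀ t : Set.Icc (0 : ℝ) a, HasDerivWithinAt κ (κ' t) (Set.Icc 0 a) t)
    (A : C(Set.Icc (0 : ℝ) a, E →L[ℝ] E)) {η f : C(Set.Icc (0 : ℝ) a, E)} {v : E}
    (h : η = ContinuousMap.const _ v + primitive ha (pointwiseApply A η + f))
    (hA : ∀ t x, κ' t x + κ t (A t x) = 0) (hf : ∀ t : Set.Icc (0 : ℝ) a, κ t (f t) = 0) (t : Set.Icc (0 : ℝ) a) :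
    κ t (η t) = κ 0 v := by
  have h := sub_eq_integral_of_hasDerivWithinAt ha
    (g := fun r => κ r (Set.IccExtend ha η r)) 0 (fun t => ?_) t
  · simp only [Set.IccExtend_val] at h
    rw [Set.IccExtend_of_mem ha η (x := 0) ⟨le_rfl, ha⟩, apply_zero_of_eq_primitive ha ‹_›] at h
    rw [sub_eq_iff_eq_add'] at h
    rw [h]
    simp [Set.IccExtend]
  · have d1 := hasDerivWithinAt_of_eq_primitive ha h t
    have d3 := (hκ t).clm_apply d1
    refine d3.congr_deriv ?_
    have := hA t (η t)
    have h3 := hf t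
    simp only [ContinuousMap.add_apply, pointwiseApply_apply, map_add, Set.IccExtend_val, h3,
      ContinuousMap.zero_apply]
    linarith

end Linear

end ManeJets


namespace ManeJets

open Asymptotics

/-! ### The symplectic form of the section coordinates -/

section SymplecticLinear

variable {n : ℕ}

/-- The canonical symplectic form `dx ∧ dy` of `ℝ²ⁿ`, as a linear map to the dual. -/
noncomputable def flat (n : ℕ) : Sect n →L[ℝ] Sect n →L[ℝ] ℝ :=
  LinearMap.toContinuousLinearMap
    { toFun := fun v => ∑ i : Fin n, (v (Sum.inl i) •
          (ContinuousLinearMap.proj (Sum.inr i) : Sect n →L[ℝ] ℝ) -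
          v (Sum.inr i) • (ContinuousLinearMap.proj (Sum.inl i) : Sect n →L[ℝ] ℝ))
      map_add' := fun v w => by
        rw [← Finset.sum_add_distrib]
        refine Finset.sum_congr rfl fun i _ => ?_
        simp only [Pi.add_apply, add_smul]
        abel
      map_smul' := fun c v => by
        rw [Finset.smul_sum]
        refine Finset.sum_congr rfl fun i _ => ?_
        simp only [Pi.smul_apply, smul_eq_mul, RingHom.id_apply, smul_sub, mul_smul] }

theorem flat_apply (v w : Sect n) :
    flat n v w = ∑ i, (v (Sum.inl i) * w (Sum.inr i) - v (Sum.inr i) * w (Sum.inl i)) := by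
  simp [flat]

theorem flat_antisymm (v w : Sect n) : flat n v w = - flat n w v := by
  rw [flat_apply, flat_apply, ← Finset.sum_neg_distrib]
  refine Finset.sum_congr rfl fun i _ => by ring

theorem flat_self (v : Sect n) : flat n v v = 0 := by
  have := flat_antisymm v v
  linarith

/-- The Hamiltonian vector of a covector. -/
noncomputable def sharp (n : ℕ) : (Sect n →L[ℝ] ℝ) →L[ℝ] Sect n :=
  ContinuousLinearMap.pi (Sum.elim
    (fun i => ContinuousLinearMap.apply ℝ ℝ (Pi.single (Sum.inr i) 1))
    (fun i => - ContinuousLinearMap.apply ℝ ℝ (Pi.single (Sum.inl i) 1)))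

theorem clm_apply_eq_sum (l : Sect n →L[ℝ] ℝ) (w : Sect n) :
    l w = ∑ i, (l (Pi.single (Sum.inl i) 1) * w (Sum.inl i) +
      l (Pi.single (Sum.inr i) 1) * w (Sum.inr i)) := by
  conv_lhs => rw [pi_eq_sum_univ' w]
  rw [map_sum, Fintype.sum_sum_type, ← Finset.sum_add_distrib]
  refine Finset.sum_congr rfl fun i _ => ?_
  simp [mul_comm]

theorem flat_sharp (l : Sect n →L[ℝ] ℝ) (w : Sect n) : flat n (sharp n l) w = l w := by
  rw [flat_apply, clm_apply_eq_sum l w]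
  refine Finset.sum_congr rfl fun i _ => ?_
  simp [sharp]
  ring

theorem flat_injective {v w : Sect n} (h : ∀ u, flat n v u = flat n w u) : v = w := by
  ext i
  rcases i with i | i
  · simpa [flat_apply, Pi.single_apply] using h (Pi.single (Sum.inr i) 1)
  · simpa [flat_apply, Pi.single_apply] using h (Pi.single (Sum.inl i) 1)

/-- The matrix of a linear map is symplectic if and only if the map preserves `dx ∧ dy`. -/
theorem toMatrix'_mem_symplecticGroup_iff (L : Sect n →ₗ[ℝ] Sect n) :
    LinearMap.toMatrix' L ∈ Matrix.symplecticGroup (Fin n) ℝ ↔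
      ∀ v w, flat n (L v) (L w) = flat n v w := by
  have hJ : ∀ v w : Sect n, flat n v w = - dotProduct v (Matrix.mulVec (Matrix.J (Fin n) ℝ) w) := by
    intro v w
    rw [flat_apply, Matrix.J, Matrix.fromBlocks_mulVec, dotProduct, Fintype.sum_sum_type,
      ← Finset.sum_add_distrib, ← Finset.sum_neg_distrib]
    refine Finset.sum_congr rfl fun i _ => ?_
    simp [Matrix.neg_mulVec]
    ring
  have hL : ∀ v, L v = Matrix.mulVec (LinearMap.toMatrix' L) v := fun v => by
    rw [LinearMap.toMatrix'_mulVec]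
  rw [SymplecticGroup.mem_iff']
  set A := LinearMap.toMatrix' L
  have hA : ∀ v w : Sect n,
      dotProduct (Matrix.mulVec A v) (Matrix.mulVec (Matrix.J (Fin n) ℝ) (Matrix.mulVec A w)) =
        dotProduct v (Matrix.mulVec (A.transpose * Matrix.J (Fin n) ℝ * A) w) := by
    intro v w
    rw [← Matrix.mulVec_mulVec, ← Matrix.mulVec_mulVec, Matrix.dotProduct_mulVec v A.transpose,
      Matrix.vecMul_transpose]
  constructor
  · intro h v w
    rw [hJ, hJ, hL, hL, hA, h]
  · intro h
    have key : ∀ v w : Sect n, dotProduct v (Matrix.mulVec (A.transpose * Matrix.J (Fin n) ℝ * A) w)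
        = dotProduct v (Matrix.mulVec (Matrix.J (Fin n) ℝ) w) := by
      intro v w
      have := h v w
      rw [hJ, hJ, hL, hL, hA] at this
      exact neg_injective this
    ext i j
    have := key (Pi.single i 1) (Pi.single j 1)
    simpa using this

end SymplecticLinear

/-! ### Symmetric forms, their Hamiltonian vector fields, and jets -/

section Forms

variable {n k : ℕ}

/-- The power `(v₁, …, v_m) ↦ ∏ l(vᵢ)` of a linear form. -/
noncomputable def powForm (m : ℕ) (l : Sect n →L[ℝ] ℝ) :
    ContinuousMultilinearMap ℝ (fun _ : Fin m => Sect n) ℝ :=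
  (ContinuousMultilinearMap.mkPiAlgebra ℝ (Fin m) ℝ).compContinuousLinearMap (fun _ => l)

theorem powForm_apply (m : ℕ) (l : Sect n →L[ℝ] ℝ) (v : Fin m → Sect n) :
    powForm m l v = ∏ i, l (v i) := by
  simp [powForm]

theorem powForm_diag (m : ℕ) (l : Sect n →L[ℝ] ℝ) (x : Sect n) :
    powForm m l (fun _ => x) = l x ^ m := by
  simp [powForm_apply]

theorem isSymmForm_powForm (m : ℕ) (l : Sect n →L[ℝ] ℝ) : IsSymmForm (powForm m l) := by
  intro σ v
  rw [powForm_apply, powForm_apply]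
  exact Equiv.prod_comp σ fun i => l (v i)

variable (n k) in
/-- The `k`-linear map `T` with `ω(T(v₁, …, v_k), w) = B(v₁, …, v_k, w)`. -/
noncomputable def raise :
    ContinuousMultilinearMap ℝ (fun _ : Fin (k + 1) => Sect n) ℝ →L[ℝ]
      ContinuousMultilinearMap ℝ (fun _ : Fin k => Sect n) (Sect n) :=
  (ContinuousLinearMap.compContinuousMultilinearMapL ℝ (fun _ : Fin k => Sect n)
    (Sect n →L[ℝ] ℝ) (Sect n) (sharp n)).comp
    (continuousMultilinearCurryRightEquiv' ℝ k (Sect n) ℝ).toContinuousLinearEquiv.toContinuousLinearMap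

theorem raise_apply (B : ContinuousMultilinearMap ℝ (fun _ : Fin (k + 1) => Sect n) ℝ)
    (v : Fin k → Sect n) : raise n k B v = sharp n (B.curryRight v) := rfl

theorem flat_raise (B : ContinuousMultilinearMap ℝ (fun _ : Fin (k + 1) => Sect n) ℝ)
    (v : Fin k → Sect n) (w : Sect n) :
    flat n (raise n k B v) w = B (Fin.snoc v w : Fin (k + 1) → Sect n) := by
  rw [raise_apply, flat_sharp]; rfl

/-- This is the Hamiltonian vector field of `l^(k+1) / (k+1)`, the one that `shear` integrates
explicitly. -/
theorem raise_powForm_diag (l : Sect n →L[ℝ] ℝ) (x : Sect n) :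
    raise n k (powForm (k + 1) l) (fun _ => x) = l x ^ k • sharp n l := by
  refine flat_injective fun w => ?_
  rw [flat_raise, powForm_apply, map_smul, smul_apply, flat_sharp,
    Fin.prod_univ_castSucc]
  simp

/-- A permutation of the first `k` slots extends to all `k + 1` slots by fixing the last one, which
is the slot paired with `w`. -/
theorem IsSymmForm.raise {B : ContinuousMultilinearMap ℝ (fun _ : Fin (k + 1) => Sect n) ℝ}
    (hB : IsSymmForm B) : IsSymmForm (raise n k B) := by
  intro σ v
  refine flat_injective fun w => ?_
  rw [flat_raise, flat_raise]
  rw [← hB (Equiv.Perm.viaFintypeEmbedding σ Fin.castSuccEmb) (Fin.snoc v w)]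
  congr 1
  ext i
  refine Fin.lastCases ?_ (fun j => ?_) i
  · simp only [Fin.snoc_last, Function.comp]
    rw [Equiv.Perm.viaFintypeEmbedding_apply_notMem_range]
    · simp
    · rintro ⟨j, hj⟩
      exact (Fin.castSucc_lt_last j).ne hj
  · have := Equiv.Perm.viaFintypeEmbedding_apply_image σ Fin.castSuccEmb j
    simp only [Function.comp, Fin.snoc_castSucc]
    have h2 : (Equiv.Perm.viaFintypeEmbedding σ Fin.castSuccEmb) j.castSucc =
      (σ j).castSucc := this
    rw [h2]
    simp

variable (n k) in
/-- The `k`-jets whose components of order less than `k` are zero. -/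
noncomputable def topJet :
    ContinuousMultilinearMap ℝ (fun _ : Fin k => Sect n) (Sect n) →L[ℝ] Jet n k :=
  ContinuousLinearMap.single ℝ
    (fun i : Fin (k + 1) => ContinuousMultilinearMap ℝ (fun _ : Fin (i : ℕ) => Sect n) (Sect n))
    (Fin.last k)

theorem topJet_last (T : ContinuousMultilinearMap ℝ (fun _ : Fin k => Sect n) (Sect n)) :
    topJet n k T (Fin.last k) = T := by
  simp [topJet]

theorem topJet_of_lt (T : ContinuousMultilinearMap ℝ (fun _ : Fin k => Sect n) (Sect n))
    {i : Fin (k + 1)} (hi : (i : ℕ) < k) : topJet n k T i = 0 := by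
  have hne : i ≠ Fin.last k := by
    rintro rfl
    simp at hi
  exact Pi.single_eq_of_ne hne _

theorem jet_ext {j j' : Jet n k} (h : ∀ i : Fin (k + 1), (i : ℕ) < k → j i = j' i)
    (hl : j (Fin.last k) = j' (Fin.last k)) : j = j' := by
  funext i
  by_cases hi : (i : ℕ) < k
  · exact h i hi
  · have : i = Fin.last k := by ext; simp; omega
    rw [this, hl]

/-- Jets are read off from an asymptotic expansion, so that the higher derivatives of a Poincaré map
never have to be computed. -/
theorem jet_of_expansion {f : Sect n → Sect n} (hf : ContDiffAt ℝ k f 0)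
    {T : ContinuousMultilinearMap ℝ (fun _ : Fin k => Sect n) (Sect n)} (hT : IsSymmForm T)
    (h : (fun x => f x - x - ((k.factorial : ℝ)⁻¹) • T (fun _ => x))
      =o[𝓝 0] fun x : Sect n => ‖x‖ ^ k) :
    jet k f = jet k id + topJet n k T := by
  obtain ⟨h1, h2⟩ := iteratedFDeriv_of_expansion hf (g := id) contDiffAt_id hT h
  refine jet_ext (fun i hi => ?_) ?_
  · simp only [Pi.add_apply, topJet_of_lt _ hi, add_zero]
    exact h1 i hi
  · simp only [Pi.add_apply, topJet_last]
    exact h2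

theorem jetProj_add_topJet (hk : 1 ≤ k)
    (T : ContinuousMultilinearMap ℝ (fun _ : Fin k => Sect n) (Sect n)) :
    jetProj (jet k id + topJet n k T) = jet (k - 1) (id : Sect n → Sect n) := by
  funext i
  have hi : (i : ℕ) < k := by have := i.2; omega
  simp only [jetProj, Pi.add_apply]
  rw [topJet_of_lt _ (by exact hi), add_zero]
  rfl

end Forms

/-! ### Symplectic shears and the jets they realize -/

section Shears

variable {n k : ℕ}

theorem IsSymplecticDiffeo.comp {f g : Sect n → Sect n} (hf : IsSymplecticDiffeo f)
    (hg : IsSymplecticDiffeo g) : IsSymplecticDiffeo (f ∘ g) := by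
  obtain ⟨f0, fs, ⟨f', fs', fl, fr⟩, fm⟩ := hf
  obtain ⟨g0, gs, ⟨g', gs', gl, gr⟩, gm⟩ := hg
  refine ⟨by simp [f0, g0], fs.comp gs, ⟨g' ∘ f', gs'.comp fs', fl.comp gl, fr.comp gr⟩, ?_⟩
  intro ξ
  rw [fderiv_comp _ (fs.differentiable (by simp) _) (gs.differentiable (by simp) _)]
  have : ((fderiv ℝ f (g ξ)).comp (fderiv ℝ g ξ) : Sect n →ₗ[ℝ] Sect n) =
    (fderiv ℝ f (g ξ) : Sect n →ₗ[ℝ] Sect n) ∘ₗ (fderiv ℝ g ξ : Sect n →ₗ[ℝ] Sect n) := rfl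
  rw [this, LinearMap.toMatrix'_comp]
  exact mul_mem (fm _) (gm _)

theorem isSymplecticDiffeo_id : IsSymplecticDiffeo (id : Sect n → Sect n) := by
  refine ⟨rfl, contDiff_id, ⟨id, contDiff_id, fun _ => rfl, fun _ => rfl⟩, fun ξ => ?_⟩
  rw [fderiv_id, toMatrix'_mem_symplecticGroup_iff]
  intro v w
  rfl

/-- A linear form is conserved by its own Hamiltonian field, which makes the shear explicit and its
inverse the shear with coefficient `-c`. -/
theorem apply_sharp_self (l : Sect n →L[ℝ] ℝ) : l (sharp n l) = 0 := by
  rw [← flat_sharp, flat_self]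

/-- The time-one map of the Hamiltonian `c lᵏ⁺¹ / (k + 1)`. -/
noncomputable def shear (k : ℕ) (c : ℝ) (l : Sect n →L[ℝ] ℝ) (ξ : Sect n) : Sect n :=
  ξ + (c * l ξ ^ k) • sharp n l

theorem contDiff_shear (c : ℝ) (l : Sect n →L[ℝ] ℝ) : ContDiff ℝ ∞ (shear k c l) := by
  unfold shear
  fun_prop

theorem shear_neg_shear (c : ℝ) (l : Sect n →L[ℝ] ℝ) (ξ : Sect n) :
    shear k (-c) l (shear k c l ξ) = ξ := by
  simp [shear, apply_sharp_self]

/-- The differential is a transvection `v ↦ v + s * l v • sharp l`. In `ω(Lv, Lw)` the two terms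
linear in `s` cancel by antisymmetry and the quadratic one is a multiple of `ω(sharp l, sharp l) =
0`. -/
theorem isSymplecticDiffeo_shear (hk : 1 ≤ k) (c : ℝ) (l : Sect n →L[ℝ] ℝ) :
    IsSymplecticDiffeo (shear k c l) := by
  refine ⟨?_, contDiff_shear c l, ⟨shear k (-c) l, contDiff_shear _ l, shear_neg_shear c l, ?_⟩, ?_⟩
  · have : k ≠ 0 := by omega
    simp [shear, this]
  · intro ξ
    simpa using shear_neg_shear (k := k) (-c) l ξ
  · intro ξ
    rw [toMatrix'_mem_symplecticGroup_iff]
    have hd : HasFDerivAt (shear k c l) (ContinuousLinearMap.id ℝ (Sect n) +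
        (c • ((k : ℝ) * l ξ ^ (k - 1)) • l).smulRight (sharp n l)) ξ := by
      refine (hasFDerivAt_id ξ).add (HasFDerivAt.smul_const ?_ _)
      have h1 : HasFDerivAt (fun x => l x ^ k) (((k : ℝ) * l ξ ^ (k - 1)) • l) ξ := by
        have := (l.hasFDerivAt (x := ξ)).pow k
        simpa [smul_smul] using this
      simpa using h1.const_mul c
    rw [hd.fderiv]
    intro v w
    have e : ∀ v : Sect n, ((ContinuousLinearMap.id ℝ (Sect n) +
        (c • ((k : ℝ) * l ξ ^ (k - 1)) • l).smulRight (sharp n l) : Sect n →L[ℝ] Sect n) :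
          Sect n →ₗ[ℝ] Sect n) v = v + (c * (k * l ξ ^ (k - 1)) * l v) • sharp n l := by
      intro v
      simp [mul_assoc]
    rw [e, e]
    simp only [map_add, map_smul, add_apply, smul_apply, flat_sharp, flat_self, smul_eq_mul]
    rw [flat_antisymm v (sharp n l), flat_sharp]
    ring

/-- Under composition of shears the leading terms add up: as `k ≥ 2`, each factor is the identity up
to `o(‖x‖)`, and replacing `f x` by `x` inside `l ^ k` changes it by `o(‖x‖^k)` only. -/
theorem exists_symplecticDiffeo_expansion (hk : 2 ≤ k) {ι : Type*} (s : Finset ι) (c : ι → ℝ)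
    (l : ι → Sect n →L[ℝ] ℝ) :
    ∃ f : Sect n → Sect n, IsSymplecticDiffeo f ∧
      (fun x => f x - x - ∑ i ∈ s, (c i * l i x ^ k) • sharp n (l i))
        =o[𝓝 0] fun x : Sect n => ‖x‖ ^ k := by
  classical
  induction s using Finset.induction_on with
  | empty => exact ⟨id, isSymplecticDiffeo_id, by simp⟩
  | insert i s hi ih =>
    obtain ⟨f, hf, he⟩ := ih
    refine ⟨shear k (c i) (l i) ∘ f, (isSymplecticDiffeo_shear (by omega) _ _).comp hf, ?_⟩
    have hk0 : (fun h : Sect n => ‖h‖ ^ k) =o[𝓝 0] fun h : Sect n => ‖h‖ := by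
      simpa using isLittleO_norm_pow_norm_pow (E' := Sect n) (show 1 < k by omega)
    have h1 : (fun x : Sect n => ∑ i ∈ s, (c i * l i x ^ k) • sharp n (l i)) =O[𝓝 0]
        fun x : Sect n => ‖x‖ ^ k := by
      refine IsBigO.fun_sum (A := fun i (x : Sect n) => (c i * l i x ^ k) • sharp n (l i))
        fun i _ => ?_
      have h2 : (fun x : Sect n => l i x ^ k) =O[𝓝 0] fun x : Sect n => ‖x‖ ^ k :=
        ((l i).isBigO_id (𝓝 0)).norm_right.pow k
      have h3 := (h2.const_mul_left (c i)).smul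
        (isBigO_refl (fun _ : Sect n => sharp n (l i)) (𝓝 0))
      refine h3.trans (IsBigO.of_bound ‖sharp n (l i)‖ (Filter.Eventually.of_forall fun x => ?_))
      rw [norm_smul, mul_comm]
    have h2 : (fun x => f x - x) =o[𝓝 0] fun x : Sect n => ‖x‖ := by
      refine (IsBigO.trans_isLittleO ?_ hk0)
      exact (he.isBigO.add h1).congr_left fun x => by abel
    have h3 : (fun x : Sect n => x) =O[𝓝 0] fun x : Sect n => ‖x‖ :=
      (isBigO_refl _ _).norm_right
    have h4 : f =O[𝓝 0] fun x : Sect n => ‖x‖ :=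
      (h2.isBigO.add h3).congr_left fun x => by abel
    have h5 := isLittleO_diag_sub (powForm k (l i)) h4 h3 h2
    have h6 : (fun x => (c i * (l i (f x) ^ k - l i x ^ k)) • sharp n (l i)) =o[𝓝 0]
        fun x : Sect n => ‖x‖ ^ k := by
      have h7 : (fun x => c i * (l i (f x) ^ k - l i x ^ k)) =o[𝓝 0]
          fun x : Sect n => ‖x‖ ^ k := by
        refine (h5.congr_left fun x => ?_).const_mul_left (c i)
        rw [powForm_diag, powForm_diag]
      have := h7.smul_isBigO (isBigO_refl (fun _ : Sect n => sharp n (l i)) (𝓝 0))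
      refine this.trans_isBigO
        (IsBigO.of_bound ‖sharp n (l i)‖ (Filter.Eventually.of_forall fun x => ?_))
      rw [norm_smul, mul_comm]
    refine (he.add h6).congr_left fun x => ?_
    rw [Finset.sum_insert hi, mul_sub, sub_smul, Function.comp, shear]
    abel

/-- The jets with top component the Hamiltonian vector field of a sum of powers of linear
forms. -/
theorem mem_jetKer_of_sum_powForm (hk : 2 ≤ k) {ι : Type*} [Fintype ι] (c : ι → ℝ)
    (l : ι → Sect n →L[ℝ] ℝ) :
    jet k id + topJet n k (raise n k (∑ i, c i • powForm (k + 1) (l i))) ∈ jetKer n k := by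
  refine ⟨?_, jetProj_add_topJet (by omega) _⟩
  -- The factor `1 / k!` appears because jets record derivatives, not Taylor coefficients.
  obtain ⟨f, hf, he⟩ := exists_symplecticDiffeo_expansion hk Finset.univ
    (fun i => (k.factorial : ℝ)⁻¹ * c i) l
  refine ⟨f, hf, jet_of_expansion (hf.2.1.of_le (by exact_mod_cast le_top)).contDiffAt ?_ ?_⟩
  · have : IsSymmForm (∑ i, c i • powForm (k + 1) (l i)) := by
      intro σ v
      simp only [sum_apply, smul_apply, isSymmForm_powForm (k + 1) _ σ v]
    exact this.raise
  · refine he.congr_left fun x => ?_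
    congr 1
    rw [map_sum, sum_apply, Finset.smul_sum]
    refine Finset.sum_congr rfl fun i _ => ?_
    rw [map_smul, smul_apply, raise_powForm_diag, smul_smul, smul_smul]

end Shears

/-! ### The jets in the kernel of the projection -/

section JetKernel

variable {n k : ℕ}

/-- The top component of a jet in the kernel of the projection is the Hamiltonian vector field
of a homogeneous polynomial. -/
theorem exists_form_of_mem_jetKer (hk : 2 ≤ k) {j : Jet n k} (hj : j ∈ jetKer n k) :
    ∃ B : ContinuousMultilinearMap ℝ (fun _ : Fin (k + 1) => Sect n) ℝ, IsSymmForm B ∧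
      j = jet k id + topJet n k (raise n k B) := by
  obtain ⟨⟨f, ⟨f0, fs, -, fm⟩, rfl⟩, hp⟩ := hj
  -- From here on `k` is the former `k - 1`, the vanishing order of the differential of `f - id`. It
  -- is still at least `1`.
  obtain ⟨k, rfl⟩ : ∃ m, k = m + 1 := ⟨k - 1, by omega⟩
  set g : Sect n → Sect n := fun x => f x - x with hg
  have gs : ContDiff ℝ ∞ g := fs.sub contDiff_id
  have gk : ∀ m : ℕ, ContDiffAt ℝ m g 0 := fun m =>
    (gs.of_le (by exact_mod_cast le_top)).contDiffAt
  have fk : ∀ m : ℕ, ContDiffAt ℝ m f 0 := fun m =>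
    (fs.of_le (by exact_mod_cast le_top)).contDiffAt
  have hgi : ∀ i : ℕ, iteratedFDeriv ℝ i g 0 = iteratedFDeriv ℝ i f 0 -
      iteratedFDeriv ℝ i id 0 := fun i => iteratedFDeriv_sub_apply (fk i) contDiffAt_id
  have hg0 : ∀ i < k + 1, iteratedFDeriv ℝ i g 0 = 0 := by
    intro i hi
    have := congrFun hp ⟨i, by omega⟩
    rw [hgi, sub_eq_zero]
    exact this
  set T := iteratedFDeriv ℝ (k + 1) g 0 with hTdef
  have hTs : IsSymmForm T := isSymmForm_iteratedFDeriv (gk _)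
  have hjet : jet (k + 1) f = jet (k + 1) id + topJet n (k + 1) T := by
    refine jet_ext (fun i hi => ?_) ?_
    · simp only [Pi.add_apply, topJet_of_lt _ hi, add_zero]
      have := hg0 i hi
      rw [hgi, sub_eq_zero] at this
      exact this
    · simp only [Pi.add_apply, topJet_last]
      have := hgi (k + 1)
      rw [eq_sub_iff_add_eq] at this
      exact this.symm.trans (add_comm _ _)
  have hgd : ∀ m : ℕ, ContDiffAt ℝ m (fderiv ℝ g) 0 := fun m =>
    (gk (m + 1)).fderiv_right (by norm_cast)
  have hfg : ∀ x v, fderiv ℝ f x v = v + fderiv ℝ g x v := by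
    intro x v
    have : fderiv ℝ g x = fderiv ℝ f x - ContinuousLinearMap.id ℝ _ := by
      have h1 : HasFDerivAt g (fderiv ℝ f x - ContinuousLinearMap.id ℝ _) x :=
        (fs.differentiable (by simp) x).hasFDerivAt.sub (hasFDerivAt_id x)
      exact h1.fderiv
    rw [this]; simp
  have hz : ∀ i < k, iteratedFDeriv ℝ i (fderiv ℝ g) 0 = 0 := by
    intro i hi
    ext v w
    have := iteratedFDeriv_succ_apply_right (𝕜 := ℝ) (f := g) (x := 0)
      (Fin.snoc v w : Fin (i + 1) → Sect n)
    rw [hg0 (i + 1) (by omega)] at this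
    simpa using congrFun this.symm _
  have hO : fderiv ℝ g =O[𝓝 0] fun x : Sect n => ‖x‖ ^ k := by
    have h1 := taylor_peano (hgd k) hz
    have h2 := (isBigO_diag (iteratedFDeriv ℝ k (fderiv ℝ g) 0)).const_smul_left
      ((k.factorial : ℝ)⁻¹)
    refine (h1.isBigO.add h2).congr_left fun x => ?_
    simp
  -- Symplecticity of `id + Dg` reads `ω(Dg v, w) + ω(v, Dg w) = -ω(Dg v, Dg w)`. The right side is
  -- `O(‖x‖^(2k))`, hence `o(‖x‖^k)`, so the derivative of order `k` of the left side vanishes at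
  -- `0`.
  have key : ∀ (u : Fin k → Sect n) (v w : Sect n),
      flat n (T (Fin.snoc u v : Fin (k + 1) → Sect n)) w +
        flat n v (T (Fin.snoc u w : Fin (k + 1) → Sect n)) = 0 := by
    intro u v w
    set L : (Sect n →L[ℝ] Sect n) →L[ℝ] ℝ :=
      ((ContinuousLinearMap.apply ℝ ℝ w).comp (flat n)).comp
        (ContinuousLinearMap.apply ℝ (Sect n) v) +
      (flat n v).comp (ContinuousLinearMap.apply ℝ (Sect n) w) with hL
    have hLa : ∀ S : Sect n →L[ℝ] Sect n, L S = flat n (S v) w + flat n v (S w) := fun S => rfl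
    have hsm : (L ∘ fderiv ℝ g) =o[𝓝 0] fun x : Sect n => ‖x‖ ^ k := by
      have e : (L ∘ fderiv ℝ g) = fun x => - flat n (fderiv ℝ g x v) (fderiv ℝ g x w) := by
        ext x
        have := (toMatrix'_mem_symplecticGroup_iff _).1 (fm x) v w
        simp only [ContinuousLinearMap.coe_coe, hfg, map_add, add_apply] at this
        simp only [Function.comp, hLa]
        linarith
      rw [e]
      have h1 : ∀ v : Sect n, (fun x => fderiv ℝ g x v) =O[𝓝 0] fun x : Sect n => ‖x‖ ^ k :=
        fun v => ((ContinuousLinearMap.apply ℝ (Sect n) v).isBigO_comp _ _).trans hO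
      have h2 : (fun x => flat n (fderiv ℝ g x v) (fderiv ℝ g x w)) =O[𝓝 0]
          fun x : Sect n => ‖x‖ ^ k * ‖x‖ ^ k := by
        refine IsBigO.trans ?_ ((h1 v).norm_left.mul (h1 w).norm_left)
        refine IsBigO.of_bound ‖flat n‖ (Filter.Eventually.of_forall fun x => ?_)
        have := (flat n).le_opNorm₂ (fderiv ℝ g x v) (fderiv ℝ g x w)
        simpa [mul_assoc] using this
      refine h2.neg_left.trans_isLittleO ?_
      simp_rw [← pow_add]
      exact isLittleO_norm_pow_norm_pow (by omega)
    have hc : ContDiffAt ℝ k (L ∘ fderiv ℝ g) 0 := L.contDiff.contDiffAt.comp _ (hgd k)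
    have h0 := iteratedFDeriv_eq_zero_of_isLittleO hc hsm le_rfl
    rw [L.iteratedFDeriv_comp_left (hgd k) le_rfl] at h0
    have h1 := congrArg (fun S => S u) h0
    simp only [ContinuousLinearMap.compContinuousMultilinearMap_coe, Function.comp, hLa] at h1
    have h2 : ∀ v : Sect n, T (Fin.snoc u v : Fin (k + 1) → Sect n) =
        iteratedFDeriv ℝ k (fderiv ℝ g) 0 u v := by
      intro v
      rw [hTdef, iteratedFDeriv_succ_apply_right]
      simp
    rw [h2, h2]
    simpa using h1
  set B : ContinuousMultilinearMap ℝ (fun _ : Fin (k + 1 + 1) => Sect n) ℝ :=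
    ContinuousMultilinearMap.uncurryRight (Ei := fun _ => Sect n)
      ((flat n).compContinuousMultilinearMap T) with hB
  have hBa : ∀ v, B v = flat n (T (Fin.init v)) (v (Fin.last _)) := fun v => rfl
  refine ⟨B, ?_, ?_⟩
  · intro σ
    have hσ : σ ∈ Submonoid.closure
        (Set.range fun i : Fin (k + 1) => Equiv.swap i.castSucc i.succ) := by
      rw [Equiv.Perm.mclosure_swap_castSucc_succ]; trivial
    induction hσ using Submonoid.closure_induction with
    | one => intro v; rfl
    | mul σ τ _ _ h1 h2 =>
      intro v
      have : v ∘ (σ * τ : Equiv.Perm _) = (v ∘ σ) ∘ τ := rfl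
      rw [this, h2, h1]
    | mem σ hσ =>
      obtain ⟨i, rfl⟩ := hσ
      intro v
      rw [hBa, hBa]
      -- Only the swap of the last two slots uses the symplectic identity `key`. All other adjacent
      -- swaps act on the slots of `T`, which is symmetric as a derivative.
      refine Fin.lastCases ?_ (fun j => ?_) i
      · have e1 : Fin.init (v ∘ Equiv.swap (Fin.last k).castSucc (Fin.last k).succ) =
            (Fin.snoc (Fin.init (Fin.init v)) (v (Fin.last _)) : Fin (k + 1) → Sect n) := by
          ext1 m
          refine Fin.lastCases ?_ (fun m => ?_) m
          · simp [Fin.init]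
          · simp only [Fin.init, Function.comp, Fin.snoc_castSucc]
            rw [Equiv.swap_apply_of_ne_of_ne]
            · intro h
              exact (Fin.castSucc_lt_last m).ne (Fin.castSucc_injective _ h)
            · rw [Fin.succ_last]
              exact (Fin.castSucc_lt_last _).ne
        have e2 : Fin.init v =
            (Fin.snoc (Fin.init (Fin.init v)) (Fin.init v (Fin.last _)) : Fin (k + 1) → Sect n) :=
          (Fin.snoc_init_self _).symm
        have e3 : (v ∘ Equiv.swap (Fin.last k).castSucc (Fin.last k).succ) (Fin.last _) =
            Fin.init v (Fin.last _) := by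
          simp [Fin.init, ← Fin.succ_last]
        rw [e1, e3]
        have e4 : flat n (T (Fin.init v)) (v (Fin.last _)) = flat n (T (Fin.snoc
            (Fin.init (Fin.init v)) (Fin.init v (Fin.last _)) : Fin (k + 1) → Sect n))
            (v (Fin.last _)) := by rw [← e2]
        have := key (Fin.init (Fin.init v)) (v (Fin.last _)) (Fin.init v (Fin.last _))
        rw [flat_antisymm (v (Fin.last _))] at this
        linarith
      · have e1 : Fin.init (v ∘ Equiv.swap j.castSucc.castSucc j.castSucc.succ) =
            Fin.init v ∘ Equiv.swap j.castSucc j.succ := by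
          ext1 m
          simp only [Fin.init, Function.comp]
          congr 1
          rw [Fin.succ_castSucc]
          exact ((Fin.castSucc_injective _).map_swap _ _ _).symm
        have e2 : (v ∘ Equiv.swap j.castSucc.castSucc j.castSucc.succ) (Fin.last _) =
            v (Fin.last _) := by
          simp only [Function.comp]
          rw [Equiv.swap_apply_of_ne_of_ne]
          · exact (Fin.castSucc_lt_last _).ne'
          · rw [Fin.succ_castSucc]; exact (Fin.castSucc_lt_last _).ne'
        rw [e1, e2, hTs]
  · rw [hjet]
    congr 2
    ext1 v
    refine flat_injective fun w => ?_
    rw [flat_raise, hBa]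
    simp

end JetKernel

/-! ### Homogeneous polynomials and sums of powers of linear forms -/

section Polynomials

variable {n k : ℕ}

/-- The linear form that a matrix row defines. -/
noncomputable def rowForm (σ : Matrix (Fin n ⊕ Fin n) (Fin n ⊕ Fin n) ℝ) (i : Fin n ⊕ Fin n) :
    Sect n →L[ℝ] ℝ :=
  ∑ j, σ i j • ContinuousLinearMap.proj j

theorem rowForm_apply (σ : Matrix (Fin n ⊕ Fin n) (Fin n ⊕ Fin n) ℝ) (i : Fin n ⊕ Fin n)
    (x : Sect n) : rowForm σ i x = ∑ j, σ i j * x j := by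
  simp [rowForm]

/-- The polynomial of a symmetric form is a combination of powers of linear forms, if these
powers span the homogeneous polynomials. -/
theorem exists_sum_powForm_of_span [NeZero n] {m : ℕ} {ι : Type*} [Fintype ι]
    {σ : ι → Matrix (Fin n ⊕ Fin n) (Fin n ⊕ Fin n) ℝ}
    (h : Submodule.span ℝ (Set.range fun i =>
      polyComp (MvPolynomial.X (Sum.inl 0) ^ m) (σ i)) =
        MvPolynomial.homogeneousSubmodule (Fin n ⊕ Fin n) ℝ m)
    {B : ContinuousMultilinearMap ℝ (fun _ : Fin m => Sect n) ℝ} (hB : IsSymmForm B) :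
    ∃ c : ι → ℝ, B = ∑ i, c i • powForm m (rowForm (σ i) (Sum.inl 0)) := by
  classical
  set p : MvPolynomial (Fin n ⊕ Fin n) ℝ := ∑ f : Fin m → Fin n ⊕ Fin n,
    MvPolynomial.C (B fun i => Pi.single (f i) 1) * ∏ i, MvPolynomial.X (f i) with hp
  have hph : p ∈ MvPolynomial.homogeneousSubmodule (Fin n ⊕ Fin n) ℝ m := by
    rw [MvPolynomial.mem_homogeneousSubmodule]
    refine MvPolynomial.IsHomogeneous.sum _ _ _ fun f _ => ?_
    have h1 := MvPolynomial.IsHomogeneous.prod Finset.univ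
      (fun i : Fin m => (MvPolynomial.X (f i) : MvPolynomial (Fin n ⊕ Fin n) ℝ)) (fun _ => 1)
      (fun i _ => MvPolynomial.isHomogeneous_X ℝ (f i))
    have h2 := (MvPolynomial.isHomogeneous_C (Fin n ⊕ Fin n)
      (B fun i => Pi.single (f i) 1)).mul h1
    simpa using h2
  have hpe : ∀ x : Sect n, MvPolynomial.eval x p = B fun _ => x := by
    intro x
    have h1 : (fun _ : Fin m => x) = fun _ => ∑ j, x j • (Pi.single j 1 : Sect n) := by
      funext _
      exact pi_eq_sum_univ' x
    have h2 := B.toMultilinearMap.map_sum (fun (_ : Fin m) j => x j • (Pi.single j 1 : Sect n))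
    rw [h1]
    refine Eq.trans ?_ h2.symm
    rw [hp, map_sum]
    refine Finset.sum_congr rfl fun f _ => ?_
    have h3 := B.toMultilinearMap.map_smul_univ (fun i => x (f i))
      (fun i => (Pi.single (f i) 1 : Sect n))
    rw [h3]
    simp [mul_comm]
  rw [← h, Submodule.mem_span_range_iff_exists_fun] at hph
  obtain ⟨c, hc⟩ := hph
  -- By polarization an identity of polynomials, compared by evaluation at each `x`, suffices for an
  -- identity of symmetric forms.
  refine ⟨c, hB.ext ?_ fun x => ?_⟩
  · intro τ v
    simp only [sum_apply, smul_apply, isSymmForm_powForm m _ τ v]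
  · rw [← hpe, ← hc, map_sum, sum_apply]
    refine Finset.sum_congr rfl fun i _ => ?_
    rw [smul_apply, powForm_diag, rowForm_apply, MvPolynomial.smul_eval]
    simp [polyComp]

end Polynomials

end ManeJets

namespace ManeJets

/-! ### Natural coordinates of the cotangent bundle -/

section CotangentCoordinates

variable {n : ℕ} {M : Type*} [TopologicalSpace M] [ChartedSpace (Coord n) M]
  [IsManifold (𝓡 (n + 1)) ∞ M]

omit [IsManifold (𝓡 (n + 1)) ∞ M] in
theorem mdifferentiable_of_mem_maximalAtlas {φ : OpenPartialHomeomorph M (Coord n)}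
    (hφ : φ ∈ IsManifold.maximalAtlas (𝓡 (n + 1)) ∞ M) :
    φ.MDifferentiable (𝓡 (n + 1)) 𝓘(ℝ, Coord n) :=
  ⟨(contMDiffOn_of_mem_maximalAtlas hφ).mdifferentiableOn (by simp),
    (contMDiffOn_symm_of_mem_maximalAtlas hφ).mdifferentiableOn (by simp)⟩

theorem coord_eq_sum (v : Coord n) : v = ∑ i, v i • EuclideanSpace.single i (1 : ℝ) := by
  ext j
  simp [Finset.sum_apply, Pi.single_apply]

omit [IsManifold (𝓡 (n + 1)) ∞ M] in
theorem toCoord_ofCoord {φ : OpenPartialHomeomorph M (Coord n)}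
    (hφ : φ ∈ IsManifold.maximalAtlas (𝓡 (n + 1)) ∞ M) {z : Phase n} (hz : z.1 ∈ φ.target) :
    toCoord φ (ofCoord φ z) = z := by
  have hd := (mdifferentiable_of_mem_maximalAtlas hφ).comp_symm_deriv hz
  refine Prod.ext (φ.right_inv hz) ?_
  ext j
  simp only [toCoord, ofCoord]
  rw [φ.right_inv hz]
  have h2 : ∀ v : Coord n, mfderiv (𝓡 (n + 1)) 𝓘(ℝ, Coord n) φ (φ.symm z.1)
      (mfderiv 𝓘(ℝ, Coord n) (𝓡 (n + 1)) φ.symm z.1 v) = v := fun v =>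
    DFunLike.congr_fun hd v
  have : ∀ (L : Coord n →L[ℝ] Coord n) (v : Coord n),
      (∑ i : Fin (n + 1), z.2 i • (EuclideanSpace.proj i : Coord n →L[ℝ] ℝ).comp L) v
        = ∑ i, z.2 i * (L v) i := by
    intro L v
    simp
  refine (this _ _).trans ?_
  rw [Finset.sum_eq_single j]
  · erw [h2]; simp
  · intro b _ hb
    erw [h2]; simp [hb]
  · simp

omit [IsManifold (𝓡 (n + 1)) ∞ M] in
theorem ofCoord_toCoord {φ : OpenPartialHomeomorph M (Coord n)}
    (hφ : φ ∈ IsManifold.maximalAtlas (𝓡 (n + 1)) ∞ M) {w : Cotangent n M}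
    (hw : w.proj ∈ φ.source) :
    ofCoord φ (toCoord φ w) = w := by
  have hd := (mdifferentiable_of_mem_maximalAtlas hφ).symm_comp_deriv hw
  obtain ⟨q, p⟩ := w
  simp only at hw
  have h2 : ∀ v : Coord n, mfderiv 𝓘(ℝ, Coord n) (𝓡 (n + 1)) φ.symm (φ q)
      (mfderiv (𝓡 (n + 1)) 𝓘(ℝ, Coord n) φ q v) = v := fun v =>
    DFunLike.congr_fun hd v
  have key : (∑ i : Fin (n + 1), (toCoord φ ⟨q, p⟩).2 i •
    (EuclideanSpace.proj i : Coord n →L[ℝ] ℝ).comp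
      (mfderiv (𝓡 (n + 1)) 𝓘(ℝ, Coord n) φ q)) = (p : Coord n →L[ℝ] ℝ) := by
    refine ContinuousLinearMap.ext fun (v : Coord n) => ?_
    have gen : ∀ (L L' : Coord n →L[ℝ] Coord n) (p : Coord n →L[ℝ] ℝ), L' (L v) = v →
       (∑ i : Fin (n + 1), p (L' (EuclideanSpace.single i (1 : ℝ))) •
        (EuclideanSpace.proj i : Coord n →L[ℝ] ℝ).comp L) v = p v := by
      intro L L' p h
      conv_rhs => rw [← h, coord_eq_sum (L v)]
      simp [mul_comm]
    exact gen _ _ p (h2 v)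
  have gen : ∀ (q' : M) (h : q' = q), (⟨q', ∑ i : Fin (n + 1), (toCoord φ ⟨q, p⟩).2 i •
    (EuclideanSpace.proj i : Coord n →L[ℝ] ℝ).comp
      (mfderiv (𝓡 (n + 1)) 𝓘(ℝ, Coord n) φ q')⟩ : Cotangent n M) = ⟨q, p⟩ := by
    rintro q' rfl
    exact congrArg (Bundle.TotalSpace.mk q') key
  exact gen _ (φ.left_inv hw)

/-- In the trivializations of the bundle of linear maps the covector is `∑ yᵢ` times the components
of the differential of the chart read in tangent coordinates, and this differential depends smoothly
on the base point. The regularity of `H` on `T*M` thereby passes to its coordinate expression. -/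
theorem contMDiffAt_ofCoord {φ : OpenPartialHomeomorph M (Coord n)}
    (hφ : φ ∈ IsManifold.maximalAtlas (𝓡 (n + 1)) ∞ M) {z : Phase n} (hz : z.1 ∈ φ.target) :
    ContMDiffAt 𝓘(ℝ, Phase n) (cotangentModel n) ∞ (ofCoord φ) z := by
  have hg : ContMDiffAt 𝓘(ℝ, Phase n) (𝓡 (n + 1)) ∞ (fun z : Phase n => φ.symm z.1) z := by
    have h1 := (contMDiffOn_symm_of_mem_maximalAtlas hφ).contMDiffAt (φ.open_target.mem_nhds hz)
    exact h1.comp z (contDiff_fst.contMDiff.contMDiffAt)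
  refine (contMDiffAt_hom_bundle (F₁ := Coord n) (F₂ := ℝ) (IB := 𝓡 (n + 1))
    (E₁ := fun q : M => TangentSpace (𝓡 (n + 1)) q) (E₂ := Bundle.Trivial M ℝ) (ofCoord φ)).2
    ⟨hg, ?_⟩
  have hφs : ContMDiffAt (𝓡 (n + 1)) 𝓘(ℝ, Coord n) ∞ φ (φ.symm z.1) :=
    (contMDiffOn_of_mem_maximalAtlas hφ).contMDiffAt (φ.open_source.mem_nhds (φ.map_target hz))
  have hm := ContMDiffAt.mfderiv (m := ∞) (n := ∞) (I := 𝓡 (n + 1)) (I' := 𝓘(ℝ, Coord n))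
    (fun (_ : Phase n) => (φ : M → Coord n))
    (fun z : Phase n => φ.symm z.1) (x₀ := z)
    (hφs.comp (z, φ.symm z.1) contMDiffAt_snd) hg (by simp)
  have hm' : ContDiffAt ℝ ∞ (fun w : Phase n => (inTangentCoordinates (𝓡 (n + 1))
      𝓘(ℝ, Coord n) (fun z : Phase n => φ.symm z.1) (fun w => φ (φ.symm w.1))
      (fun w : Phase n => mfderiv (𝓡 (n + 1)) 𝓘(ℝ, Coord n) φ (φ.symm w.1)) z w :
        Coord n →L[ℝ] Coord n)) z := contMDiffAt_iff_contDiffAt.1 hm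
  have hsum : ContDiffAt ℝ ∞ (fun w : Phase n => ∑ i : Fin (n + 1), w.2 i •
    (EuclideanSpace.proj i : Coord n →L[ℝ] ℝ).comp
      (inTangentCoordinates (𝓡 (n + 1)) 𝓘(ℝ, Coord n) (fun z : Phase n => φ.symm z.1)
        (fun w => φ (φ.symm w.1)) (fun w : Phase n => mfderiv (𝓡 (n + 1)) 𝓘(ℝ, Coord n) φ
          (φ.symm w.1)) z w : Coord n →L[ℝ] Coord n)) z := by
    refine ContDiffAt.sum fun i _ => ?_
    have hi : ContDiffAt ℝ ∞ (fun w : Phase n => w.2 i) z :=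
      ((EuclideanSpace.proj i : Coord n →L[ℝ] ℝ).comp
        (ContinuousLinearMap.snd ℝ (Coord n) (Coord n))).contDiff.contDiffAt
    exact hi.smul (ContDiffAt.clm_comp
      (g := fun _ : Phase n => (EuclideanSpace.proj i : Coord n →L[ℝ] ℝ)) contDiffAt_const hm')
  refine (contMDiffAt_iff_contDiffAt.2 hsum).congr_of_eventuallyEq ?_
  refine Filter.Eventually.of_forall fun w => ?_
  have gen : ∀ (A : ℝ →L[ℝ] ℝ) (B : Coord n →L[ℝ] Coord n) (L S : Coord n →L[ℝ] Coord n),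
      A = ContinuousLinearMap.id ℝ ℝ → B = 1 →
      A ∘L (∑ i : Fin (n + 1), w.2 i • (EuclideanSpace.proj i : Coord n →L[ℝ] ℝ).comp L) ∘L S =
        ∑ i : Fin (n + 1), w.2 i • (EuclideanSpace.proj i : Coord n →L[ℝ] ℝ).comp (B ∘L L ∘L S) := by
    rintro A B L S rfl rfl
    ext v
    simp
  exact gen _ _ _ _ (Bundle.Trivial.continuousLinearMapAt_trivialization ..)
    (TangentBundle.continuousLinearMapAt_model_space ..)

/-- The Hamiltonian in natural coordinates. -/
noncomputable def coordHam (φ : OpenPartialHomeomorph M (Coord n)) (H : Cotangent n M → ℝ) (z : Phase n) : ℝ :=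
  H (ofCoord φ z)

theorem contDiffOn_coordHam {φ : OpenPartialHomeomorph M (Coord n)}
    (hφ : φ ∈ IsManifold.maximalAtlas (𝓡 (n + 1)) ∞ M) {H : Cotangent n M → ℝ} {m : ℕ}
    (hH : ContMDiff (cotangentModel n) 𝓘(ℝ, ℝ) m H) :
    ContDiffOn ℝ m (coordHam φ H) (φ.target ×ˢ Set.univ) := by
  intro z hz
  refine (contMDiffAt_iff_contDiffAt.1 ?_).contDiffWithinAt
  exact (hH.contMDiffAt).comp z ((contMDiffAt_ofCoord hφ hz.1).of_le (by exact_mod_cast le_top))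

end CotangentCoordinates

/-! ### Cutoffs, uniqueness of orbits, first visits of a level set -/

section Cutoff

variable {E F : Type*} [NormedAddCommGroup E] [NormedSpace ℝ E] [FiniteDimensional ℝ E]
  [NormedAddCommGroup F] [NormedSpace ℝ F]

/-- A `C^m` function on an open set agrees near a compact subset with a compactly supported
function of class `C^m`. -/
theorem exists_contDiff_eventuallyEq {m : ℕ∞} {f : E → F} {O K : Set E} (hO : IsOpen O)
    (hf : ContDiffOn ℝ m f O) (hK : IsCompact K) (hKO : K ⊆ O) :
    ∃ g : E → F, ContDiff ℝ m g ∧ HasCompactSupport g ∧ ∀ x ∈ K, g =ᶠ[𝓝 x] f := by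
  obtain ⟨K₁, hK₁, h1, h2⟩ := exists_compact_between hK hO hKO
  obtain ⟨χ, hχ1, hχ0, -⟩ := exists_contMDiffMap_one_nhds_of_subset_interior (n := m)
    𝓘(ℝ, E) hK.isClosed h1
  have hχs : tsupport χ ⊆ K₁ := by
    refine closure_minimal (fun x hx => ?_) hK₁.isClosed
    by_contra hx2
    exact hx (hχ0 x hx2)
  have hχ : ContDiff ℝ m χ := χ.contMDiff.contDiff
  have hs : tsupport (fun x => χ x • f x) ⊆ K₁ := (tsupport_smul_subset_left _ _).trans hχs
  refine ⟨fun x => χ x • f x, ?_, hK₁.of_isClosed_subset (isClosed_tsupport _) hs, fun x hx => ?_⟩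
  · rw [contDiff_iff_contDiffAt]
    intro x
    by_cases hx : x ∈ O
    · exact hχ.contDiffAt.smul (hf.contDiffAt (hO.mem_nhds hx))
    · have : x ∉ tsupport (fun x => χ x • f x) := fun h => hx (h2 (hs h))
      exact (contDiffAt_const (c := (0 : F))).congr_of_eventuallyEq
        (notMem_tsupport_iff_eventuallyEq.1 this)
  · filter_upwards [(eventually_nhdsSet_iff_forall.1 hχ1) x hx] with y hy
    simp [hy]

/-- Uniqueness of the solutions of an autonomous equation with a field of class `C¹` on an open
set. -/
theorem eqOn_of_hasDerivWithinAt {X : E → E} {O : Set E} (hO : IsOpen O)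
    (hX : ContDiffOn ℝ 1 X O) {f g : ℝ → E} {τ : ℝ}
    (hf : ∀ r ∈ Set.Icc 0 τ, f r ∈ O ∧ HasDerivWithinAt f (X (f r)) (Set.Icc 0 τ) r)
    (hg : ∀ r ∈ Set.Icc 0 τ, g r ∈ O ∧ HasDerivWithinAt g (X (g r)) (Set.Icc 0 τ) r)
    (h0 : f 0 = g 0) : Set.EqOn f g (Set.Icc 0 τ) := by
  have hfc : ContinuousOn f (Set.Icc 0 τ) := fun r hr => (hf r hr).2.continuousWithinAt
  have hgc : ContinuousOn g (Set.Icc 0 τ) := fun r hr => (hg r hr).2.continuousWithinAt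
  -- Cutting off near the compact images of both curves gives a compactly supported `C¹` field,
  -- which is globally Lipschitz.
  obtain ⟨Y, hY, hYs, hYX⟩ := exists_contDiff_eventuallyEq (m := 1) hO hX
    ((isCompact_Icc.image_of_continuousOn hfc).union (isCompact_Icc.image_of_continuousOn hgc))
    (by rintro x (⟨r, hr, rfl⟩ | ⟨r, hr, rfl⟩); exacts [(hf r hr).1, (hg r hr).1])
  obtain ⟨C, hC⟩ := hY.lipschitzWith_of_hasCompactSupport hYs (by simp)
  refine ODE_solution_unique_of_mem_Icc_right (v := fun _ => Y) (s := fun _ => Set.univ)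
    (K := C) (fun t _ => hC.lipschitzOnWith) hfc (fun t ht => ?_) (fun _ _ => trivial) hgc
    (fun t ht => ?_) (fun _ _ => trivial) h0
  · rw [(hYX (f t) (Or.inl ⟨t, Set.Ico_subset_Icc_self ht, rfl⟩)).self_of_nhds]
    exact ((hf t (Set.Ico_subset_Icc_self ht)).2).mono_of_mem_nhdsWithin (Icc_mem_nhdsGE_of_mem ht)
  · rw [(hYX (g t) (Or.inr ⟨t, Set.Ico_subset_Icc_self ht, rfl⟩)).self_of_nhds]
    exact ((hg t (Set.Ico_subset_Icc_self ht)).2).mono_of_mem_nhdsWithin (Icc_mem_nhdsGE_of_mem ht)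

/-- Two orbits from the same point that stop at their first visit of a level set of `x` end at the
same point. -/
theorem endpoint_unique {X : E → E} {O : Set E} (hO : IsOpen O)
    (hX : ContDiffOn ℝ 1 X O) (x : E → ℝ) {s t : ℝ} {D : Set ℝ} (ht : t ∉ D)
    (hD : s = t → D = ∅) {f g : ℝ → E} {τ σ : ℝ} (hτ : 0 ≤ τ) (hσ : 0 ≤ σ)
    (hf : ∀ r ∈ Set.Icc 0 τ, f r ∈ O ∧ HasDerivWithinAt f (X (f r)) (Set.Icc 0 τ) r)
    (hg : ∀ r ∈ Set.Icc 0 σ, g r ∈ O ∧ HasDerivWithinAt g (X (g r)) (Set.Icc 0 σ) r)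
    (h0 : f 0 = g 0) (hs : x (f 0) = s) (hfτ : x (f τ) = t) (hgσ : x (g σ) = t)
    (hfD : ∀ r ∈ Set.Ioo 0 τ, x (f r) ∈ D) (hgD : ∀ r ∈ Set.Ioo 0 σ, x (g r) ∈ D) :
    f τ = g σ := by
  wlog h : τ ≤ σ generalizing f g τ σ
  · exact (this hσ hτ hg hf h0.symm (h0 ▸ hs) hgσ hfτ hgD hfD (le_of_not_ge h)).symm
  have heq : f τ = g τ := eqOn_of_hasDerivWithinAt hO hX hf
    (fun r hr => ⟨(hg r ⟨hr.1, hr.2.trans h⟩).1,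
      (hg r ⟨hr.1, hr.2.trans h⟩).2.mono (Set.Icc_subset_Icc_right h)⟩) h0 ⟨hτ, le_rfl⟩
  -- If `τ < σ`, the longer orbit is at the level `t` at time `τ`. For `τ > 0` this is an interior
  -- time and contradicts `t ∉ D`; for `τ = 0` the levels `s` and `t` coincide, and `D` is empty
  -- although `(0, σ)` is not.
  rcases h.eq_or_lt with rfl | h
  · exact heq
  rcases hτ.eq_or_lt with rfl | hτ
  · have : D = ∅ := hD (hs.symm.trans hfτ)
    have h2 := hgD (σ / 2) ⟨by linarith, by linarith⟩
    simp [this] at h2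
  · exact absurd (hfτ ▸ heq ▸ hgD τ ⟨hτ, h⟩) ht

omit [FiniteDimensional ℝ E] in
theorem hasDerivWithinAt_reverse {X : E → E} {f : ℝ → E} {τ : ℝ}
    (hf : ∀ r ∈ Set.Icc 0 τ, HasDerivWithinAt f (X (f r)) (Set.Icc 0 τ) r) :
    ∀ r ∈ Set.Icc 0 τ, HasDerivWithinAt (fun r => f (τ - r)) (-X (f (τ - r))) (Set.Icc 0 τ) r := by
  intro r hr
  have h1 : HasDerivWithinAt (fun r : ℝ => τ - r) (-1) (Set.Icc 0 τ) r :=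
    ((hasDerivAt_id r).const_sub τ).hasDerivWithinAt
  have h2 := (hf (τ - r) ⟨by linarith [hr.2], by linarith [hr.1]⟩).scomp r h1
    (fun x hx => ⟨by linarith [hx.2], by linarith [hx.1]⟩)
  simpa [Function.comp_def] using h2

end Cutoff

/-! ### Hamiltonian orbits in coordinates and their reparametrization by `x₀` -/

section CoordinateOrbits

variable {n : ℕ}

/-- The Hamiltonian vector field as a linear function of the differential. -/
noncomputable def hamGrad (n : ℕ) : (Phase n →L[ℝ] ℝ) →L[ℝ] Phase n :=
  LinearMap.toContinuousLinearMap
    { toFun := fun L => (WithLp.toLp 2 fun i => L (0, EuclideanSpace.single i (1 : ℝ)),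
        WithLp.toLp 2 fun i => - L (EuclideanSpace.single i (1 : ℝ), 0))
      map_add' := fun L L' => by
        ext i
        · simp
        · simp [add_comm]
      map_smul' := fun c L => by
        ext i <;> simp }

theorem hamField_eq (K : Phase n → ℝ) (z : Phase n) : hamField K z = hamGrad n (fderiv ℝ K z) :=
  rfl

/-- The canonical symplectic form of the phase space. -/
noncomputable def phaseForm (n : ℕ) : Phase n →L[ℝ] Phase n →L[ℝ] ℝ :=
  (innerSL ℝ).bilinearComp (ContinuousLinearMap.fst ℝ (Coord n) (Coord n))
      (ContinuousLinearMap.snd ℝ (Coord n) (Coord n)) -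
    (innerSL ℝ).bilinearComp (ContinuousLinearMap.snd ℝ (Coord n) (Coord n))
      (ContinuousLinearMap.fst ℝ (Coord n) (Coord n))

theorem phaseForm_apply (v w : Phase n) :
    phaseForm n v w = ∑ i, (v.1 i * w.2 i - v.2 i * w.1 i) := by
  simp [phaseForm, PiLp.inner_apply, Finset.sum_sub_distrib, mul_comm]

theorem phaseForm_antisymm (v w : Phase n) : phaseForm n v w = - phaseForm n w v := by
  rw [phaseForm_apply, phaseForm_apply, ← Finset.sum_neg_distrib]
  exact Finset.sum_congr rfl fun i _ => by ring

theorem phaseForm_hamGrad (L : Phase n →L[ℝ] ℝ) (v : Phase n) :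
    phaseForm n (hamGrad n L) v = L v := by
  rw [phaseForm_apply]
  have h1 : L v = L (v.1, 0) + L (0, v.2) := by rw [← map_add]; simp
  have h2 : L (v.1, 0) = ∑ i, v.1 i * L (EuclideanSpace.single i (1 : ℝ), 0) := by
    have := congrArg (L.comp (ContinuousLinearMap.inl ℝ (Coord n) (Coord n))) (coord_eq_sum v.1)
    rw [map_sum] at this
    exact this.trans (Finset.sum_congr rfl fun i _ => by rw [map_smul]; rfl)
  have h3 : L (0, v.2) = ∑ i, v.2 i * L (0, EuclideanSpace.single i (1 : ℝ)) := by
    have := congrArg (L.comp (ContinuousLinearMap.inr ℝ (Coord n) (Coord n))) (coord_eq_sum v.2)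
    rw [map_sum] at this
    exact this.trans (Finset.sum_congr rfl fun i _ => by rw [map_smul]; rfl)
  rw [h1, h2, h3, ← Finset.sum_add_distrib]
  refine Finset.sum_congr rfl fun i _ => ?_
  simp [hamGrad]
  ring

theorem contDiffOn_hamField {K : Phase n → ℝ} {O : Set (Phase n)} (hO : IsOpen O) {m : ℕ}
    (hK : ContDiffOn ℝ (m + 1 : ℕ) K O) : ContDiffOn ℝ m (hamField K) O :=
  (hamGrad n).contDiff.comp_contDiffOn (hK.fderiv_of_isOpen hO (by norm_cast))

/-- The relation `Crosses` in natural coordinates, over the open set `Ω` of `ℝ × ℝⁿ`. -/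
def CoordCrosses (Ω : Set (Coord n)) (K : Phase n → ℝ) (s t : ℝ) (z w : Phase n) : Prop :=
  z.1 ∈ Ω ∧ z.1 0 = s ∧ w.1 ∈ Ω ∧ w.1 0 = t ∧ ∃ τ : ℝ, 0 ≤ τ ∧ ∃ ζ : ℝ → Phase n,
    (∀ r ∈ Set.Icc 0 τ, ζ r ∈ Ω ×ˢ Set.univ ∧
      HasDerivWithinAt ζ (hamField K (ζ r)) (Set.Icc 0 τ) r) ∧
    ζ 0 = z ∧ ζ τ = w ∧ ∀ r ∈ Set.Ioo 0 τ, (ζ r).1 0 ∈ Set.Ioo s t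

theorem CoordCrosses.right_unique {Ω : Set (Coord n)} (hΩ : IsOpen Ω) {K : Phase n → ℝ}
    (hK : ContDiffOn ℝ 1 (hamField K) (Ω ×ˢ Set.univ)) {s t : ℝ} {z w w' : Phase n}
    (h : CoordCrosses Ω K s t z w) (h' : CoordCrosses Ω K s t z w') : w = w' := by
  obtain ⟨hz, hzs, hw, hwt, τ, hτ, f, hf, hf0, hfτ, hfD⟩ := h
  obtain ⟨-, -, hw', hwt', σ, hσ, g, hg, hg0, hgσ, hgD⟩ := h'
  rw [← hfτ, ← hgσ]
  exact endpoint_unique (hΩ.prod isOpen_univ) hK (fun z => z.1 0) (s := s) (t := t)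
    (D := Set.Ioo s t) (by simp) (by rintro rfl; simp) hτ hσ hf hg (hf0.trans hg0.symm)
    (by rw [hf0, hzs]) (by rw [hfτ, hwt]) (by rw [hgσ, hwt']) hfD hgD

theorem CoordCrosses.left_unique {Ω : Set (Coord n)} (hΩ : IsOpen Ω) {K : Phase n → ℝ}
    (hK : ContDiffOn ℝ 1 (hamField K) (Ω ×ˢ Set.univ)) {s t : ℝ} {z z' w : Phase n}
    (h : CoordCrosses Ω K s t z w) (h' : CoordCrosses Ω K s t z' w) : z = z' := by
  obtain ⟨hz, hzs, hw, hwt, τ, hτ, f, hf, hf0, hfτ, hfD⟩ := h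
  obtain ⟨hz', hzs', -, -, σ, hσ, g, hg, hg0, hgσ, hgD⟩ := h'
  have hf' := hasDerivWithinAt_reverse (X := hamField K) (fun r hr => (hf r hr).2)
  have hg' := hasDerivWithinAt_reverse (X := hamField K) (fun r hr => (hg r hr).2)
  have := endpoint_unique (X := fun z => -hamField K z) (f := fun r => f (τ - r))
    (g := fun r => g (σ - r)) (hΩ.prod isOpen_univ) hK.neg (fun z => z.1 0) (s := t) (t := s)
    (D := Set.Ioo s t) (by simp) (by rintro rfl; simp) hτ hσ
    (fun r hr => ⟨(hf (τ - r) ⟨by linarith [hr.2], by linarith [hr.1]⟩).1, hf' r hr⟩)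
    (fun r hr => ⟨(hg (σ - r) ⟨by linarith [hr.2], by linarith [hr.1]⟩).1, hg' r hr⟩)
    (by simp [hfτ, hgσ]) (by simp [hfτ, hwt]) (by simp [hf0, hzs])
    (by simp [hg0, hzs'])
    (fun r hr => hfD (τ - r) ⟨by linarith [hr.2], by linarith [hr.1]⟩)
    (fun r hr => hgD (σ - r) ⟨by linarith [hr.2], by linarith [hr.1]⟩)
  simpa [hf0, hg0] using this

/-- A curve along which `x₀` is the time and that is tangent to the Hamiltonian vector field is
an orbit, up to reparametrization. -/
theorem coordCrosses_of_path {Ω : Set (Coord n)} {K : Phase n → ℝ} {t : ℝ} (ht : 0 ≤ t)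
    {ζ : ℝ → Phase n} (hΩ : ∀ r ∈ Set.Icc 0 t, (ζ r).1 ∈ Ω)
    (hpos : ∀ r ∈ Set.Icc 0 t, 0 < (hamField K (ζ r)).1 0)
    (hcont : ContinuousOn (fun r => (hamField K (ζ r)).1 0) (Set.Icc 0 t))
    (hd : ∀ r ∈ Set.Icc 0 t, HasDerivWithinAt ζ (((hamField K (ζ r)).1 0)⁻¹ • hamField K (ζ r))
      (Set.Icc 0 t) r) (hx : ∀ r ∈ Set.Icc 0 t, (ζ r).1 0 = r) :
    CoordCrosses Ω K 0 t (ζ 0) (ζ t) := by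
  have h0 : (0 : ℝ) ∈ Set.Icc 0 t := ⟨le_rfl, ht⟩
  have h1 : t ∈ Set.Icc 0 t := ⟨ht, le_rfl⟩
  refine ⟨hΩ 0 h0, hx 0 h0, hΩ t h1, hx t h1, ?_⟩
  set q : Set.Icc 0 t → ℝ := fun r => ((hamField K (ζ r)).1 0)⁻¹ with hq
  have hqc : Continuous q := by
    refine Continuous.inv₀ (continuousOn_iff_continuous_domRestrict.1 hcont) fun r => ?_
    exact (hpos r r.2).ne'
  have hqpos : ∀ r, 0 < q r := fun r => inv_pos.2 (hpos r r.2)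
  set p : ℝ → ℝ := Set.IccExtend ht q with hp
  have hpc : Continuous p := hqc.Icc_extend'
  have hppos : ∀ r, 0 < p r := fun r => hqpos _
  obtain ⟨c, hc, hcp⟩ : ∃ c, 0 < c ∧ ∀ r, c ≤ p r := by
    obtain ⟨r₀, -, hr₀⟩ := isCompact_univ.exists_isMinOn (f := q) ⟨⟨0, h0⟩, trivial⟩
      hqc.continuousOn
    exact ⟨q r₀, hqpos r₀, fun r => hr₀ (Set.mem_univ _)⟩
  -- `S r` is the Hamiltonian time needed to reach `x₀ = r`. Its density `p` is extended by
  -- constants outside `[0, t]` and bounded below, so `S` is a bijection of `ℝ`, and its inverse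
  -- reparametrizes the curve as a genuine orbit.
  set S : ℝ → ℝ := fun r => ∫ x in (0 : ℝ)..r, p x with hS
  have hSd : ∀ r, HasDerivAt S (p r) r := fun r => hpc.integral_hasStrictDerivAt 0 r |>.hasDerivAt
  have hSm : StrictMono S := strictMono_of_hasDerivAt_pos hSd hppos
  have hS0 : S 0 = 0 := by simp [hS]
  have hmono : Monotone fun r => S r - c * r := by
    refine monotone_of_hasDerivAt_nonneg (f' := fun r => p r - c)
      (fun r => ((hSd r).fun_sub ((hasDerivAt_id r).const_mul c)).congr_deriv (by simp)) fun r => ?_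
    simpa using hcp r
  have hSs : Function.Surjective S := by
    refine Continuous.surjective (continuous_iff_continuousAt.2 fun r => (hSd r).continuousAt) ?_ ?_
    · refine Filter.tendsto_atTop_mono' _ ?_ (Filter.tendsto_id.const_mul_atTop hc)
      filter_upwards [Filter.eventually_ge_atTop 0] with r hr
      have := hmono hr
      simp [hS0] at this
      simpa using this
    · refine Filter.tendsto_atBot_mono' _ ?_ (Filter.tendsto_id.const_mul_atBot hc)
      filter_upwards [Filter.eventually_le_atBot 0] with r hr
      have := hmono hr
      simp [hS0] at this
      simpa using this
  set e := hSm.orderIsoOfSurjective S hSs with he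
  have heS : ∀ r, S (e.symm r) = r := fun r => hSm.orderIsoOfSurjective_self_symm_apply S hSs r
  have hes : ∀ r, e.symm (S r) = r := fun r => hSm.orderIsoOfSurjective_symm_apply_self S hSs r
  have hed : ∀ r, HasDerivAt e.symm (p (e.symm r))⁻¹ r := fun r =>
    HasDerivAt.of_local_left_inverse e.symm.continuous.continuousAt (hSd _) (hppos _).ne'
      (Filter.Eventually.of_forall heS)
  have he0 : e.symm 0 = 0 := by rw [← hS0]; exact hes 0 |>.trans hS0.symm
  have hmem : ∀ r ∈ Set.Icc 0 (S t), e.symm r ∈ Set.Icc 0 t := fun r hr =>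
    ⟨by rw [← he0]; exact e.symm.monotone hr.1, by rw [← hes t]; exact e.symm.monotone hr.2⟩
  refine ⟨S t, hS0 ▸ hSm.monotone ht, fun r => ζ (e.symm r), fun r hr => ⟨⟨hΩ _ (hmem r hr),
    trivial⟩, ?_⟩, by simp only [he0], by simp only [hes], fun r hr => ?_⟩
  · have := (hd _ (hmem r hr)).scomp r (hed r).hasDerivWithinAt hmem
    refine this.congr_deriv ?_
    rw [hp, Set.IccExtend_of_mem ht q (hmem r hr), hq]
    simp [smul_smul, (hpos _ (hmem r hr)).ne']
  · have hr' : e.symm r ∈ Set.Ioo 0 t :=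
      ⟨by rw [← he0]; exact e.symm.strictMono hr.1, by rw [← hes t]; exact e.symm.strictMono hr.2⟩
    rw [hx _ (Set.Ioo_subset_Icc_self hr')]
    exact hr'

end CoordinateOrbits

end ManeJets

namespace ManeJets

/-! ### Evaluation of the Poincaré maps -/

section Evaluation

variable {n : ℕ} {M : Type*} [TopologicalSpace M] [ChartedSpace (Coord n) M]

theorem crosses_iff {φ : OpenPartialHomeomorph M (Coord n)}
    (hφ : φ ∈ IsManifold.maximalAtlas (𝓡 (n + 1)) ∞ M) {H : Cotangent n M → ℝ} {s t : ℝ}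
    {z w : Cotangent n M} :
    Crosses φ H s t z w ↔ z.proj ∈ φ.source ∧ w.proj ∈ φ.source ∧
      CoordCrosses φ.target (coordHam φ H) s t (toCoord φ z) (toCoord φ w) := by
  constructor
  · rintro ⟨hz, hw, τ, hτ, η, hη, rfl, rfl, hD⟩
    exact ⟨hz.1, hw.1, φ.map_source hz.1, hz.2, φ.map_source hw.1, hw.2, τ, hτ,
      fun r => toCoord φ (η r), fun r hr => ⟨⟨φ.map_source (hη r hr).1, trivial⟩, (hη r hr).2⟩,
      rfl, rfl, hD⟩
  · rintro ⟨hz, hw, -, hz0, -, hw0, τ, hτ, ζ, hζ, hζ0, hζτ, hD⟩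
    refine ⟨⟨hz, hz0⟩, ⟨hw, hw0⟩, τ, hτ, fun r => ofCoord φ (ζ r), fun r hr => ⟨?_, ?_⟩, ?_, ?_, ?_⟩
    · exact φ.map_target (hζ r hr).1.1
    · refine HasDerivWithinAt.congr_of_mem ?_ (fun x hx => toCoord_ofCoord hφ (hζ x hx).1.1) hr
      rw [toCoord_ofCoord hφ (hζ r hr).1.1]
      exact (hζ r hr).2
    · simp only [hζ0, ofCoord_toCoord hφ hz]
    · simp only [hζτ, ofCoord_toCoord hφ hw]
    · intro r hr
      have h1 := hD r hr
      rwa [← φ.right_inv (hζ r (Set.Ioo_subset_Icc_self hr)).1.1] at h1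

/-- The definition picks some crossing orbit; by uniqueness, exhibiting any one of them computes the
map. -/
theorem poincare_eq {φ : OpenPartialHomeomorph M (Coord n)}
    (hφ : φ ∈ IsManifold.maximalAtlas (𝓡 (n + 1)) ∞ M) {H : Cotangent n M → ℝ}
    (hK : ContDiffOn ℝ 1 (hamField (coordHam φ H)) (φ.target ×ˢ Set.univ)) {t : ℝ}
    {z w : Cotangent n M} (h : Crosses φ H 0 t z w) : poincare φ H t z = w := by
  have hex : ∃ w, Crosses φ H 0 t z w := ⟨w, h⟩
  rw [poincare, dif_pos hex]
  have h1 := (crosses_iff hφ).1 hex.choose_spec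
  have h2 := (crosses_iff hφ).1 h
  have := h1.2.2.right_unique φ.open_target hK h2.2.2
  rw [← ofCoord_toCoord hφ h1.2.1, this, ofCoord_toCoord hφ h2.2.1]

theorem poincareInv_eq {φ : OpenPartialHomeomorph M (Coord n)}
    (hφ : φ ∈ IsManifold.maximalAtlas (𝓡 (n + 1)) ∞ M) {H : Cotangent n M → ℝ}
    (hK : ContDiffOn ℝ 1 (hamField (coordHam φ H)) (φ.target ×ˢ Set.univ)) {t : ℝ}
    {z w : Cotangent n M} (h : Crosses φ H 0 t z w) : poincareInv φ H t w = z := by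
  have hex : ∃ z, Crosses φ H 0 t z w := ⟨z, h⟩
  rw [poincareInv, dif_pos hex]
  have h1 := (crosses_iff hφ).1 hex.choose_spec
  have h2 := (crosses_iff hφ).1 h
  have := h1.2.2.left_unique φ.open_target hK h2.2.2
  rw [← ofCoord_toCoord hφ h1.1, this, ofCoord_toCoord hφ h2.1]

theorem CoordCrosses.crosses_ofCoord {φ : OpenPartialHomeomorph M (Coord n)}
    (hφ : φ ∈ IsManifold.maximalAtlas (𝓡 (n + 1)) ∞ M) {H : Cotangent n M → ℝ} {s t : ℝ}
    {z w : Phase n} (h : CoordCrosses φ.target (coordHam φ H) s t z w) :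
    Crosses φ H s t (ofCoord φ z) (ofCoord φ w) := by
  have hz := h.1
  have hw := h.2.2.1
  refine (crosses_iff hφ).2 ⟨φ.map_target hz, φ.map_target hw, ?_⟩
  rwa [toCoord_ofCoord hφ hz, toCoord_ofCoord hφ hw]

end Evaluation

/-! ### The rescaled Hamiltonian field near the arc -/

section ClockField

variable {n : ℕ}

/-- The compact-open topology turns a condition holding near each point of a compact curve into one
holding along all nearby curves. -/
theorem eventually_forall_of_forall_eventually {I E : Type*} [TopologicalSpace I] [CompactSpace I]
    [TopologicalSpace E] {θ : C(I, E)} {P : E → Prop} (h : ∀ t, ∀ᶠ z in 𝓝 (θ t), P z) :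
    ∀ᶠ η in 𝓝 θ, ∀ t, P (η t) := by
  have hO : IsOpen {z | ∀ᶠ z' in 𝓝 z, P z'} := isOpen_setOfPred_eventually_nhds
  have := (ContinuousMap.isOpen_setOfPred_mapsTo (X := I) isCompact_univ hO).mem_nhds
    (show θ ∈ _ from fun t _ => h t)
  filter_upwards [this] with η hη t
  exact (hη (Set.mem_univ t)).self_of_nhds

/-- The Hamiltonian vector field, rescaled so that `x₀` is the time. -/
noncomputable def unitField (K : Phase n → ℝ) (z : Phase n) : Phase n :=
  ((hamField K z).1 0)⁻¹ • hamField K z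

/-- Near the curve `θ`, over `Ω`, the function `x₀` increases along the orbits of `K`, and `X` is
the rescaled Hamiltonian vector field. -/
def IsClockField (Ω : Set (Coord n)) (K : Phase n → ℝ) {a : ℝ} (X : Phase n → Phase n)
    (θ : C(Set.Icc (0 : ℝ) a, Phase n)) : Prop :=
  ∀ t, ∀ᶠ z in 𝓝 (θ t), z ∈ Ω ×ˢ (Set.univ : Set (Coord n)) ∧ 0 < (hamField K z).1 0 ∧
    ContinuousAt (hamField K) z ∧ X z = unitField K z

/-- The solutions of a differential equation on `[0, a]`. -/
def IsSolution {E : Type*} [NormedAddCommGroup E] [NormedSpace ℝ E] {a : ℝ} (ha : 0 ≤ a)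
    (X : E → E) (η : C(Set.Icc (0 : ℝ) a, E)) : Prop :=
  ∀ t : Set.Icc (0 : ℝ) a, HasDerivWithinAt (Set.IccExtend ha η) (X (η t)) (Set.Icc 0 a) t

/-- The linear form `x₀`. -/
noncomputable def clock (n : ℕ) : Phase n →L[ℝ] ℝ :=
  (EuclideanSpace.proj (0 : Fin (n + 1)) : Coord n →L[ℝ] ℝ).comp
    (ContinuousLinearMap.fst ℝ (Coord n) (Coord n))

theorem clock_apply (z : Phase n) : clock n z = z.1 0 := rfl

/-- The rescaled field has `x₀`-component one. This is known only near the arc, so the solution must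
stay close to `θ`. -/
theorem IsClockField.eventually_clock {Ω : Set (Coord n)} {K : Phase n → ℝ} {a : ℝ}
    (ha : 0 ≤ a) {X : Phase n → Phase n} {θ : C(Set.Icc (0 : ℝ) a, Phase n)}
    (hX : IsClockField Ω K X θ) :
    ∀ᶠ η in 𝓝 θ, IsSolution ha X η → ∀ r : Set.Icc (0 : ℝ) a,
      (η r).1 0 = (η ⟨0, le_rfl, ha⟩).1 0 + r := by
  filter_upwards [eventually_forall_of_forall_eventually hX] with η hη hs
  have h1 : ∀ r : Set.Icc (0 : ℝ) a, HasDerivWithinAt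
      (fun r => clock n (Set.IccExtend ha η r)) ((1 : C(Set.Icc (0 : ℝ) a, ℝ)) r)
      (Set.Icc 0 a) r := by
    intro r
    have := ((clock n).hasFDerivAt.comp_hasDerivWithinAt (r : ℝ) (hs r))
    refine this.congr_deriv ?_
    rw [(hη r).2.2.2, unitField, map_smul, clock_apply]
    simp [(hη r).2.1.ne']
  intro r
  have h2 := sub_eq_integral_of_hasDerivWithinAt ha 1 h1 r
  have h3 : ∫ x in (0 : ℝ)..r, Set.IccExtend ha (1 : C(Set.Icc (0 : ℝ) a, ℝ)) x = r := by
    have : Set.IccExtend ha (1 : C(Set.Icc (0 : ℝ) a, ℝ)) = fun _ => (1 : ℝ) := by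
      ext x; rfl
    rw [this]; simp
  rw [h3, Set.IccExtend_val, Set.IccExtend_of_mem ha η (x := 0) ⟨le_rfl, ha⟩, clock_apply,
    clock_apply] at h2
  linarith

/-- The bridge from the rescaled equation on the fixed interval `[0, a]` to the Poincaré maps, whose
orbits have unprescribed travel times. -/
theorem IsClockField.eventually_coordCrosses {Ω : Set (Coord n)} {K : Phase n → ℝ} {a : ℝ}
    (ha : 0 ≤ a) {X : Phase n → Phase n} {θ : C(Set.Icc (0 : ℝ) a, Phase n)}
    (hX : IsClockField Ω K X θ) :
    ∀ᶠ η in 𝓝 θ, IsSolution ha X η → (η ⟨0, le_rfl, ha⟩).1 0 = 0 → ∀ t : Set.Icc (0 : ℝ) a,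
      CoordCrosses Ω K 0 t (η ⟨0, le_rfl, ha⟩) (η t) := by
  filter_upwards [eventually_forall_of_forall_eventually hX, hX.eventually_clock ha]
    with η hη hclock hs h0 t
  have hx : ∀ r : Set.Icc (0 : ℝ) a, (η r).1 0 = r := fun r => by rw [hclock hs r, h0, zero_add]
  have hta : ∀ r ∈ Set.Icc (0 : ℝ) t, r ∈ Set.Icc 0 a := fun r hr => ⟨hr.1, hr.2.trans t.2.2⟩
  have key : ∀ r (hr : r ∈ Set.Icc (0 : ℝ) t), Set.IccExtend ha η r = η ⟨r, hta r hr⟩ :=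
    fun r hr => Set.IccExtend_of_mem ha η (hta r hr)
  have := coordCrosses_of_path (Ω := Ω) (K := K) (ζ := Set.IccExtend ha η) t.2.1
    (fun r hr => by rw [key r hr]; exact (hη _).1.1) (fun r hr => by rw [key r hr]; exact (hη _).2.1)
    (fun r hr => by
      have h1 : ContinuousAt (fun z => (hamField K z).1 0) (Set.IccExtend ha η r) := by
        rw [key r hr]
        exact (clock n).continuous.continuousAt.comp (hη ⟨r, hta r hr⟩).2.2.1
      exact (ContinuousAt.comp (f := Set.IccExtend ha η) (g := fun z => (hamField K z).1 0) h1
        η.continuous.Icc_extend'.continuousAt).continuousWithinAt)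
    (fun r hr => by
      have h1 := (hs ⟨r, hta r hr⟩).mono (s := Set.Icc 0 (t : ℝ)) (Set.Icc_subset_Icc_right t.2.2)
      rw [(hη ⟨r, hta r hr⟩).2.2.2, ← key r hr] at h1
      exact h1)
    (fun r hr => by rw [key r hr]; exact hx ⟨r, hta r hr⟩)
  rwa [Set.IccExtend_of_mem ha η (x := 0) ⟨le_rfl, ha⟩, Set.IccExtend_val] at this

/-- The curve `θ` is an orbit of `K` over the open set `Ω`, along the axis of `x₀`, and `K` is of
class `C^(k+1)`. -/
structure IsArc (Ω : Set (Coord n)) (k : ℕ) (K : Phase n → ℝ) {a : ℝ} (ha : 0 < a)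
    (θ : C(Set.Icc (0 : ℝ) a, Phase n)) : Prop where
  isOpen : IsOpen Ω
  contDiffOn : ContDiffOn ℝ (k + 1 : ℕ) K (Ω ×ˢ Set.univ)
  mem : ∀ t, θ t ∈ Ω ×ˢ (Set.univ : Set (Coord n))
  base : ∀ t : Set.Icc (0 : ℝ) a, (θ t).1 = EuclideanSpace.single 0 (t : ℝ)
  isSolution : IsSolution ha.le (hamField K) θ

namespace IsArc

variable {Ω : Set (Coord n)} {k : ℕ} {K : Phase n → ℝ} {a : ℝ} {ha : 0 < a}
  {θ : C(Set.Icc (0 : ℝ) a, Phase n)}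

theorem isOpen_prod (h : IsArc Ω k K ha θ) : IsOpen (Ω ×ˢ (Set.univ : Set (Coord n))) :=
  h.isOpen.prod isOpen_univ

theorem contDiffOn_hamField (h : IsArc Ω k K ha θ) :
    ContDiffOn ℝ k (hamField K) (Ω ×ˢ Set.univ) :=
  ManeJets.contDiffOn_hamField h.isOpen_prod h.contDiffOn

/-- The base curve is the axis with unit speed. Besides fixing the clock rate on the arc, this later
identifies `dH` of the perturbation with a derivative of `V` along the axis. -/
theorem hamField_fst (h : IsArc Ω k K ha θ) (t : Set.Icc (0 : ℝ) a) :
    (hamField K (θ t)).1 = EuclideanSpace.single 0 1 := by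
  have h1 : HasDerivWithinAt (fun r => (Set.IccExtend ha.le θ r).1) (hamField K (θ t)).1
      (Set.Icc 0 a) t :=
    (ContinuousLinearMap.fst ℝ (Coord n) (Coord n)).hasFDerivAt.comp_hasDerivWithinAt _
      (h.isSolution t)
  have h2 : HasDerivWithinAt (fun r : ℝ => r • (EuclideanSpace.single 0 1 : Coord n))
      (EuclideanSpace.single 0 1) (Set.Icc 0 a) t := by
    simpa using ((hasDerivAt_id (t : ℝ)).smul_const
      (EuclideanSpace.single 0 1 : Coord n)).hasDerivWithinAt
  have h3 : ∀ r ∈ Set.Icc 0 a, (Set.IccExtend ha.le θ r).1 =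
      r • (EuclideanSpace.single 0 1 : Coord n) := by
    intro r hr
    rw [Set.IccExtend_of_mem ha.le θ hr, h.base]
    ext i
    simp
  exact ((uniqueDiffOn_Icc ha) t t.2).eq_deriv _ h1 (h2.congr_of_mem h3 t.2)

theorem hamField_clock (h : IsArc Ω k K ha θ) (t : Set.Icc (0 : ℝ) a) :
    (hamField K (θ t)).1 0 = 1 := by
  rw [h.hamField_fst]; simp

/-- The rate of `x₀` is nonzero on an open neighbourhood of the compact arc, so local data can be
cut off there. Globally defined fields are what composition operators on path spaces require. -/
theorem exists_eventuallyEq (h : IsArc Ω k K ha θ) {F : Type*} [NormedAddCommGroup F]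
    [NormedSpace ℝ F] (f : Phase n → F)
    (hf : ∀ z ∈ Ω ×ˢ (Set.univ : Set (Coord n)), (hamField K z).1 0 ≠ 0 → ContDiffAt ℝ k f z) :
    ∃ g : Phase n → F, ContDiff ℝ k g ∧ ∀ t, g =ᶠ[𝓝 (θ t)] f := by
  have hc : ContinuousOn (fun z => (hamField K z).1 0) (Ω ×ˢ Set.univ) :=
    (clock n).continuous.comp_continuousOn h.contDiffOn_hamField.continuousOn
  have hO := hc.isOpen_inter_preimage h.isOpen_prod isOpen_ne (t := {x : ℝ | x ≠ 0})
  obtain ⟨g, hg, -, hgf⟩ := exists_contDiff_eventuallyEq (m := k) (f := f) hO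
    (fun z hz => (hf z hz.1 hz.2).contDiffWithinAt) (isCompact_range θ.continuous) (by
      rintro _ ⟨t, rfl⟩
      refine ⟨h.mem t, ?_⟩
      simp [h.hamField_clock t])
  exact ⟨g, by exact_mod_cast hg, fun t => hgf _ ⟨t, rfl⟩⟩

theorem contDiffAt_inv (h : IsArc Ω k K ha θ) {z : Phase n}
    (hz : z ∈ Ω ×ˢ (Set.univ : Set (Coord n))) (h0 : (hamField K z).1 0 ≠ 0) :
    ContDiffAt ℝ k (fun z => ((hamField K z).1 0)⁻¹) z :=
  ((clock n).contDiff.contDiffAt.comp z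
    (h.contDiffOn_hamField.contDiffAt (h.isOpen_prod.mem_nhds hz))).inv h0

theorem exists_clockRate (h : IsArc Ω k K ha θ) :
    ∃ g : Phase n → ℝ, ContDiff ℝ k g ∧ ∀ t, g =ᶠ[𝓝 (θ t)] fun z => ((hamField K z).1 0)⁻¹ :=
  h.exists_eventuallyEq _ fun _ hz h0 => h.contDiffAt_inv hz h0

theorem exists_unitField (h : IsArc Ω k K ha θ) :
    ∃ X : Phase n → Phase n, ContDiff ℝ k X ∧ ∀ t, X =ᶠ[𝓝 (θ t)] unitField K :=
  h.exists_eventuallyEq _ fun _ hz h0 => (h.contDiffAt_inv hz h0).smul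
    (h.contDiffOn_hamField.contDiffAt (h.isOpen_prod.mem_nhds hz))

theorem eventually_pos (h : IsArc Ω k K ha θ) (t : Set.Icc (0 : ℝ) a) :
    ∀ᶠ z in 𝓝 (θ t), z ∈ Ω ×ˢ (Set.univ : Set (Coord n)) ∧ 0 < (hamField K z).1 0 ∧
      ContinuousAt (hamField K) z := by
  have hO := h.isOpen_prod.mem_nhds (h.mem t)
  have hc : ContinuousAt (fun z => (hamField K z).1 0) (θ t) :=
    (clock n).continuous.continuousAt.comp (h.contDiffOn_hamField.continuousOn.continuousAt hO)
  filter_upwards [hO, hc.eventually (lt_mem_nhds (by simp [h.hamField_clock t] :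
    (0 : ℝ) < (hamField K (θ t)).1 0))] with z hz hz'
  exact ⟨hz, hz', h.contDiffOn_hamField.continuousOn.continuousAt (h.isOpen_prod.mem_nhds hz)⟩

theorem isClockField (h : IsArc Ω k K ha θ) {X : Phase n → Phase n}
    (hX : ∀ t, X =ᶠ[𝓝 (θ t)] unitField K) : IsClockField Ω K X θ := fun t => by
  filter_upwards [h.eventually_pos t, hX t] with z hz hz'
  exact ⟨hz.1, hz.2.1, hz.2.2, hz'⟩

theorem unitField_eq (h : IsArc Ω k K ha θ) (t : Set.Icc (0 : ℝ) a) :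
    unitField K (θ t) = hamField K (θ t) := by
  rw [unitField, h.hamField_clock]; simp

end IsArc

end ClockField

end ManeJets

namespace ManeJets

/-! ### Solutions as zeros of the integral equation, and time reversal -/

section Solutions

universe u
variable {E : Type u} [NormedAddCommGroup E] [NormedSpace ℝ E] {a : ℝ}

theorem IsSolution.odeDefect_eq [CompleteSpace E] {ha : 0 ≤ a} {X : C(E, E)}
    {η : C(Set.Icc (0 : ℝ) a, E)} (h : IsSolution ha X η) :
    odeDefect ha X η = constPath a (η ⟨0, le_rfl, ha⟩) := by
  have := eq_primitive_of_hasDerivWithinAt ha η (X.comp η) h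
  rw [odeDefect, sub_eq_iff_eq_add]
  exact this

theorem isSolution_of_odeDefect_eq [CompleteSpace E] {ha : 0 ≤ a} {X : C(E, E)}
    {η : C(Set.Icc (0 : ℝ) a, E)} {v : E} (h : odeDefect ha X η = constPath a v) :
    IsSolution ha X η ∧ η ⟨0, le_rfl, ha⟩ = v := by
  have h1 : η = ContinuousMap.const _ v + primitive ha (X.comp η) := by
    rw [odeDefect, sub_eq_iff_eq_add] at h
    exact h
  exact ⟨fun t => hasDerivWithinAt_of_eq_primitive ha h1 t, apply_zero_of_eq_primitive ha h1⟩

/-- The reversal of the time, on `[0, a]`. -/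
def reverseTime (a : ℝ) : C(Set.Icc (0 : ℝ) a, Set.Icc (0 : ℝ) a) :=
  ⟨fun t => ⟨a - t, by linarith [t.2.2], by linarith [t.2.1]⟩, by fun_prop⟩

theorem reverseTime_coe (t : Set.Icc (0 : ℝ) a) : (reverseTime a t : ℝ) = a - t := rfl

theorem reverseTime_reverseTime (t : Set.Icc (0 : ℝ) a) : reverseTime a (reverseTime a t) = t :=
  Subtype.ext (by simp [reverseTime_coe])

theorem reverseTime_zero (ha : 0 ≤ a) : reverseTime a ⟨0, le_rfl, ha⟩ = ⟨a, ha, le_rfl⟩ :=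
  Subtype.ext (by simp [reverseTime_coe])

theorem reverseTime_last (ha : 0 ≤ a) : reverseTime a ⟨a, ha, le_rfl⟩ = ⟨0, le_rfl, ha⟩ :=
  Subtype.ext (by simp [reverseTime_coe])

omit [NormedSpace ℝ E] in
theorem comp_reverseTime_comp_reverseTime (η : C(Set.Icc (0 : ℝ) a, E)) :
    (η.comp (reverseTime a)).comp (reverseTime a) = η := by
  ext t
  simp [reverseTime_reverseTime]

omit [NormedSpace ℝ E] in
theorem continuous_comp_reverseTime :
    Continuous fun η : C(Set.Icc (0 : ℝ) a, E) => η.comp (reverseTime a) :=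
  ContinuousMap.continuous_precomp _

theorem IsSolution.reverse {ha : 0 ≤ a} {X : E → E} {η : C(Set.Icc (0 : ℝ) a, E)}
    (h : IsSolution ha X η) : IsSolution ha (fun z => -X z) (η.comp (reverseTime a)) := by
  have h1 := hasDerivWithinAt_reverse (X := X) (f := Set.IccExtend ha η) (τ := a) (fun r hr => by
    have := h ⟨r, hr⟩
    rwa [← Set.IccExtend_of_mem ha η hr] at this)
  intro t
  have h2 := h1 t t.2
  have h3 : ∀ r (hr : r ∈ Set.Icc 0 a), Set.IccExtend ha η (a - r) =
      Set.IccExtend ha (η.comp (reverseTime a)) r := fun r hr => by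
    rw [Set.IccExtend_of_mem ha _ hr, Set.IccExtend_of_mem ha _ (x := a - r)
      ⟨by linarith [hr.2], by linarith [hr.1]⟩]
    rfl
  have h4 := h2.congr_of_mem (fun r hr => (h3 r hr).symm) t.2
  rw [h3 t t.2, Set.IccExtend_val] at h4
  exact h4

end Solutions

/-! ### Infinitesimal invariance of clock, energy and symplectic form along the arc -/

namespace IsArc

variable {n : ℕ} {Ω : Set (Coord n)} {k : ℕ} {K : Phase n → ℝ} {a : ℝ} {ha : 0 < a}
  {θ : C(Set.Icc (0 : ℝ) a, Phase n)}

theorem contDiffAt_fderiv (h : IsArc Ω k K ha θ) (t : Set.Icc (0 : ℝ) a) :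
    ContDiffAt ℝ k (fderiv ℝ K) (θ t) :=
  (h.contDiffOn.fderiv_of_isOpen h.isOpen_prod (by norm_cast)).contDiffAt
    (h.isOpen_prod.mem_nhds (h.mem t))

theorem second_symm (h : IsArc Ω k K ha θ) (hk : 1 ≤ k) (t : Set.Icc (0 : ℝ) a) (v w : Phase n) :
    fderiv ℝ (fderiv ℝ K) (θ t) v w = fderiv ℝ (fderiv ℝ K) (θ t) w v := by
  have h1 : ContDiffAt ℝ (k + 1 : ℕ) K (θ t) :=
    h.contDiffOn.contDiffAt (h.isOpen_prod.mem_nhds (h.mem t))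
  have h2 := h1.isSymmSndFDerivAt (by
    simp only [minSmoothness_of_isRCLikeNormedField]
    exact_mod_cast (by omega : 2 ≤ k + 1))
  exact h2 v w

/-- The differential of the rescaled field along the arc. -/
theorem fderiv_field (h : IsArc Ω k K ha θ) (hk : 1 ≤ k) {X : Phase n → Phase n}
    (hX : ∀ t, X =ᶠ[𝓝 (θ t)] unitField K) (t : Set.Icc (0 : ℝ) a) :
    ∃ l : Phase n →L[ℝ] ℝ, ∀ v, fderiv ℝ X (θ t) v =
      hamGrad n (fderiv ℝ (fderiv ℝ K) (θ t) v) + l v • hamGrad n (fderiv ℝ K (θ t)) := by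
  have hk' : (k : WithTop ℕ∞) ≠ 0 := by exact_mod_cast (by omega : k ≠ 0)
  have h1 : HasFDerivAt (hamField K) ((hamGrad n).comp (fderiv ℝ (fderiv ℝ K) (θ t))) (θ t) :=
    (hamGrad n).hasFDerivAt.comp _ ((h.contDiffAt_fderiv t).differentiableAt hk').hasFDerivAt
  have h2 := ((h.contDiffAt_inv (h.mem t) (by simp [h.hamField_clock t])).differentiableAt
    hk').hasFDerivAt
  refine ⟨fderiv ℝ (fun z => ((hamField K z).1 0)⁻¹) (θ t), fun v => ?_⟩
  have h3 : HasFDerivAt (unitField K) _ (θ t) := h2.smul h1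
  rw [(hX t).fderiv_eq, h3.fderiv, h.hamField_clock t]
  simp [hamField_eq]

/-- The Hessian part is infinitesimally symplectic because second derivatives are symmetric. The
rescaling adds a multiple of the Hamiltonian vector, whose pairing with `w` is `dK(w)`; the
invariance therefore holds only on the tangent space of the energy level. -/
theorem phaseForm_fderiv (h : IsArc Ω k K ha θ) (hk : 1 ≤ k) {X : Phase n → Phase n}
    (hX : ∀ t, X =ᶠ[𝓝 (θ t)] unitField K) (t : Set.Icc (0 : ℝ) a) {v w : Phase n}
    (hv : fderiv ℝ K (θ t) v = 0) (hw : fderiv ℝ K (θ t) w = 0) :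
    phaseForm n (fderiv ℝ X (θ t) v) w + phaseForm n v (fderiv ℝ X (θ t) w) = 0 := by
  obtain ⟨l, hl⟩ := h.fderiv_field hk hX t
  rw [phaseForm_antisymm v, hl, hl]
  simp only [map_add, map_smul, add_apply, smul_apply,
    phaseForm_hamGrad, hv, hw, h.second_symm hk t v w]
  simp

/-- The differentiated form of `dK(X) = 0`, the conservation of energy. The contribution of the
rescaling drops out because `dK` vanishes on the Hamiltonian vector. -/
theorem fderiv_energy (h : IsArc Ω k K ha θ) (hk : 1 ≤ k) {X : Phase n → Phase n}
    (hX : ∀ t, X =ᶠ[𝓝 (θ t)] unitField K) (t : Set.Icc (0 : ℝ) a) (v : Phase n) :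
    fderiv ℝ (fderiv ℝ K) (θ t) (hamField K (θ t)) v + fderiv ℝ K (θ t) (fderiv ℝ X (θ t) v) =
      0 := by
  obtain ⟨l, hl⟩ := h.fderiv_field hk hX t
  have h1 : ∀ w, fderiv ℝ K (θ t) w = phaseForm n (hamField K (θ t)) w := fun w => by
    rw [hamField_eq, phaseForm_hamGrad]
  rw [h1, phaseForm_antisymm, hl, h.second_symm hk]
  simp only [map_add, map_smul, add_apply, smul_apply, phaseForm_hamGrad]
  rw [← phaseForm_hamGrad (fderiv ℝ K (θ t)) (hamField K (θ t)), hamField_eq]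
  have := phaseForm_antisymm (hamGrad n (fderiv ℝ K (θ t))) (hamGrad n (fderiv ℝ K (θ t)))
  have h0 : phaseForm n (hamGrad n (fderiv ℝ K (θ t))) (hamGrad n (fderiv ℝ K (θ t))) = 0 := by
    linarith
  rw [h0]; simp

theorem clock_fderiv (h : IsArc Ω k K ha θ) {X : Phase n → Phase n}
    (hX1 : ContDiff ℝ 1 X)
    (hX : ∀ t, X =ᶠ[𝓝 (θ t)] unitField K) (t : Set.Icc (0 : ℝ) a) (v : Phase n) :
    clock n (fderiv ℝ X (θ t) v) = 0 := by
  have h1 : HasFDerivAt (fun z => clock n (X z)) ((clock n).comp (fderiv ℝ X (θ t))) (θ t) :=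
    (clock n).hasFDerivAt.comp _ (hX1.differentiable (by simp) _).hasFDerivAt
  have h2 : (fun z => clock n (X z)) =ᶠ[𝓝 (θ t)] fun _ => 1 := by
    filter_upwards [h.isClockField hX t] with z hz
    rw [hz.2.2.2, unitField, map_smul, clock_apply]
    simp [hz.2.1.ne']
  have h3 := (hasFDerivAt_const (𝕜 := ℝ) (1 : ℝ) (θ t)).congr_of_eventuallyEq h2
  have h4 : (clock n).comp (fderiv ℝ X (θ t)) = 0 := h1.unique h3
  exact congrArg (fun L : Phase n →L[ℝ] ℝ => L v) h4

theorem energy_hasDerivWithinAt (h : IsArc Ω k K ha θ) (hk : 1 ≤ k) (t : Set.Icc (0 : ℝ) a) :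
    HasDerivWithinAt (fun r => fderiv ℝ K (Set.IccExtend ha.le θ r))
      (fderiv ℝ (fderiv ℝ K) (θ t) (hamField K (θ t))) (Set.Icc 0 a) t := by
  have hk' : (k : WithTop ℕ∞) ≠ 0 := by exact_mod_cast (by omega : k ≠ 0)
  have h1 := ((h.contDiffAt_fderiv t).differentiableAt hk').hasFDerivAt
  have h2 := h.isSolution t
  rw [← Set.IccExtend_val ha.le (θ : Set.Icc (0 : ℝ) a → Phase n) t] at h1
  have := h1.comp_hasDerivWithinAt (t : ℝ) h2
  rwa [Set.IccExtend_val] at this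

end IsArc
end ManeJets

namespace ManeJets

open Asymptotics

/-! ### Leading terms of composition operators along a path -/

section TaylorAlong

universe u

variable {I : Type*} [TopologicalSpace I] [CompactSpace I]
  {E F : Type u} [NormedAddCommGroup E] [NormedSpace ℝ E] [NormedAddCommGroup F] [NormedSpace ℝ F]

/-- The leading term of a composition operator along a path where the composed function vanishes
to order `k`. -/
theorem exists_leading_term {k : ℕ} (Y : C(E, F)) (hY : ContDiff ℝ k Y) (θ : C(I, E))
    (h0 : ∀ t, ∀ i < k, iteratedFDeriv ℝ i Y (θ t) = 0) :
    ∃ T : ContinuousMultilinearMap ℝ (fun _ : Fin k => C(I, E)) C(I, F),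
      ((fun v : C(I, E) => Y.comp (θ + v) - T (fun _ => v)) =o[𝓝 0] fun v => ‖v‖ ^ k) ∧
      ∀ v t, T v t = (k.factorial : ℝ)⁻¹ • iteratedFDeriv ℝ k Y (θ t) (fun i => v i t) := by
  set N : C(I, E) → C(I, F) := fun v => Y.comp (θ + v) with hN
  have hNc : ContDiff ℝ k N := by
    have h1 := contDiff_comp (X := I) (n := k) Y (by exact_mod_cast hY)
    exact (by exact_mod_cast h1 : ContDiff ℝ k fun η : C(I, E) => Y.comp η).comp
      (contDiff_const.add contDiff_id)
  -- Evaluation at `t` is linear and intertwines the composition operator with `Y` itself, so the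
  -- derivatives on path space are computed pointwise in `t`.
  have key : ∀ i ≤ k, ∀ v t, iteratedFDeriv ℝ i N 0 v t =
      iteratedFDeriv ℝ i Y (θ t) (fun j => v j t) := by
    intro i hi v t
    have h1 := (ContinuousMap.evalCLM ℝ t : C(I, F) →L[ℝ] F).iteratedFDeriv_comp_left
      (hNc.contDiffAt (x := 0)) (i := i) (by exact_mod_cast hi)
    have hYt : ContDiff ℝ k fun z => Y (θ t + z) := hY.comp (contDiff_const.add contDiff_id)
    have h2 := (ContinuousMap.evalCLM ℝ t : C(I, E) →L[ℝ] E).iteratedFDeriv_comp_right hYt 0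
      (i := i) (by exact_mod_cast hi)
    have h3 : (ContinuousMap.evalCLM ℝ t : C(I, F) →L[ℝ] F) ∘ N =
      (fun z => Y (θ t + z)) ∘ (ContinuousMap.evalCLM ℝ t : C(I, E) →L[ℝ] E) := rfl
    rw [h3, h2, iteratedFDeriv_comp_add_left, map_zero, add_zero] at h1
    exact (congrArg (fun L => L v) h1).symm
  refine ⟨(k.factorial : ℝ)⁻¹ • iteratedFDeriv ℝ k N 0, ?_, fun v t => ?_⟩
  · refine taylor_peano hNc.contDiffAt fun i hi => ?_
    ext v t
    rw [key i hi.le, h0 t i hi]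
    simp
  · rw [smul_apply, ContinuousMap.smul_apply, key k le_rfl]

end TaylorAlong

/-! ### The Hamiltonian field of a potential and its Taylor expansion on the axis -/

section PotentialField

variable {n : ℕ}

/-- The differential of `V(x₀, x)` in phase space, turned into a vector. -/
noncomputable def potGrad (n : ℕ) : (Coord n →L[ℝ] ℝ) →L[ℝ] Phase n :=
  (hamGrad n).comp (ContinuousLinearMap.precomp ℝ (ContinuousLinearMap.fst ℝ (Coord n) (Coord n)))

theorem phaseForm_potGrad (L : Coord n →L[ℝ] ℝ) (w : Phase n) :
    phaseForm n (potGrad n L) w = L w.1 :=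
  phaseForm_hamGrad _ w

theorem phaseForm_inr_single (z : Phase n) :
    phaseForm n z (0, EuclideanSpace.single 0 1) = z.1 0 := by
  rw [phaseForm_apply, Finset.sum_eq_single 0]
  · simp
  · intro i _ hi
    simp [hi]
  · simp

/-- A potential depends on the base point only, so its Hamiltonian vector is vertical and does not
change the rate of `x₀`. -/
theorem clock_potGrad (L : Coord n →L[ℝ] ℝ) : clock n (potGrad n L) = 0 := by
  rw [clock_apply, ← phaseForm_inr_single, phaseForm_potGrad, map_zero]

variable {k : ℕ} {V : Coord n → ℝ} {g : Phase n → ℝ} {z₀ : Phase n}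

/-- Since `dV` is `O(‖x‖^k)` at the base point and `g = 1 + o(1)`, the rescaling factor enters only
beyond order `k`, and the leading term is that of `dV` alone. -/
theorem iteratedFDeriv_potGrad_aux (hV : ContDiff ℝ ∞ V) (hg : ContDiff ℝ k g) (hg1 : g z₀ = 1)
    (hV0 : ∀ i ≤ k, iteratedFDeriv ℝ i V z₀.1 = 0) :
    (∀ i < k, iteratedFDeriv ℝ i (fun z => g z • potGrad n (fderiv ℝ V z.1)) z₀ = 0) ∧
      iteratedFDeriv ℝ k (fun z => g z • potGrad n (fderiv ℝ V z.1)) z₀ =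
        (potGrad n).compContinuousMultilinearMap
          ((iteratedFDeriv ℝ k (fderiv ℝ V) z₀.1).compContinuousLinearMap
            fun _ => ContinuousLinearMap.fst ℝ (Coord n) (Coord n)) := by
  have hdV : ContDiff ℝ k (fderiv ℝ V) :=
    (hV.fderiv_right (m := ∞) (by simp)).of_le (by exact_mod_cast le_top)
  have hY : ContDiff ℝ k fun z : Phase n => g z • potGrad n (fderiv ℝ V z.1) :=
    hg.smul ((potGrad n).contDiff.comp (hdV.comp contDiff_fst))
  set S := (potGrad n).compContinuousMultilinearMap
    ((iteratedFDeriv ℝ k (fderiv ℝ V) z₀.1).compContinuousLinearMap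
      fun _ => ContinuousLinearMap.fst ℝ (Coord n) (Coord n)) with hS
  have hSsymm : IsSymmForm S := fun σ v => by
    have := isSymmForm_iteratedFDeriv (hdV.contDiffAt (x := z₀.1)) σ (fun i => (v i).1)
    exact congrArg (potGrad n) this
  have h1 : (fun x => fderiv ℝ V (z₀.1 + x) - (k.factorial : ℝ)⁻¹ •
      iteratedFDeriv ℝ k (fderiv ℝ V) z₀.1 (fun _ => x)) =o[𝓝 0] fun x => ‖x‖ ^ k := by
    have := taylor_peano (k := k) (f := fun x => fderiv ℝ V (z₀.1 + x))
      (hdV.comp (contDiff_const.add contDiff_id)).contDiffAt (fun i hi => by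
        rw [iteratedFDeriv_comp_add_left, add_zero, ← norm_eq_zero, norm_iteratedFDeriv_fderiv,
          hV0 (i + 1) hi, norm_zero])
    simpa [iteratedFDeriv_comp_add_left] using this
  have h2 : (fun x : Phase n => potGrad n (fderiv ℝ V (z₀.1 + x.1)) - (k.factorial : ℝ)⁻¹ •
      S (fun _ => x)) =o[𝓝 0] fun x => ‖x‖ ^ k := by
    have hfst : Filter.Tendsto (fun x : Phase n => x.1) (𝓝 0) (𝓝 0) :=
      continuous_fst.tendsto' _ _ rfl
    have h3 := h1.comp_tendsto hfst
    have h4 : (fun x : Phase n => ‖x.1‖ ^ k) =O[𝓝 0] fun x => ‖x‖ ^ k :=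
      IsBigO.of_bound 1 (Filter.Eventually.of_forall fun x => by
        simp only [norm_pow, norm_norm, one_mul]
        gcongr
        exact norm_fst_le x)
    have h5 := ((potGrad n).isBigO_comp _ _).trans_isLittleO (h3.trans_isBigO h4)
    refine h5.congr_left fun x => ?_
    simp [hS]
  have h6 : (fun x : Phase n => g (z₀ + x) • potGrad n (fderiv ℝ V (z₀ + x).1) - 0 -
      (k.factorial : ℝ)⁻¹ • S (fun _ => x)) =o[𝓝 0] fun x => ‖x‖ ^ k := by
    have hgt : Filter.Tendsto (fun x => g (z₀ + x)) (𝓝 0) (𝓝 1) := by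
      refine (hg.continuous.tendsto' z₀ 1 hg1).comp ?_
      exact (continuous_const.add continuous_id).tendsto' _ _ (add_zero z₀)
    have h7 : (fun x => g (z₀ + x)) =O[𝓝 0] fun _ => (1 : ℝ) := hgt.isBigO_one ℝ
    have h8 : (fun x => g (z₀ + x) - 1) =o[𝓝 0] fun _ => (1 : ℝ) := by
      rw [isLittleO_one_iff]
      simpa using hgt.sub_const 1
    have h9 := h7.smul_isLittleO h2
    have h10 := h8.smul_isBigO ((isBigO_diag S).const_smul_left ((k.factorial : ℝ)⁻¹))
    simp only [one_smul] at h9 h10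
    refine (h9.add h10).congr_left fun x => ?_
    simp only [Prod.fst_add, smul_sub, sub_smul, one_smul, sub_zero, Pi.smul_apply]
    abel
  have := iteratedFDeriv_of_expansion (k := k)
    (f := fun x => g (z₀ + x) • potGrad n (fderiv ℝ V (z₀ + x).1)) (g := fun _ => 0)
    (hY.comp (contDiff_const.add contDiff_id)).contDiffAt contDiff_const.contDiffAt hSsymm h6
  have htr : ∀ i, iteratedFDeriv ℝ i
      (fun x => g (z₀ + x) • potGrad n (fderiv ℝ V (z₀ + x).1)) 0 =
      iteratedFDeriv ℝ i (fun z => g z • potGrad n (fderiv ℝ V z.1)) z₀ := fun i => by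
    rw [iteratedFDeriv_comp_add_left (f := fun z : Phase n => g z • potGrad n (fderiv ℝ V z.1)),
      add_zero]
  exact ⟨fun i hi => by rw [← htr, this.1 i hi]; simp, by rw [← htr, this.2]; simp⟩

theorem iteratedFDeriv_potGrad_of_lt (hV : ContDiff ℝ ∞ V) (hg : ContDiff ℝ k g)
    (hg1 : g z₀ = 1) (hV0 : ∀ i ≤ k, iteratedFDeriv ℝ i V z₀.1 = 0) {i : ℕ} (hi : i < k) :
    iteratedFDeriv ℝ i (fun z => g z • potGrad n (fderiv ℝ V z.1)) z₀ = 0 :=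
  (iteratedFDeriv_potGrad_aux hV hg hg1 hV0).1 i hi

theorem phaseForm_iteratedFDeriv_potGrad (hV : ContDiff ℝ ∞ V) (hg : ContDiff ℝ k g)
    (hg1 : g z₀ = 1) (hV0 : ∀ i ≤ k, iteratedFDeriv ℝ i V z₀.1 = 0) (v : Fin k → Phase n)
    (w : Phase n) :
    phaseForm n (iteratedFDeriv ℝ k (fun z => g z • potGrad n (fderiv ℝ V z.1)) z₀ v) w =
      iteratedFDeriv ℝ (k + 1) V z₀.1 (Fin.snoc (fun i => (v i).1) w.1) := by
  rw [(iteratedFDeriv_potGrad_aux hV hg hg1 hV0).2, iteratedFDeriv_succ_apply_right]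
  simp only [Fin.init_snoc, Fin.snoc_last]
  exact phaseForm_potGrad _ w

/-- If all the derivatives of order `k` vanish along an axis, those of order `k + 1` vanish in the
direction of the axis. -/
theorem iteratedFDeriv_snoc_axis {a : ℝ} (ha : 0 < a) (hV : ContDiff ℝ ∞ V)
    (hV0 : ∀ t ∈ Set.Icc 0 a, iteratedFDeriv ℝ k V (EuclideanSpace.single 0 t) = 0) {t : ℝ}
    (ht : t ∈ Set.Icc 0 a) (v : Fin k → Coord n) :
    iteratedFDeriv ℝ (k + 1) V (EuclideanSpace.single 0 t)
      (Fin.snoc v (EuclideanSpace.single 0 1)) = 0 := by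
  have hd : DifferentiableAt ℝ (iteratedFDeriv ℝ k V) (EuclideanSpace.single 0 t) :=
    (hV.differentiable_iteratedFDeriv (by exact_mod_cast ENat.natCast_lt_top k)) _
  have hline : HasDerivAt (fun s : ℝ => (EuclideanSpace.single 0 s : Coord n))
      (EuclideanSpace.single 0 1) t := by
    have h := (hasDerivAt_id t).smul_const (EuclideanSpace.single 0 1 : Coord n)
    refine (h.congr_deriv (by simp)).congr_of_eventuallyEq (Filter.Eventually.of_forall fun s => ?_)
    ext i
    simp
  have h1 := (hd.hasFDerivAt.comp_hasDerivAt t hline).hasDerivWithinAt (s := Set.Icc 0 a)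
  have h2 : HasDerivWithinAt (fun _ : ℝ => (0 : Coord n [×k]→L[ℝ] ℝ)) 0 (Set.Icc 0 a) t :=
    hasDerivWithinAt_const _ _ _
  have h3 := ((uniqueDiffOn_Icc ha) t ht).eq_deriv _ h1 (h2.congr_of_mem (fun s hs => hV0 s hs) ht)
  have h4 := isSymmForm_iteratedFDeriv (n := k + 1) (f := V) (x := EuclideanSpace.single 0 t)
    (hV.of_le (by exact_mod_cast le_top)).contDiffAt
  -- Symmetry moves the axis direction from the last slot to the first, where the derivative of
  -- order `k + 1` is a derivative along the axis of the vanishing derivative of order `k`.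
  have h5 := h4 (finRotate (k + 1)) (Fin.cons (EuclideanSpace.single 0 1) v)
  have h6 : (Fin.snoc v (EuclideanSpace.single 0 1) : Fin (k + 1) → Coord n) =
      (Fin.cons (EuclideanSpace.single 0 1) v : Fin (k + 1) → Coord n) ∘ finRotate (k + 1) := by
    ext1 i
    exact congrFun (Fin.snoc_eq_cons_rotate v (EuclideanSpace.single 0 (1 : ℝ) : Coord n)) i
  rw [h6, h5, iteratedFDeriv_succ_apply_left]
  simp only [Fin.cons_zero, Fin.tail_cons]
  rw [h3]
  rfl

end PotentialField

end ManeJets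

namespace ManeJets

open Asymptotics

/-! ### Forward and backward flows near a solution -/

section Flows

universe u
variable {E : Type u} [NormedAddCommGroup E] [NormedSpace ℝ E] {a : ℝ}

variable (E a) in
/-- The reversal of paths. -/
noncomputable def reversePath : C(Set.Icc (0 : ℝ) a, E) →L[ℝ] C(Set.Icc (0 : ℝ) a, E) where
  toFun η := η.comp (reverseTime a)
  map_add' _ _ := rfl
  map_smul' _ _ := rfl
  cont := continuous_comp_reverseTime

theorem reversePath_apply (η : C(Set.Icc (0 : ℝ) a, E)) :
    reversePath E a η = η.comp (reverseTime a) := rfl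

theorem exists_flow [CompleteSpace E] (ha : 0 ≤ a) {k : ℕ} (hk : 1 ≤ k) (X : C(E, E))
    (hX : ContDiff ℝ k X) (hX1 : ContDiff ℝ 1 X) {θ : C(Set.Icc (0 : ℝ) a, E)}
    (hθ : IsSolution ha X θ) :
    ∃ G : C(Set.Icc (0 : ℝ) a, E) → C(Set.Icc (0 : ℝ) a, E),
      ContDiffAt ℝ k G (constPath a (θ ⟨0, le_rfl, ha⟩)) ∧
      G (constPath a (θ ⟨0, le_rfl, ha⟩)) = θ ∧
      (∀ᶠ z in 𝓝 (θ ⟨0, le_rfl, ha⟩), odeDefect ha X (G (constPath a z)) = constPath a z) ∧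
      (∀ᶠ η in 𝓝 θ, G (odeDefect ha X η) = η) ∧
      ∀ b, fderiv ℝ G (constPath a (θ ⟨0, le_rfl, ha⟩)) b = b + primitive ha
        (pointwiseApply ((fderivMap X hX1).comp θ)
          (fderiv ℝ G (constPath a (θ ⟨0, le_rfl, ha⟩)) b)) := by
  obtain ⟨G, h1, h2, h3, h4, h5⟩ := exists_solution_operator ha hk X hX hX1 θ
  rw [hθ.odeDefect_eq] at h1 h2 h3 h5
  exact ⟨G, h1, h2, ((constPath a).continuous.tendsto _).eventually h3, h4, h5⟩

/-- The flow of `-X` read with reversed time. Evaluated at time `0`, the path with prescribed end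
point gives the inverse Poincaré map, with the same regularity. -/
theorem exists_backflow [CompleteSpace E] (ha : 0 ≤ a) {k : ℕ} (hk : 1 ≤ k) (X : C(E, E))
    (hX : ContDiff ℝ k X) {θ : C(Set.Icc (0 : ℝ) a, E)} (hθ : IsSolution ha X θ) :
    ∃ B : E → C(Set.Icc (0 : ℝ) a, E), ContDiffAt ℝ k B (θ ⟨a, ha, le_rfl⟩) ∧
      B (θ ⟨a, ha, le_rfl⟩) = θ ∧
      (∀ᶠ w in 𝓝 (θ ⟨a, ha, le_rfl⟩), IsSolution ha X (B w) ∧ B w ⟨a, ha, le_rfl⟩ = w) ∧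
      ∀ᶠ η in 𝓝 θ, IsSolution ha X η → B (η ⟨a, ha, le_rfl⟩) = η := by
  have hX1 : ContDiff ℝ 1 X := hX.of_le (by exact_mod_cast hk)
  obtain ⟨G, h1, h2, h3, h4, -⟩ := exists_flow ha hk (-X) hX.neg hX1.neg
    (θ := θ.comp (reverseTime a)) hθ.reverse
  have h0 : (θ.comp (reverseTime a)) ⟨0, le_rfl, ha⟩ = θ ⟨a, ha, le_rfl⟩ := by
    rw [ContinuousMap.comp_apply, reverseTime_zero ha]
  rw [h0] at h1 h2 h3
  refine ⟨fun w => reversePath E a (G (constPath a w)), ?_, ?_, ?_, ?_⟩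
  · exact (reversePath E a).contDiff.contDiffAt.comp _
      (h1.comp _ (constPath a : E →L[ℝ] C(Set.Icc (0 : ℝ) a, E)).contDiff.contDiffAt)
  · exact (congrArg (reversePath E a) h2).trans (comp_reverseTime_comp_reverseTime θ)
  · filter_upwards [h3] with w hw
    obtain ⟨h5, h6⟩ := isSolution_of_odeDefect_eq hw
    refine ⟨?_, ?_⟩
    · have := h5.reverse
      simp only [ContinuousMap.coe_neg, Pi.neg_apply, neg_neg] at this
      exact this
    · rw [reversePath_apply, ContinuousMap.comp_apply, reverseTime_last ha, h6]
  · have hc : Filter.Tendsto (fun η : C(Set.Icc (0 : ℝ) a, E) => η.comp (reverseTime a)) (𝓝 θ)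
      (𝓝 (θ.comp (reverseTime a))) := continuous_comp_reverseTime.tendsto _
    filter_upwards [hc.eventually h4] with η hη hs
    have h5 : odeDefect ha (-X) (η.comp (reverseTime a)) = constPath a (η ⟨a, ha, le_rfl⟩) := by
      rw [IsSolution.odeDefect_eq (X := -X) hs.reverse, ContinuousMap.comp_apply, reverseTime_zero ha]
    rw [← h5, hη, reversePath_apply, comp_reverseTime_comp_reverseTime]

end Flows

namespace IsArc

variable {n : ℕ} {Ω : Set (Coord n)} {k : ℕ} {K : Phase n → ℝ} {a : ℝ} {ha : 0 < a}
  {θ : C(Set.Icc (0 : ℝ) a, Phase n)}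

/-- As the potential adds a vertical vector, the rescaling factor of the perturbed field is the
unperturbed one, so the rescaled perturbation is linear in `V`. -/
theorem isClockField_add (h : IsArc Ω k K ha θ) {X : Phase n → Phase n}
    (hX : ∀ t, X =ᶠ[𝓝 (θ t)] unitField K) {g : Phase n → ℝ}
    (hg : ∀ t, g =ᶠ[𝓝 (θ t)] fun z => ((hamField K z).1 0)⁻¹) {V : Coord n → ℝ}
    (hV : ContDiff ℝ ∞ V) {Ku : Phase n → ℝ}
    (hKu : ∀ z ∈ Ω ×ˢ (Set.univ : Set (Coord n)), Ku z = K z + V z.1) :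
    IsClockField Ω Ku (fun z => X z + g z • potGrad n (fderiv ℝ V z.1)) θ := by
  have hV1 : Differentiable ℝ V := hV.differentiable (by simp)
  have key : ∀ z ∈ Ω ×ˢ (Set.univ : Set (Coord n)),
      hamField Ku z = hamField K z + potGrad n (fderiv ℝ V z.1) := by
    intro z hz
    have h1 : Ku =ᶠ[𝓝 z] fun z => K z + V z.1 := by
      filter_upwards [h.isOpen_prod.mem_nhds hz] with w hw using hKu w hw
    have h2 : HasFDerivAt K (fderiv ℝ K z) z :=
      ((h.contDiffOn.contDiffAt (h.isOpen_prod.mem_nhds hz)).differentiableAt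
        (by norm_cast)).hasFDerivAt
    have h3 : HasFDerivAt (fun z : Phase n => V z.1)
        ((fderiv ℝ V z.1).comp (ContinuousLinearMap.fst ℝ (Coord n) (Coord n))) z :=
      (hV1 z.1).hasFDerivAt.comp z hasFDerivAt_fst
    rw [hamField_eq, h1.fderiv_eq, (h2.fun_add h3).fderiv, map_add]
    rfl
  have hc : Continuous fun z : Phase n => potGrad n (fderiv ℝ V z.1) :=
    (potGrad n).continuous.comp ((hV.continuous_fderiv (by simp)).comp continuous_fst)
  intro t
  filter_upwards [h.isClockField hX t, hg t] with z hz hgz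
  have hclock : (hamField Ku z).1 0 = (hamField K z).1 0 := by
    have := clock_potGrad (fderiv ℝ V z.1)
    rw [clock_apply] at this
    rw [key z hz.1, Prod.fst_add, PiLp.add_apply, this, add_zero]
  refine ⟨hz.1, hclock ▸ hz.2.1, ?_, ?_⟩
  · refine (hz.2.2.1.add hc.continuousAt).congr ?_
    filter_upwards [h.isOpen_prod.mem_nhds hz.1] with w hw using (key w hw).symm
  · rw [hz.2.2.2, hgz, unitField, unitField, hclock, key z hz.1, smul_add]

end IsArc

end ManeJets

namespace ManeJets

open Asymptotics

/-! ### The variation of the Poincaré map along the arc -/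

namespace IsArc

variable {n : ℕ} {Ω : Set (Coord n)} {k : ℕ} {K : Phase n → ℝ} {a : ℝ} {ha : 0 < a}
  {θ : C(Set.Icc (0 : ℝ) a, Phase n)}

/-- The linearized flow along the arc preserves the clock. -/
theorem clock_variation (h : IsArc Ω k K ha θ) {X : C(Phase n, Phase n)}
    (hX1 : ContDiff ℝ 1 X) (hX : ∀ t, X =ᶠ[𝓝 (θ t)] unitField K)
    {η f : C(Set.Icc (0 : ℝ) a, Phase n)} {v : Phase n}
    (hη : η = constPath a v + primitive ha.le (pointwiseApply ((fderivMap X hX1).comp θ) η + f))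
    (hf : ∀ t, clock n (f t) = 0) (t : Set.Icc (0 : ℝ) a) : clock n (η t) = clock n v :=
  linear_variation ha.le (fun _ => clock n) (fun _ => 0) (fun _ => hasDerivWithinAt_const _ _ _)
    ((fderivMap X hX1).comp θ) hη
    (fun t x => by
      rw [zero_apply, zero_add]
      exact h.clock_fderiv hX1 hX t x) hf t

/-- The linearized flow along the arc preserves the differential of the energy. -/
theorem energy_variation (h : IsArc Ω k K ha θ) (hk : 1 ≤ k) {X : C(Phase n, Phase n)}
    (hX1 : ContDiff ℝ 1 X) (hX : ∀ t, X =ᶠ[𝓝 (θ t)] unitField K)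
    {η f : C(Set.Icc (0 : ℝ) a, Phase n)} {v : Phase n}
    (hη : η = constPath a v + primitive ha.le (pointwiseApply ((fderivMap X hX1).comp θ) η + f))
    (hf : ∀ t, fderiv ℝ K (θ t) (f t) = 0) (t : Set.Icc (0 : ℝ) a) :
    fderiv ℝ K (θ t) (η t) = fderiv ℝ K (θ ⟨0, le_rfl, ha.le⟩) v := by
  have := linear_variation ha.le (fun r => fderiv ℝ K (Set.IccExtend ha.le θ r))
    (fun t => fderiv ℝ (fderiv ℝ K) (θ t) (hamField K (θ t)))
    (h.energy_hasDerivWithinAt hk) ((fderivMap X hX1).comp θ) hη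
    (fun t x => by
      rw [Set.IccExtend_val]
      exact h.fderiv_energy hk hX t x) (fun t => by rw [Set.IccExtend_val]; exact hf t) t
  rwa [Set.IccExtend_val, Set.IccExtend_of_mem ha.le _ (x := 0) ⟨le_rfl, ha.le⟩] at this

/-- The linearized flow along the arc preserves the symplectic form on the tangent spaces of the
energy level. -/
theorem phaseForm_variation (h : IsArc Ω k K ha θ) (hk : 1 ≤ k) {X : C(Phase n, Phase n)}
    (hX1 : ContDiff ℝ 1 X) (hX : ∀ t, X =ᶠ[𝓝 (θ t)] unitField K)
    {η₁ η₂ f : C(Set.Icc (0 : ℝ) a, Phase n)} {v₁ v₂ : Phase n}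
    (h₁ : η₁ = constPath a v₁ + primitive ha.le (pointwiseApply ((fderivMap X hX1).comp θ) η₁ + f))
    (h₂ : η₂ = constPath a v₂ + primitive ha.le (pointwiseApply ((fderivMap X hX1).comp θ) η₂))
    (hf : ∀ t, fderiv ℝ K (θ t) (f t) = 0)
    (hv₁ : fderiv ℝ K (θ ⟨0, le_rfl, ha.le⟩) v₁ = 0)
    (hv₂ : fderiv ℝ K (θ ⟨0, le_rfl, ha.le⟩) v₂ = 0) (t : Set.Icc (0 : ℝ) a) :
    phaseForm n (η₁ t) (η₂ t) = phaseForm n v₁ v₂ +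
      ∫ r in (0 : ℝ)..t, phaseForm n (Set.IccExtend ha.le f r) (Set.IccExtend ha.le η₂ r) := by
  have e₂ : η₂ = constPath a v₂ +
      primitive ha.le (pointwiseApply ((fderivMap X hX1).comp θ) η₂ + 0) := by rwa [add_zero]
  refine bilinear_variation ha.le (phaseForm n) ((fderivMap X hX1).comp θ) h₁ h₂ (fun t => ?_) t
  exact h.phaseForm_fderiv hk hX t
    (by rw [h.energy_variation hk hX1 hX h₁ hf t, hv₁])
    (by rw [h.energy_variation hk hX1 hX e₂ (fun t => by simp) t, hv₂])

set_option maxHeartbeats 2000000 in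
/-- The relative Poincaré map of a potential whose `k`-jet vanishes along the arc: it is a
perturbation of the identity of order `k`, whose leading term is given by an integral along the
arc. -/
theorem exists_variation (h : IsArc Ω k K ha θ) (hk : 2 ≤ k) {p : Sect n → Phase n}
    (hp : ContDiffAt ℝ k p 0) (hp0 : p 0 = θ ⟨0, le_rfl, ha.le⟩) (hpc : ∀ ξ, (p ξ).1 0 = 0)
    (hpK : ∀ᶠ ξ in 𝓝 0, K (p ξ) = K (p 0)) :
    ∃ m : Sect n →L[ℝ] C(Set.Icc (0 : ℝ) a, Phase n),
      (∀ v, m v ⟨0, le_rfl, ha.le⟩ = fderiv ℝ p 0 v) ∧ (∀ v t, (m v t).1 0 = 0) ∧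
      (∀ t, ∃ P : Sect n → Phase n,
        HasFDerivAt P ((ContinuousMap.evalCLM ℝ t : _ →L[ℝ] Phase n).comp m) 0 ∧
        ∀ᶠ ξ in 𝓝 0, CoordCrosses Ω K 0 t (p ξ) (P ξ)) ∧
      ∀ (V : Coord n → ℝ) (Ku : Phase n → ℝ), ContDiff ℝ ∞ V →
        (∀ t ∈ Set.Icc 0 a, ∀ i ≤ k, iteratedFDeriv ℝ i V (EuclideanSpace.single 0 t) = 0) →
        (∀ z ∈ Ω ×ˢ (Set.univ : Set (Coord n)), Ku z = K z + V z.1) →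
        ∃ R q : Sect n → Phase n, ContDiffAt ℝ k R 0 ∧ R 0 = p 0 ∧
          (∀ᶠ ξ in 𝓝 0, ∃ w, CoordCrosses Ω Ku 0 a (p ξ) w ∧ CoordCrosses Ω K 0 a (R ξ) w) ∧
          (∀ ξ, (q ξ).1 0 = 0) ∧
          ((fun ξ => R ξ - p ξ - q ξ) =o[𝓝 0] fun ξ => ‖ξ‖ ^ k) ∧
          ∀ ξ v, phaseForm n (q ξ) (fderiv ℝ p 0 v) = (k.factorial : ℝ)⁻¹ *
            ∫ r in (0 : ℝ)..a, Set.IccExtend ha.le (fun t : Set.Icc (0 : ℝ) a =>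
              iteratedFDeriv ℝ (k + 1) V (EuclideanSpace.single 0 (t : ℝ))
                (Fin.snoc (fun _ => (m ξ t).1) (m v t).1)) r := by
  have hk1 : 1 ≤ k := by omega
  have hk0 : (k : WithTop ℕ∞) ≠ 0 := by exact_mod_cast (by omega : k ≠ 0)
  set t₀ : Set.Icc (0 : ℝ) a := ⟨0, le_rfl, ha.le⟩ with ht₀
  set t₁ : Set.Icc (0 : ℝ) a := ⟨a, ha.le, le_rfl⟩ with ht₁
  obtain ⟨X₀, hX₀c, hX₀⟩ := h.exists_unitField
  obtain ⟨g, hgc, hg⟩ := h.exists_clockRate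
  set X : C(Phase n, Phase n) := ⟨X₀, hX₀c.continuous⟩ with hXdef
  have hXc : ContDiff ℝ k X := hX₀c
  have hX : ∀ t, X =ᶠ[𝓝 (θ t)] unitField K := hX₀
  have hX1 : ContDiff ℝ 1 X := hXc.of_le (by exact_mod_cast hk1)
  have hXθ : IsSolution ha.le X θ := fun t => by
    rw [(hX t).self_of_nhds, h.unitField_eq]; exact h.isSolution t
  obtain ⟨G, hGc, hGθ, hGs, hGr, hGd⟩ := exists_flow ha.le hk1 X hXc hX1 hXθ
  set D := fderiv ℝ G (constPath a (θ t₀)) with hD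
  have hGD : HasStrictFDerivAt G D (constPath a (θ t₀)) := hGc.hasStrictFDerivAt hk0
  set p' := fderiv ℝ p 0 with hp'
  have hpd : HasFDerivAt p p' 0 := (hp.differentiableAt hk0).hasFDerivAt
  set m : Sect n →L[ℝ] C(Set.Icc (0 : ℝ) a, Phase n) := D.comp ((constPath a).comp p') with hm
  set A := (fderivMap X hX1).comp θ with hA
  have hmeq : ∀ v, m v = constPath a (p' v) + primitive ha.le (pointwiseApply A (m v)) :=
    fun v => hGd (constPath a (p' v))
  have hmeq0 : ∀ v, m v = constPath a (p' v) + primitive ha.le (pointwiseApply A (m v) + 0) :=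
    fun v => by rw [add_zero]; exact hmeq v
  have hp'c : ∀ v, clock n (p' v) = 0 := fun v => by
    have h1 : HasFDerivAt (fun ξ => clock n (p ξ)) ((clock n).comp p') 0 :=
      (clock n).hasFDerivAt.comp _ hpd
    have h2 : (fun ξ => clock n (p ξ)) = fun _ => 0 := funext hpc
    rw [h2] at h1
    have h3 : (clock n).comp p' = 0 := h1.unique (hasFDerivAt_const _ _)
    exact congrArg (fun L : Sect n →L[ℝ] ℝ => L v) h3
  have hp'K : ∀ v, fderiv ℝ K (θ t₀) (p' v) = 0 := fun v => by
    have h0 : HasFDerivAt K (fderiv ℝ K (θ t₀)) (p 0) := by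
      rw [hp0]
      exact ((h.contDiffOn.contDiffAt (h.isOpen_prod.mem_nhds (h.mem t₀))).differentiableAt
        (by norm_cast)).hasFDerivAt
    have h1 : HasFDerivAt (fun ξ => K (p ξ)) ((fderiv ℝ K (θ t₀)).comp p') 0 := h0.comp _ hpd
    have h2 := (hasFDerivAt_const (𝕜 := ℝ) (K (p 0)) (0 : Sect n)).congr_of_eventuallyEq hpK
    have h3 : (fderiv ℝ K (θ t₀)).comp p' = 0 := h1.unique h2
    exact congrArg (fun L : Sect n →L[ℝ] ℝ => L v) h3
  have hmc : ∀ v t, clock n (m v t) = 0 := fun v t => by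
    rw [h.clock_variation hX1 hX (hmeq0 v) (fun t => by simp) t, hp'c]
  have hpcont : Filter.Tendsto p (𝓝 0) (𝓝 (θ t₀)) := by
    rw [← hp0]; exact hp.continuousAt
  have hGcont : Filter.Tendsto (fun z => G (constPath a z)) (𝓝 (θ t₀)) (𝓝 θ) := by
    have h1 := hGc.continuousAt.tendsto.comp ((constPath a).continuous.tendsto (θ t₀))
    rwa [hGθ] at h1
  have hGp : HasFDerivAt (fun ξ => G (constPath a (p ξ))) m 0 := by
    have h1 : HasFDerivAt G D (constPath a (p 0)) := by rw [hp0]; exact hGD.hasFDerivAt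
    exact h1.comp (0 : Sect n) ((constPath a : Phase n →L[ℝ]
      C(Set.Icc (0 : ℝ) a, Phase n)).hasFDerivAt.comp (0 : Sect n) hpd)
  refine ⟨m, fun v => apply_zero_of_eq_primitive ha.le (hmeq v), hmc, fun t => ?_, ?_⟩
  · refine ⟨fun ξ => G (constPath a (p ξ)) t,
      (ContinuousMap.evalCLM ℝ t :
        C(Set.Icc (0 : ℝ) a, Phase n) →L[ℝ] Phase n).hasFDerivAt.comp (0 : Sect n) hGp, ?_⟩
    filter_upwards [(hGcont.comp hpcont).eventually
      ((h.isClockField hX).eventually_coordCrosses ha.le), hpcont.eventually hGs] with ξ h1 h2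
    obtain ⟨h3, h4⟩ := isSolution_of_odeDefect_eq h2
    have h5 := h1 h3 (by
      show (G (constPath a (p ξ)) t₀).1 0 = 0
      rw [h4]; exact hpc ξ) t
    rwa [Function.comp_apply, h4] at h5
  · intro V Ku hV hV0 hKu
    have hV0' : ∀ t : Set.Icc (0 : ℝ) a, ∀ i ≤ k, iteratedFDeriv ℝ i V (θ t).1 = 0 :=
      fun t i hi => by rw [h.base]; exact hV0 t t.2 i hi
    have hg1 : ∀ t, g (θ t) = 1 := fun t => by
      rw [(hg t).self_of_nhds]
      simp only [h.hamField_clock, inv_one]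
    have hdV : ContDiff ℝ k (fderiv ℝ V) :=
      (hV.fderiv_right (m := ∞) (by simp)).of_le (by exact_mod_cast le_top)
    have hYc : ContDiff ℝ k fun z : Phase n => g z • potGrad n (fderiv ℝ V z.1) :=
      hgc.smul ((potGrad n).contDiff.comp (hdV.comp contDiff_fst))
    set Y : C(Phase n, Phase n) := ⟨fun z => g z • potGrad n (fderiv ℝ V z.1), hYc.continuous⟩
      with hY
    have hY0 : ∀ t, Y (θ t) = 0 := fun t => by
      have h1 : fderiv ℝ V (θ t).1 = 0 := by
        rw [← norm_eq_zero, ← norm_iteratedFDeriv_one (𝕜 := ℝ), hV0' t 1 hk1, norm_zero]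
      show g (θ t) • potGrad n (fderiv ℝ V (θ t).1) = 0
      rw [h1, map_zero, smul_zero]
    obtain ⟨T, hTo, hTv⟩ := exists_leading_term (k := k) Y hYc θ
      (fun t i hi => iteratedFDeriv_potGrad_of_lt hV hgc (hg1 t) (hV0' t) hi)
    have hTform : ∀ (v : Fin k → C(Set.Icc (0 : ℝ) a, Phase n)) (t : Set.Icc (0 : ℝ) a) (w : Phase n),
        phaseForm n (T v t) w = (k.factorial : ℝ)⁻¹ * iteratedFDeriv ℝ (k + 1) V
          (EuclideanSpace.single 0 (t : ℝ)) (Fin.snoc (fun i => (v i t).1) w.1) := by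
      intro v t w
      rw [hTv, map_smul, smul_apply, smul_eq_mul, ← h.base t,
        ← phaseForm_iteratedFDeriv_potGrad hV hgc (hg1 t) (hV0' t)]
      rfl
    have hTc : ∀ v t, clock n (T v t) = 0 := fun v t => by
      rw [clock_apply, ← phaseForm_inr_single, hTform]
      have h1 := (iteratedFDeriv ℝ (k + 1) V (EuclideanSpace.single 0 (t : ℝ))).map_coord_zero
        (m := Fin.snoc (fun i => (v i t).1) (0 : Coord n)) (Fin.last k) (by simp)
      rw [h1, mul_zero]
    -- Up to a constant, `dK` of the leading term is the derivative of order `k + 1` of `V` with one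
    -- argument along the axis, and this is zero.
    have hTK : ∀ v t, fderiv ℝ K (θ t) (T v t) = 0 := fun v t => by
      rw [← phaseForm_hamGrad, ← hamField_eq, phaseForm_antisymm, hTform, h.hamField_fst,
        iteratedFDeriv_snoc_axis ha hV (fun s hs => hV0 s hs k le_rfl) t.2]
      simp
    have hXuc : ContDiff ℝ k (X + Y) := hXc.add hYc
    have hXuclock : IsClockField Ω Ku (X + Y) θ := h.isClockField_add hX hg hV hKu
    have hXuθ : IsSolution ha.le (X + Y) θ := fun t => by
      have : (X + Y) (θ t) = X (θ t) := by rw [ContinuousMap.add_apply, hY0, add_zero]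
      rw [this]
      exact hXθ t
    obtain ⟨Gu, hGuc, hGuθ, hGus, -, -⟩ := exists_flow ha.le hk1 (X + Y) hXuc
      (hXuc.of_le (by exact_mod_cast hk1)) hXuθ
    obtain ⟨Bk, hBc, hBθ, hBs, hBr⟩ := exists_backflow ha.le hk1 X hXc hXθ
    set ηu : Sect n → C(Set.Icc (0 : ℝ) a, Phase n) := fun ξ => Gu (constPath a (p ξ)) with hηu
    have hηuc : ContDiffAt ℝ k ηu 0 := by
      have h1 : ContDiffAt ℝ k Gu (constPath a (p 0)) := by rw [hp0]; exact hGuc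
      exact h1.comp (0 : Sect n) ((constPath a : Phase n →L[ℝ]
        C(Set.Icc (0 : ℝ) a, Phase n)).contDiff.contDiffAt.comp (0 : Sect n) hp)
    have hηu0 : ηu 0 = θ := by rw [hηu]; simp only [hp0]; exact hGuθ
    have hηut : Filter.Tendsto ηu (𝓝 0) (𝓝 θ) := by
      rw [← hηu0]; exact hηuc.continuousAt
    have hηus : ∀ᶠ ξ in 𝓝 0, odeDefect ha.le (X + Y) (ηu ξ) = constPath a (p ξ) :=
      hpcont.eventually hGus
    have hev : ∀ t : Set.Icc (0 : ℝ) a, ContDiff ℝ k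
        fun η : C(Set.Icc (0 : ℝ) a, Phase n) => η t := fun t =>
      (ContinuousMap.evalCLM ℝ t : C(Set.Icc (0 : ℝ) a, Phase n) →L[ℝ] Phase n).contDiff
    have hend : ContDiffAt ℝ k (fun ξ => ηu ξ t₁) 0 := (hev t₁).contDiffAt.comp (0 : Sect n) hηuc
    have hendt : Filter.Tendsto (fun ξ => ηu ξ t₁) (𝓝 0) (𝓝 (θ t₁)) := by
      have := hend.continuousAt.tendsto
      rwa [hηu0] at this
    have hBt : Filter.Tendsto Bk (𝓝 (θ t₁)) (𝓝 θ) := by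
      have := hBc.continuousAt.tendsto
      rwa [hBθ] at this
    -- the initial point of the backward solution
    set F : Phase n → Phase n := fun w => Bk w t₀ with hF
    have hFc : ContDiffAt ℝ k F (θ t₁) := (hev t₀).contDiffAt.comp _ hBc
    set L := fderiv ℝ F (θ t₁) with hL
    have hFd : HasStrictFDerivAt F L (θ t₁) := hFc.hasStrictFDerivAt hk0
    have hFG : ∀ᶠ z in 𝓝 (θ t₀), F (G (constPath a z) t₁) = z := by
      filter_upwards [hGcont.eventually hBr, hGs] with z h1 h2
      obtain ⟨h3, h4⟩ := isSolution_of_odeDefect_eq h2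
      rw [hF]
      show Bk (G (constPath a z) t₁) t₀ = z
      rw [h1 h3]
      exact h4
    set Φ : Phase n →L[ℝ] Phase n := (ContinuousMap.evalCLM ℝ t₁ :
      C(Set.Icc (0 : ℝ) a, Phase n) →L[ℝ] Phase n).comp (D.comp (constPath a)) with hΦ
    have hLΦ : L.comp Φ = ContinuousLinearMap.id ℝ (Phase n) := by
      have h1 : HasFDerivAt (fun z => G (constPath a z) t₁) Φ (θ t₀) :=
        (ContinuousMap.evalCLM ℝ t₁ :
          C(Set.Icc (0 : ℝ) a, Phase n) →L[ℝ] Phase n).hasFDerivAt.comp _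
          (hGD.hasFDerivAt.comp _ (constPath a : Phase n →L[ℝ]
            C(Set.Icc (0 : ℝ) a, Phase n)).hasFDerivAt)
      have h2 : HasFDerivAt F L (G (constPath a (θ t₀)) t₁) := by
        rw [hGθ]; exact hFd.hasFDerivAt
      have h3 := h2.comp (θ t₀) h1
      exact h3.unique ((hasFDerivAt_id (θ t₀)).congr_of_eventuallyEq hFG)
    -- Phase space is finite-dimensional, so the left inverse `L` of the linearized flow `Φ` is also
    -- a right inverse.
    have hΦL : ∀ w, Φ (L w) = w := by
      have h1 : (L : Phase n →ₗ[ℝ] Phase n) * (Φ : Phase n →ₗ[ℝ] Phase n) = 1 := by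
        exact LinearMap.ext fun z => congrArg (fun L : Phase n →L[ℝ] Phase n => L z) hLΦ
      have h2 := mul_eq_one_comm.1 h1
      exact fun w => congrArg (fun L : Phase n →ₗ[ℝ] Phase n => L w) h2
    -- The Duhamel term: the solution of the linearized equation with zero initial value, forced by
    -- `T` along `m ξ`. The vector `q ξ` below is its end value carried back to time `0`.
    set e : Sect n → C(Set.Icc (0 : ℝ) a, Phase n) := fun ξ =>
      D (primitive ha.le (T fun _ => m ξ)) with he
    have heeq : ∀ ξ, e ξ = constPath a 0 +
        primitive ha.le (pointwiseApply A (e ξ) + T fun _ => m ξ) := fun ξ => by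
      refine (hGd (primitive ha.le (T fun _ => m ξ))).trans ?_
      rw [map_zero, zero_add, map_add]
      exact add_comm _ _
    set q : Sect n → Phase n := fun ξ => L (e ξ t₁) with hq
    have hξeq : ∀ ξ, D (constPath a (q ξ)) = constPath a (q ξ) +
        primitive ha.le (pointwiseApply A (D (constPath a (q ξ))) + 0) := fun ξ => by
      rw [add_zero]; exact hGd _
    have hξe : ∀ ξ, D (constPath a (q ξ)) t₁ = e ξ t₁ := fun ξ => hΦL (e ξ t₁)
    have hqc : ∀ ξ, clock n (q ξ) = 0 := fun ξ => by
      rw [← h.clock_variation hX1 hX (hξeq ξ) (fun t => by simp) t₁, hξe,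
        h.clock_variation hX1 hX (heeq ξ) (hTc _) t₁, map_zero]
    have hqK : ∀ ξ, fderiv ℝ K (θ t₀) (q ξ) = 0 := fun ξ => by
      rw [← h.energy_variation hk1 hX1 hX (hξeq ξ) (fun t => by simp) t₁, hξe,
        h.energy_variation hk1 hX1 hX (heeq ξ) (hTK _) t₁, map_zero]
    refine ⟨fun ξ => F (ηu ξ t₁), q, ?_, ?_, ?_, hqc, ?_, fun ξ v => ?_⟩
    · have h1 : ContDiffAt ℝ k F (ηu 0 t₁) := by rw [hηu0]; exact hFc
      exact h1.comp (0 : Sect n) hend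
    · show Bk (ηu 0 t₁) t₀ = p 0
      rw [hηu0, hBθ, hp0]
    · filter_upwards [hηut.eventually (hXuclock.eventually_coordCrosses ha.le), hηus,
        hηut.eventually (hXuclock.eventually_clock ha.le), hendt.eventually hBs,
        (hBt.comp hendt).eventually ((h.isClockField hX).eventually_coordCrosses ha.le),
        (hBt.comp hendt).eventually ((h.isClockField hX).eventually_clock ha.le)]
        with ξ h1 h2 h3 h4 h5 h6
      obtain ⟨h7, h8⟩ := isSolution_of_odeDefect_eq h2
      have h9 : (ηu ξ t₀).1 0 = 0 := by rw [h8]; exact hpc ξ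
      have h10 : (ηu ξ t₁).1 0 = a := by
        have := h3 h7 t₁
        rw [h9, zero_add] at this
        exact this
      have h11 : (Bk (ηu ξ t₁) t₀).1 0 = 0 := by
        have h12 := h6 h4.1 t₁
        have h13 : (Bk (ηu ξ t₁) t₁).1 0 = a := by rw [h4.2, h10]
        have h14 : (Bk (ηu ξ t₁) t₁).1 0 = (Bk (ηu ξ t₁) t₀).1 0 + a := h12
        linarith
      refine ⟨ηu ξ t₁, ?_, ?_⟩
      · have := h1 h7 h9 t₁
        rwa [h8] at this
      · have h15 : CoordCrosses Ω K 0 a (Bk (ηu ξ t₁) t₀) (Bk (ηu ξ t₁) t₁) := h5 h4.1 h11 t₁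
        rwa [h4.2] at h15
    · have hexp := perturbed_solution_expansion ha.le hk (X := X) (Xu := X + Y) hGD hGθ hGr hpd hp0
        (hηuc.differentiableAt hk0).hasFDerivAt hηu0 hηus T (hTo.congr_left fun v => by
          congr 1
          ext1 t
          simp)
      set η : Sect n → C(Set.Icc (0 : ℝ) a, Phase n) := fun ξ => G (constPath a (p ξ)) with hη
      have hexp' : (fun ξ => ηu ξ t₁ - η ξ t₁ - e ξ t₁) =o[𝓝 0] fun ξ : Sect n => ‖ξ‖ ^ k :=
        ((ContinuousMap.evalCLM ℝ t₁ : C(Set.Icc (0 : ℝ) a, Phase n) →L[ℝ] Phase n).isBigO_comp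
          _ _).trans_isLittleO hexp
      have heO : (fun ξ => e ξ t₁) =O[𝓝 0] fun ξ : Sect n => ‖ξ‖ ^ k := by
        have h1 := (isBigO_diag (T.compContinuousLinearMap fun _ => m))
        exact (((ContinuousMap.evalCLM ℝ t₁ : C(Set.Icc (0 : ℝ) a, Phase n) →L[ℝ] Phase n).comp
          (D.comp (primitive ha.le))).isBigO_comp _ _).trans h1
      have hO : (fun ξ => ηu ξ t₁ - η ξ t₁) =O[𝓝 0] fun ξ : Sect n => ‖ξ‖ ^ k :=
        (hexp'.isBigO.add heO).congr_left fun ξ => by abel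
      have hηt : Filter.Tendsto (fun ξ => η ξ t₁) (𝓝 0) (𝓝 (θ t₁)) :=
        ((hev t₁).continuous.tendsto θ).comp (hGcont.comp hpcont)
      -- Strict differentiability again: the backward map is compared at the perturbed and
      -- unperturbed end points, which both move with `ξ` and differ by `O(‖ξ‖^k)`.
      have h2 := (hFd.isLittleO.comp_tendsto (hendt.prodMk_nhds hηt)).trans_isBigO hO
      have h3 := (L.isBigO_comp _ _).trans_isLittleO hexp'
      refine (h2.add h3).congr' ?_ Filter.EventuallyEq.rfl
      filter_upwards [hpcont.eventually hFG] with ξ h4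
      simp only [Function.comp_apply, map_sub]
      rw [show F (η ξ t₁) = p ξ from h4]
      abel
    · have h1 := h.phaseForm_variation hk1 hX1 hX (hξeq ξ) (hmeq v) (fun t => by simp) (hqK ξ)
        (hp'K v) t₁
      have h2 := h.phaseForm_variation hk1 hX1 hX (heeq ξ) (hmeq v) (hTK _) (map_zero _)
        (hp'K v) t₁
      simp only [Set.IccExtend_apply, ContinuousMap.zero_apply, map_zero, zero_apply,
        intervalIntegral.integral_zero, add_zero] at h1
      rw [← h1, hξe, h2, map_zero, zero_apply, zero_add, ← intervalIntegral.integral_const_mul]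
      refine intervalIntegral.integral_congr fun r _ => ?_
      simp only [Set.IccExtend_apply, hTform]

end IsArc

end ManeJets

namespace ManeJets

open Asymptotics

/-! ### Integrals of pulled back forms -/

section ArcForm

variable {n : ℕ} {a : ℝ}

/-- The pullbacks of multilinear forms by a path of linear maps. -/
noncomputable def pullForms (m : ℕ) (N : C(Set.Icc (0 : ℝ) a, Sect n →L[ℝ] Coord n)) :
    C(Set.Icc (0 : ℝ) a, (Coord n [×m]→L[ℝ] ℝ) →L[ℝ] (Sect n [×m]→L[ℝ] ℝ)) :=
  ⟨fun t => ContinuousMultilinearMap.compContinuousLinearMapContinuousMultilinear ℝ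
      (fun _ : Fin m => Sect n) (fun _ : Fin m => Coord n) ℝ (fun _ => N t),
    (ContinuousMultilinearMap.cont _).comp (continuous_pi fun _ => N.continuous)⟩

/-- The integral, along a path of linear maps, of the pullbacks of a path of forms. -/
noncomputable def arcForm (ha : 0 ≤ a) (m : ℕ) (N : C(Set.Icc (0 : ℝ) a, Sect n →L[ℝ] Coord n)) :
    C(Set.Icc (0 : ℝ) a, Coord n [×m]→L[ℝ] ℝ) →L[ℝ] (Sect n [×m]→L[ℝ] ℝ) :=
  (ContinuousMap.evalCLM ℝ (⟨a, ha, le_rfl⟩ : Set.Icc (0 : ℝ) a) :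
    C(Set.Icc (0 : ℝ) a, Sect n [×m]→L[ℝ] ℝ) →L[ℝ] (Sect n [×m]→L[ℝ] ℝ)).comp
    ((primitive ha).comp (pointwiseApply (pullForms m N)))

theorem arcForm_apply (ha : 0 ≤ a) (m : ℕ) (N : C(Set.Icc (0 : ℝ) a, Sect n →L[ℝ] Coord n))
    (c : C(Set.Icc (0 : ℝ) a, Coord n [×m]→L[ℝ] ℝ)) (v : Fin m → Sect n) :
    arcForm ha m N c v = ∫ r in (0 : ℝ)..a,
      Set.IccExtend ha (fun t => c t fun i => N t (v i)) r := by
  have h1 : arcForm ha m N c = ∫ r in (0 : ℝ)..a,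
      Set.IccExtend ha (pointwiseApply (pullForms m N) c) r := rfl
  have h2 := (ContinuousMultilinearMap.apply ℝ (fun _ : Fin m => Sect n) ℝ v).intervalIntegral_comp_comm
    (μ := MeasureTheory.volume) (a := 0) (b := a)
    (((pointwiseApply (pullForms m N) c).continuous.Icc_extend' (h := ha)).intervalIntegrable _ _)
  rw [h1]
  exact h2.symm

theorem IsSymmForm.arcForm (ha : 0 ≤ a) (m : ℕ) (N : C(Set.Icc (0 : ℝ) a, Sect n →L[ℝ] Coord n))
    {c : C(Set.Icc (0 : ℝ) a, Coord n [×m]→L[ℝ] ℝ)} (hc : ∀ t, IsSymmForm (c t)) :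
    IsSymmForm (arcForm ha m N c) := by
  intro σ v
  rw [arcForm_apply, arcForm_apply]
  refine intervalIntegral.integral_congr fun r _ => ?_
  simp only [Set.IccExtend_apply]
  exact hc _ σ fun i => N _ (v i)

end ArcForm

/-! ### Coordinates on the sections -/

section SectionCoordinates

variable {n : ℕ}

/-- The coordinates `(x, y)` of a point `(x₀, x, y₀, y)`. -/
noncomputable def sectOf (n : ℕ) : Phase n →L[ℝ] Sect n :=
  LinearMap.toContinuousLinearMap
    { toFun := fun z => Sum.elim (fun i : Fin n => z.1 i.succ) (fun i : Fin n => z.2 i.succ)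
      map_add' := fun z w => by ext i; rcases i with i | i <;> rfl
      map_smul' := fun c z => by ext i; rcases i with i | i <;> rfl }

theorem sectOf_inl (z : Phase n) (i : Fin n) : sectOf n z (Sum.inl i) = z.1 i.succ := rfl

theorem sectOf_inr (z : Phase n) (i : Fin n) : sectOf n z (Sum.inr i) = z.2 i.succ := rfl

/-- When the `x₀`-components vanish, `y₀` no longer contributes; the graph function `α` is therefore
invisible to the symplectic form of the section. -/
theorem phaseForm_eq_flat {v w : Phase n} (hv : v.1 0 = 0) (hw : w.1 0 = 0) :
    phaseForm n v w = flat n (sectOf n v) (sectOf n w) := by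
  rw [phaseForm_apply, flat_apply, Fin.sum_univ_succ]
  simp [hv, hw, sectOf_inl, sectOf_inr]

/-- The point `(0, x, α(x, y), y)`. -/
noncomputable def phasePoint (α : Sect n → ℝ) (ξ : Sect n) : Phase n :=
  (WithLp.toLp 2 (Fin.cons (0 : ℝ) fun i : Fin n => ξ (Sum.inl i)),
    WithLp.toLp 2 (Fin.cons (α ξ) fun i : Fin n => ξ (Sum.inr i)))

theorem sectOf_phasePoint (α : Sect n → ℝ) (ξ : Sect n) : sectOf n (phasePoint α ξ) = ξ := by
  ext i; rcases i with i | i <;> rfl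

theorem contDiffAt_phasePoint {α : Sect n → ℝ} {k : ℕ} {ξ : Sect n} (hα : ContDiffAt ℝ k α ξ) :
    ContDiffAt ℝ k (phasePoint α) ξ := by
  refine ContDiffAt.prodMk ?_ ?_
  · refine contDiffAt_euclidean.2 fun i => ?_
    refine Fin.cases ?_ (fun j => ?_) i
    · exact contDiffAt_const
    · exact contDiffAt_apply ℝ ℝ (Sum.inl j : Fin n ⊕ Fin n) ξ
  · refine contDiffAt_euclidean.2 fun i => ?_
    refine Fin.cases ?_ (fun j => ?_) i
    · exact hα
    · exact contDiffAt_apply ℝ ℝ (Sum.inr j : Fin n ⊕ Fin n) ξ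

end SectionCoordinates

/-! ### The jet of the relative Poincaré map -/

section JetFormula

variable {n : ℕ} {M : Type*} [TopologicalSpace M] [ChartedSpace (Coord n) M]
  [IsManifold (𝓡 (n + 1)) ∞ M]

/-- The orbit `θ` in natural coordinates. -/
theorem exists_isArc {k : ℕ} {H : Cotangent n M → ℝ}
    (hH : ContMDiff (cotangentModel n) 𝓘(ℝ, ℝ) ((k + 1 : ℕ) : WithTop ℕ∞) H) {a : ℝ} (ha : 0 < a)
    {φ : OpenPartialHomeomorph M (Coord n)}
    (hφ : φ ∈ IsManifold.maximalAtlas (𝓡 (n + 1)) ∞ M)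
    {θ : ℝ → Cotangent n M} (hθ : IsOrbitOn φ H θ (Set.Icc 0 a))
    (hφθ : ∀ t ∈ Set.Icc 0 a, φ (θ t).proj = EuclideanSpace.single 0 t) :
    ∃ ζ : C(Set.Icc (0 : ℝ) a, Phase n), (∀ t, ζ t = toCoord φ (θ t)) ∧
      IsArc φ.target k (coordHam φ H) ha ζ := by
  have hc : ContinuousOn (fun t => toCoord φ (θ t)) (Set.Icc 0 a) := fun t ht =>
    (hθ t ht).2.continuousWithinAt
  refine ⟨⟨fun t => toCoord φ (θ t), continuousOn_iff_continuous_domRestrict.1 hc⟩, fun t => rfl,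
    φ.open_target, contDiffOn_coordHam hφ hH, fun t => ⟨φ.map_source (hθ t t.2).1, trivial⟩,
    fun t => hφθ t t.2, fun t => ?_⟩
  refine (hθ t t.2).2.congr_of_mem (fun r hr => ?_) t.2
  rw [Set.IccExtend_of_mem ha.le _ hr]
  rfl

/-- The jet of the relative Poincaré map is the jet of the identity plus the integral, along the
orbit, of the derivatives of order `k + 1` of the potential. -/
theorem exists_jet_formula {k : ℕ} (hk : 2 ≤ k) {H : Cotangent n M → ℝ}
    (hH : ContMDiff (cotangentModel n) 𝓘(ℝ, ℝ) ((k + 1 : ℕ) : WithTop ℕ∞) H) {a : ℝ} (ha : 0 < a)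
    {φ : OpenPartialHomeomorph M (Coord n)}
    (hφ : φ ∈ IsManifold.maximalAtlas (𝓡 (n + 1)) ∞ M)
    {θ : ℝ → Cotangent n M} (hθ : IsOrbitOn φ H θ (Set.Icc 0 a))
    (hφθ : ∀ t ∈ Set.Icc 0 a, φ (θ t).proj = EuclideanSpace.single 0 t)
    {α : Sect n → ℝ} (hα : IsSectParam φ H (k + 1) (θ 0) α) :
    ∃ N : C(Set.Icc (0 : ℝ) a, Sect n →L[ℝ] Coord n), (∀ t v, N t v 0 = 0) ∧
      (∀ t v i, N t v (Fin.succ i) = (linPoincare φ H α (θ 0) t).mulVec v (Sum.inl i)) ∧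
      ∀ (u : M → ℝ) (V : Coord n → ℝ), ContDiff ℝ ∞ V →
        (∀ t ∈ Set.Icc 0 a, ∀ i ≤ k, iteratedFDeriv ℝ i V (EuclideanSpace.single 0 t) = 0) →
        (∀ x ∈ φ.target, u (φ.symm x) = V x) →
        (∀ᶠ ξ in 𝓝 (sectCoord φ (θ 0)), ∃ w z',
          Crosses φ (perturb H u) 0 a (sectPoint φ α ξ) w ∧ Crosses φ H 0 a z' w) ∧
        ContDiffAt ℝ k (sectRel φ H a α (θ 0) u) 0 ∧
        ∀ c : C(Set.Icc (0 : ℝ) a, Coord n [×(k + 1)]→L[ℝ] ℝ),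
          (∀ t, c t = iteratedFDeriv ℝ (k + 1) V (EuclideanSpace.single 0 (t : ℝ))) →
          jetMap φ H a α (θ 0) k u =
            jet k id + topJet n k (raise n k (arcForm ha.le (k + 1) N c)) := by
  obtain ⟨ζ, hζ, harc⟩ := exists_isArc hH ha hφ hθ hφθ
  obtain ⟨hα1, hα2, hα3⟩ := hα
  have hK1 : ContDiffOn ℝ 1 (hamField (coordHam φ H)) (φ.target ×ˢ Set.univ) :=
    harc.contDiffOn_hamField.of_le (by exact_mod_cast (by omega : 1 ≤ k))
  set ξ₀ := sectCoord φ (θ 0) with hξ₀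
  set p : Sect n → Phase n := fun ξ => phasePoint α (ξ₀ + ξ) with hp
  have hshift : Filter.Tendsto (fun ξ : Sect n => ξ₀ + ξ) (𝓝 0) (𝓝 ξ₀) :=
    (continuous_const.add continuous_id).tendsto' _ _ (add_zero ξ₀)
  have hunshift : Filter.Tendsto (fun ξ : Sect n => ξ - ξ₀) (𝓝 ξ₀) (𝓝 0) :=
    (continuous_id.sub continuous_const).tendsto' _ _ (sub_self ξ₀)
  have hpp : ∀ ξ, sectPoint φ α (ξ₀ + ξ) = ofCoord φ (p ξ) := fun ξ => rfl
  have hp0 : p 0 = ζ ⟨0, le_rfl, ha.le⟩ := by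
    have h1 : (toCoord φ (θ 0)).1 = EuclideanSpace.single 0 0 := hφθ 0 ⟨le_rfl, ha.le⟩
    rw [hζ, hp]
    simp only [add_zero]
    refine Prod.ext ?_ ?_
    · ext i
      refine Fin.cases ?_ (fun j => ?_) i
      · rw [h1]; simp [phasePoint]
      · rfl
    · ext i
      refine Fin.cases ?_ (fun j => ?_) i
      · exact hα2
      · rfl
  have hpc : ContDiffAt ℝ k p 0 := by
    have h1 : ContDiffAt ℝ k α (ξ₀ + 0) := by
      rw [add_zero]; exact hα1.of_le (by exact_mod_cast Nat.le_succ k)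
    exact (contDiffAt_phasePoint h1).comp (0 : Sect n)
      (contDiffAt_const.add contDiffAt_id)
  have hpK : ∀ᶠ ξ in 𝓝 0, coordHam φ H (p ξ) = coordHam φ H (p 0) := by
    have h1 : coordHam φ H (p 0) = H (θ 0) := by
      rw [coordHam, ← hpp, add_zero]; exact hα3.self_of_nhds
    filter_upwards [hshift.eventually hα3] with ξ hξ
    rw [h1, ← hξ]
    rfl
  obtain ⟨m, -, hmc, hmP, hmV⟩ := harc.exists_variation hk hpc hp0 (fun _ => rfl) hpK
  have hsp' : ∀ v, sectOf n (fderiv ℝ p 0 v) = v := fun v => by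
    have h1 : HasFDerivAt p (fderiv ℝ p 0) 0 := (hpc.differentiableAt
      (by exact_mod_cast (by omega : k ≠ 0))).hasFDerivAt
    have h2 : HasFDerivAt (fun ξ => sectOf n (p ξ)) ((sectOf n).comp (fderiv ℝ p 0)) 0 :=
      (sectOf n).hasFDerivAt.comp _ h1
    have h3 : HasFDerivAt (fun ξ => sectOf n (p ξ)) (ContinuousLinearMap.id ℝ (Sect n)) 0 := by
      simp only [hp, sectOf_phasePoint]
      exact (hasFDerivAt_id (0 : Sect n)).const_add ξ₀
    exact congrArg (fun L : Sect n →L[ℝ] Sect n => L v) (h2.unique h3)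
  have hp'c : ∀ v, (fderiv ℝ p 0 v).1 0 = 0 := fun v => by
    have h1 : HasFDerivAt p (fderiv ℝ p 0) 0 := (hpc.differentiableAt
      (by exact_mod_cast (by omega : k ≠ 0))).hasFDerivAt
    have h2 : HasFDerivAt (fun ξ => clock n (p ξ)) ((clock n).comp (fderiv ℝ p 0)) 0 :=
      (clock n).hasFDerivAt.comp _ h1
    have h3 : HasFDerivAt (fun ξ => clock n (p ξ)) (0 : Sect n →L[ℝ] ℝ) 0 :=
      hasFDerivAt_const (0 : ℝ) _
    exact congrArg (fun L : Sect n →L[ℝ] ℝ => L v) (h2.unique h3)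
  -- Only the base component of the linearized flow matters, because a potential is differentiated
  -- in base directions only.
  let N : C(Set.Icc (0 : ℝ) a, Sect n →L[ℝ] Coord n) :=
    ⟨fun t => (ContinuousLinearMap.fst ℝ (Coord n) (Coord n)).comp
      ((ContinuousMap.evalCLM ℝ t : C(Set.Icc (0 : ℝ) a, Phase n) →L[ℝ] Phase n).comp m),
    continuous_clm_apply.2 fun v => continuous_fst.comp (m v).continuous⟩
  refine ⟨N,
    fun t v => hmc v t, fun t v i => ?_, fun u V hV hV0 hu => ?_⟩
  · obtain ⟨P, hP, hPc⟩ := hmP t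
    have h1 : sectPoincare φ H α t =ᶠ[𝓝 ξ₀] fun ξ => sectOf n (P (ξ - ξ₀)) := by
      filter_upwards [hunshift.eventually hPc] with ξ hξ
      have h2 := poincare_eq hφ hK1 (hξ.crosses_ofCoord hφ)
      have h3 : sectPoint φ α ξ = ofCoord φ (p (ξ - ξ₀)) := by rw [← hpp]; congr 1; abel
      rw [sectPoincare, h3, h2]
      exact congrArg (sectOf n) (toCoord_ofCoord hφ hξ.2.2.1)
    have h2 : HasFDerivAt (fun ξ => sectOf n (P (ξ - ξ₀))) ((sectOf n).comp
        ((ContinuousMap.evalCLM ℝ t : C(Set.Icc (0 : ℝ) a, Phase n) →L[ℝ] Phase n).comp m)) ξ₀ := by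
      have h3 : HasFDerivAt P ((ContinuousMap.evalCLM ℝ t :
          C(Set.Icc (0 : ℝ) a, Phase n) →L[ℝ] Phase n).comp m) (ξ₀ - ξ₀) := by rwa [sub_self]
      exact (sectOf n).hasFDerivAt.comp _ (HasFDerivAt.comp (f := fun ξ => ξ - ξ₀) ξ₀ h3
        ((hasFDerivAt_id ξ₀).sub_const ξ₀))
    rw [linPoincare, h1.fderiv_eq, h2.fderiv, LinearMap.toMatrix'_mulVec]
    rfl
  · obtain ⟨R, q, hR, hR0, hRc, hqc, hexp, hq⟩ := hmV V (coordHam φ (perturb H u)) hV hV0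
      (fun z hz => congrArg (H (ofCoord φ z) + ·) (hu z.1 hz.1))
    have hKu : ContDiffOn ℝ 1 (hamField (coordHam φ (perturb H u))) (φ.target ×ˢ Set.univ) := by
      refine contDiffOn_hamField (m := 1) harc.isOpen_prod ?_
      have h1 : ContDiffOn ℝ (1 + 1 : ℕ) (coordHam φ H) (φ.target ×ˢ Set.univ) :=
        harc.contDiffOn.of_le (by exact_mod_cast (by omega : 1 + 1 ≤ k + 1))
      have h2 : ∀ m : ℕ, (m : WithTop ℕ∞) ≤ ∞ := fun m => by exact_mod_cast le_top
      refine (h1.add ((hV.of_le (h2 _)).comp contDiff_fst).contDiffOn).congr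
        fun z hz => ?_
      exact congrArg (H (ofCoord φ z) + ·) (hu z.1 hz.1)
    have hrel : sectRel φ H a α (θ 0) u =ᶠ[𝓝 0] fun ξ => sectOf n (R ξ) - ξ₀ := by
      filter_upwards [hRc] with ξ hξ
      obtain ⟨w, hw1, hw2⟩ := hξ
      have h1 := poincare_eq hφ hKu (hw1.crosses_ofCoord hφ)
      have h2 := poincareInv_eq hφ hK1 (hw2.crosses_ofCoord hφ)
      rw [sectRel, hpp, relPoincare, h1, h2]
      exact congrArg (fun z => sectOf n z - ξ₀) (toCoord_ofCoord hφ hw2.1)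
    have hrelc : ContDiffAt ℝ k (sectRel φ H a α (θ 0) u) 0 :=
      (((sectOf n).contDiff.contDiffAt.comp (0 : Sect n) hR).sub
        contDiffAt_const).congr_of_eventuallyEq hrel
    refine ⟨?_, hrelc, fun c hc => ?_⟩
    · filter_upwards [hunshift.eventually hRc] with ξ hξ
      obtain ⟨w, hw1, hw2⟩ := hξ
      refine ⟨_, _, ?_, hw2.crosses_ofCoord hφ⟩
      have h3 : sectPoint φ α ξ = ofCoord φ (p (ξ - ξ₀)) := by rw [← hpp]; congr 1; abel
      rw [h3]
      exact hw1.crosses_ofCoord hφ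
    · refine jet_of_expansion hrelc (IsSymmForm.raise (IsSymmForm.arcForm ha.le _ _ fun t => ?_)) ?_
      · rw [hc]
        exact isSymmForm_iteratedFDeriv (hV.of_le (by exact_mod_cast le_top)).contDiffAt
      · have h1 := ((sectOf n).isBigO_comp _ _).trans_isLittleO hexp
        refine h1.congr' ?_ Filter.EventuallyEq.rfl
        filter_upwards [hrel] with ξ hξ
        -- The variation formula gives the pairing with every tangent vector of the section;
        -- nondegeneracy then identifies `q` with a Hamiltonian polynomial field.
        have h2 : sectOf n (q ξ) = (k.factorial : ℝ)⁻¹ • raise n k (arcForm ha.le (k + 1) N c)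
            (fun _ => ξ) := by
          refine flat_injective fun v => ?_
          have h3 := hq ξ v
          rw [phaseForm_eq_flat (hqc ξ) (hp'c v), hsp'] at h3
          rw [h3, map_smul, smul_apply, flat_raise, arcForm_apply, smul_eq_mul]
          congr 1
          refine intervalIntegral.integral_congr fun r _ => ?_
          simp only [Set.IccExtend_apply, hc]
          congr 1
          ext1 i
          refine Fin.lastCases ?_ (fun j => ?_) i
          · simp only [Fin.snoc_last]
            rfl
          · simp only [Fin.snoc_castSucc]
            rfl
        rw [hξ, map_sub, map_sub, h2, hp]
        simp only [sectOf_phasePoint]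
        abel

end JetFormula

end ManeJets

namespace ManeJets

open Asymptotics

/-! ### Product potentials and their derivatives on the axis -/

section ProductFunctions

variable {n : ℕ}

/-- The projection `(x₀, x) ↦ x`. -/
noncomputable def tailCoord (n : ℕ) : Coord n →L[ℝ] EuclideanSpace ℝ (Fin n) :=
  LinearMap.toContinuousLinearMap
    { toFun := fun q => WithLp.toLp 2 fun i : Fin n => q i.succ
      map_add' := fun _ _ => rfl
      map_smul' := fun _ _ => rfl }

theorem tailCoord_apply (q : Coord n) :
    tailCoord n q = WithLp.toLp 2 fun i : Fin n => q i.succ := rfl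

theorem tailCoord_single (t : ℝ) : tailCoord n (EuclideanSpace.single 0 t) = 0 := by
  ext i
  simp [tailCoord_apply]

/-- The function `δ(x₀) β(x)`. -/
noncomputable def prodFun (δ : ℝ → ℝ) (β : EuclideanSpace ℝ (Fin n) → ℝ) (q : Coord n) : ℝ :=
  δ (q 0) * β (tailCoord n q)

theorem contDiff_prodFun {δ : ℝ → ℝ} {β : EuclideanSpace ℝ (Fin n) → ℝ} (hδ : ContDiff ℝ ∞ δ)
    (hβ : ContDiff ℝ ∞ β) : ContDiff ℝ ∞ (prodFun δ β) :=
  (hδ.comp (EuclideanSpace.proj (0 : Fin (n + 1)) : Coord n →L[ℝ] ℝ).contDiff).mul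
    (hβ.comp (tailCoord n).contDiff)

/-- The factor `β` is `O(‖v‖^(k+1))` near the axis, so replacing `δ(t + v₀)` by `δ(t)` costs
`o(‖v‖^(k+1))`. The expansion then determines all derivatives up to order `k + 1`, without Leibniz
sums. -/
theorem iteratedFDeriv_prodFun {k : ℕ} {δ : ℝ → ℝ} {β : EuclideanSpace ℝ (Fin n) → ℝ}
    (hδ : ContDiff ℝ ∞ δ) (hβ : ContDiff ℝ ∞ β) (h0 : ∀ i ≤ k, iteratedFDeriv ℝ i β 0 = 0)
    (t : ℝ) :
    (∀ i ≤ k, iteratedFDeriv ℝ i (prodFun δ β) (EuclideanSpace.single 0 t) = 0) ∧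
      iteratedFDeriv ℝ (k + 1) (prodFun δ β) (EuclideanSpace.single 0 t) =
        δ t • (iteratedFDeriv ℝ (k + 1) β 0).compContinuousLinearMap fun _ => tailCoord n := by
  set f : Coord n → ℝ := fun v => prodFun δ β (EuclideanSpace.single 0 t + v) with hf
  have hs : ∀ i, iteratedFDeriv ℝ i (prodFun δ β) (EuclideanSpace.single 0 t) =
      iteratedFDeriv ℝ i f 0 := fun i => by
    rw [hf, iteratedFDeriv_comp_add_left, add_zero]
  have hle : ∀ m : ℕ, (m : WithTop ℕ∞) ≤ ∞ := fun m => by exact_mod_cast le_top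
  have hfc : ContDiffAt ℝ (k + 1 : ℕ) f 0 :=
    (((contDiff_prodFun hδ hβ).of_le (hle _)).comp
      (contDiff_const.add contDiff_id)).contDiffAt
  have hβc : ContDiffAt ℝ (k + 1 : ℕ) β 0 := (hβ.of_le (hle _)).contDiffAt
  set D := iteratedFDeriv ℝ (k + 1) β 0 with hD
  set T : Coord n [×(k + 1)]→L[ℝ] ℝ :=
    δ t • D.compContinuousLinearMap fun _ => tailCoord n with hT
  have hTs : IsSymmForm T := fun σ v => by
    have := isSymmForm_iteratedFDeriv hβc σ (fun i => tailCoord n (v i))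
    exact congrArg (δ t * ·) this
  have hexp : (fun v => f v - (fun _ => (0 : ℝ)) v -
      (((k + 1).factorial : ℝ)⁻¹) • T (fun _ => v)) =o[𝓝 0] fun v : Coord n => ‖v‖ ^ (k + 1) := by
    have htail : (fun v : Coord n => tailCoord n v) =O[𝓝 0] fun v => v :=
      (tailCoord n).isBigO_id _
    have h1 : (fun v : Coord n => β (tailCoord n v) -
        (((k + 1).factorial : ℝ)⁻¹) • D (fun _ => tailCoord n v)) =o[𝓝 0]
        fun v : Coord n => ‖v‖ ^ (k + 1) := by
      have h2 := taylor_peano hβc (fun i hi => h0 i (by omega))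
      have h3 : Filter.Tendsto (fun v : Coord n => tailCoord n v) (𝓝 0) (𝓝 0) := by
        simpa using (tailCoord n).continuous.tendsto 0
      exact (h2.comp_tendsto h3).trans_isBigO (htail.norm_norm.pow (k + 1))
    have h4 : (fun v : Coord n => (((k + 1).factorial : ℝ)⁻¹) • D (fun _ => tailCoord n v))
        =O[𝓝 0] fun v : Coord n => ‖v‖ ^ (k + 1) := by
      exact (isBigO_diag (D.compContinuousLinearMap fun _ => tailCoord n)).const_mul_left _
    have h5 : Filter.Tendsto (fun v : Coord n => δ (t + v 0)) (𝓝 0) (𝓝 (δ t)) := by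
      have h6 : Continuous fun v : Coord n => δ (t + v 0) :=
        hδ.continuous.comp (continuous_const.add
          (EuclideanSpace.proj (0 : Fin (n + 1)) : Coord n →L[ℝ] ℝ).continuous)
      simpa using h6.tendsto 0
    have h7 := (h5.isBigO_one ℝ).mul_isLittleO h1
    have h8 : (fun v : Coord n => δ (t + v 0) - δ t) =o[𝓝 0] fun _ => (1 : ℝ) := by
      rw [isLittleO_one_iff]
      simpa using h5.sub_const (δ t)
    have h9 := h8.mul_isBigO h4
    simp only [one_mul] at h7 h9
    refine (h7.add h9).congr_left fun v => ?_
    have h10 : f v = δ (t + v 0) * β (tailCoord n v) := by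
      simp [hf, prodFun, tailCoord_single]
    have h11 : T (fun _ => v) = δ t * D (fun _ => tailCoord n v) := rfl
    rw [h10, h11]
    simp only [smul_eq_mul]
    ring
  obtain ⟨h1, h2⟩ := iteratedFDeriv_of_expansion hfc contDiffAt_const hTs hexp
  refine ⟨fun i hi => ?_, ?_⟩
  · rw [hs, h1 i (by omega), iteratedFDeriv_fun_zero]
    rfl
  · rw [hs, h2, iteratedFDeriv_fun_zero]
    exact zero_add T

/-- The form `(v₁, …, v_m) ↦ ∏ (vᵢ)₁` on the coordinate space. -/
noncomputable def coordPow (n m : ℕ) [NeZero n] : Coord n [×m]→L[ℝ] ℝ :=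
  (ContinuousMultilinearMap.mkPiAlgebra ℝ (Fin m) ℝ).compContinuousLinearMap
    fun _ => (EuclideanSpace.proj (Fin.succ 0) : Coord n →L[ℝ] ℝ)

theorem coordPow_apply [NeZero n] (m : ℕ) (v : Fin m → Coord n) :
    coordPow n m v = ∏ i, v i (Fin.succ 0) := by
  simp [coordPow]

theorem isSymmForm_coordPow [NeZero n] (m : ℕ) : IsSymmForm (coordPow n m) := fun σ v => by
  rw [coordPow_apply, coordPow_apply]
  exact Equiv.prod_comp σ fun i => v i (Fin.succ 0)

theorem iteratedFDeriv_prodFun_normal [NeZero n] {k : ℕ} {δ : ℝ → ℝ}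
    {β : EuclideanSpace ℝ (Fin n) → ℝ}
    (hδ : ContDiff ℝ ∞ δ) (hβ : ContDiff ℝ ∞ β) (h0 : ∀ i ≤ k, iteratedFDeriv ℝ i β 0 = 0)
    (h1 : ∀ v : EuclideanSpace ℝ (Fin n),
      iteratedFDeriv ℝ (k + 1) β 0 (fun _ => v) = ((k + 1).factorial : ℝ) * v 0 ^ (k + 1))
    (t : ℝ) :
    iteratedFDeriv ℝ (k + 1) (prodFun δ β) (EuclideanSpace.single 0 t) =
      (((k + 1).factorial : ℝ) * δ t) • coordPow n (k + 1) := by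
  rw [(iteratedFDeriv_prodFun hδ hβ h0 t).2]
  have hβc : ContDiffAt ℝ (k + 1 : ℕ) β 0 := (hβ.of_le (by exact_mod_cast le_top)).contDiffAt
  refine IsSymmForm.ext (fun σ v => ?_) (fun σ v => ?_) fun x => ?_
  · exact congrArg (δ t * ·) (isSymmForm_iteratedFDeriv hβc σ (fun i => tailCoord n (v i)))
  · exact congrArg (_ * ·) (isSymmForm_coordPow (k + 1) σ v)
  · have h2 : coordPow n (k + 1) (fun _ => x) = x (Fin.succ 0) ^ (k + 1) := by
      simp [coordPow_apply]
    have h3 := h1 (tailCoord n x)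
    rw [smul_apply, smul_apply, h2]
    refine (congrArg (δ t * ·) h3).trans ?_
    simp only [smul_eq_mul, tailCoord_apply]
    ring

theorem continuous_axis (n : ℕ) :
    Continuous fun t : ℝ => (EuclideanSpace.single 0 t : Coord n) :=
  (PiLp.continuous_toLp 2 fun _ : Fin (n + 1) => ℝ).comp (continuous_single (A := fun _ : Fin (n + 1) => ℝ) 0)

/-- The derivatives of order `m` of a smooth function along the axis. -/
noncomputable def axisForms (a : ℝ) (m : ℕ) {V : Coord n → ℝ} (hV : ContDiff ℝ ∞ V) :
    C(Set.Icc (0 : ℝ) a, Coord n [×m]→L[ℝ] ℝ) :=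
  ⟨fun t => iteratedFDeriv ℝ m V (EuclideanSpace.single 0 (t : ℝ)),
    (hV.continuous_iteratedFDeriv (m := m) (by exact_mod_cast le_top)).comp
      ((continuous_axis n).comp continuous_subtype_val)⟩

theorem isSymmForm_axisForms {a : ℝ} (m : ℕ) {V : Coord n → ℝ} (hV : ContDiff ℝ ∞ V)
    (t : Set.Icc (0 : ℝ) a) : IsSymmForm (axisForms a m hV t) :=
  isSymmForm_iteratedFDeriv (hV.of_le (by exact_mod_cast le_top)).contDiffAt

/-- The powers of the linear forms `v ↦ (N t v)₁`, as a path of forms. -/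
noncomputable def powPath [NeZero n] {a : ℝ} (m : ℕ)
    (N : C(Set.Icc (0 : ℝ) a, Sect n →L[ℝ] Coord n)) :
    C(Set.Icc (0 : ℝ) a, Sect n [×m]→L[ℝ] ℝ) :=
  ⟨fun t => pullForms m N t (coordPow n m), (pullForms m N).continuous.clm_apply continuous_const⟩

theorem powPath_apply [NeZero n] {a : ℝ} (m : ℕ)
    (N : C(Set.Icc (0 : ℝ) a, Sect n →L[ℝ] Coord n)) (t : Set.Icc (0 : ℝ) a)
    {l : Sect n →L[ℝ] ℝ} (hl : ∀ v, N t v (Fin.succ 0) = l v) :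
    powPath m N t = powForm m l := by
  ext v
  rw [powForm_apply]
  simp only [← hl]
  exact coordPow_apply m fun i => N t (v i)

/-- For normalized potentials the form depends on `δ` only, and linearly; the submersion property
becomes a question about weighted integrals of one fixed path of powers. -/
theorem arcForm_prodFun [NeZero n] {a : ℝ} (ha : 0 ≤ a) {k : ℕ}
    (N : C(Set.Icc (0 : ℝ) a, Sect n →L[ℝ] Coord n)) {δ : ℝ → ℝ}
    {β : EuclideanSpace ℝ (Fin n) → ℝ}
    (hδ : ContDiff ℝ ∞ δ) (hβ : ContDiff ℝ ∞ β) (h0 : ∀ i ≤ k, iteratedFDeriv ℝ i β 0 = 0)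
    (h1 : ∀ v : EuclideanSpace ℝ (Fin n),
      iteratedFDeriv ℝ (k + 1) β 0 (fun _ => v) = ((k + 1).factorial : ℝ) * v 0 ^ (k + 1)) :
    arcForm ha (k + 1) N (axisForms a (k + 1) (contDiff_prodFun hδ hβ)) =
      ((k + 1).factorial : ℝ) •
        ∫ r in (0 : ℝ)..a, δ r • Set.IccExtend ha (powPath (k + 1) N) r := by
  have h2 : arcForm ha (k + 1) N (axisForms a (k + 1) (contDiff_prodFun hδ hβ)) =
    ∫ r in (0 : ℝ)..a, Set.IccExtend ha (pointwiseApply (pullForms (k + 1) N)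
      (axisForms a (k + 1) (contDiff_prodFun hδ hβ))) r := rfl
  rw [h2, ← intervalIntegral.integral_smul]
  refine intervalIntegral.integral_congr fun r hr => ?_
  rw [Set.uIcc_of_le ha] at hr
  simp only [Set.IccExtend_of_mem ha _ hr]
  have h3 : pointwiseApply (pullForms (k + 1) N)
      (axisForms a (k + 1) (contDiff_prodFun hδ hβ)) ⟨r, hr⟩ = pullForms (k + 1) N ⟨r, hr⟩
        (iteratedFDeriv ℝ (k + 1) (prodFun δ β) (EuclideanSpace.single 0 r)) := rfl
  rw [h3, iteratedFDeriv_prodFun_normal hδ hβ h0 h1, map_smul, mul_smul]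
  rfl

theorem IsSymmForm.integral_powPath [NeZero n] {a : ℝ} (ha : 0 ≤ a) (m : ℕ)
    (N : C(Set.Icc (0 : ℝ) a, Sect n →L[ℝ] Coord n)) {δ : ℝ → ℝ} (hδ : Continuous δ) :
    IsSymmForm (∫ r in (0 : ℝ)..a, δ r • Set.IccExtend ha (powPath m N) r) := by
  have h1 : ∀ v : Fin m → Sect n, (∫ r in (0 : ℝ)..a, δ r • Set.IccExtend ha (powPath m N) r) v =
      ∫ r in (0 : ℝ)..a, (δ r • Set.IccExtend ha (powPath m N) r) v := fun v =>
    ((ContinuousMultilinearMap.apply ℝ (fun _ : Fin m => Sect n) ℝ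
      v).intervalIntegral_comp_comm (μ := MeasureTheory.volume)
      ((hδ.smul ((powPath m N).continuous.Icc_extend' (h := ha))).intervalIntegrable _ _)).symm
  intro σ v
  rw [h1, h1]
  refine intervalIntegral.integral_congr fun r _ => ?_
  simp only [smul_apply, Set.IccExtend_apply]
  exact congrArg (_ * ·) (isSymmForm_coordPow m σ fun i => N _ (v i))

end ProductFunctions

end ManeJets

namespace ManeJets

/-! ### Spans of weighted integrals -/

section Weights

variable {F : Type*} [NormedAddCommGroup F] [NormedSpace ℝ F] {a : ℝ}

/-- By duality: a linear form that kills all the integrals has, along `P`, zero integral against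
every test function. It therefore vanishes along `P` almost everywhere, then by continuity on the
closed interval. The end points matter, since the times of a general family may be `0` or `a`. -/
theorem mem_span_weighted_integral [FiniteDimensional ℝ F] (ha : 0 < a)
    (P : C(Set.Icc (0 : ℝ) a, F)) (t : Set.Icc (0 : ℝ) a) :
    P t ∈ Submodule.span ℝ {x : F | ∃ δ : ℝ → ℝ, ContDiff ℝ ∞ δ ∧ tsupport δ ⊆ Set.Ioo 0 a ∧
      x = ∫ r in (0 : ℝ)..a, δ r • Set.IccExtend ha.le P r} := by
  set W := Submodule.span ℝ {x : F | ∃ δ : ℝ → ℝ, ContDiff ℝ ∞ δ ∧ tsupport δ ⊆ Set.Ioo 0 a ∧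
      x = ∫ r in (0 : ℝ)..a, δ r • Set.IccExtend ha.le P r} with hW
  have : CompleteSpace F := FiniteDimensional.complete ℝ F
  have hPc : Continuous (Set.IccExtend ha.le P) := P.continuous.Icc_extend'
  by_contra ht
  obtain ⟨f, hft, hfW⟩ := Submodule.exists_le_ker_of_notMem ht
  set f' : F →L[ℝ] ℝ := LinearMap.toContinuousLinearMap f
  set g : ℝ → ℝ := fun r => f' (Set.IccExtend ha.le P r) with hg
  have hgc : Continuous g := f'.continuous.comp hPc
  have h1 : ∀ᵐ x : ℝ, x ∈ Set.Ioo 0 a → g x = 0 := by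
    refine isOpen_Ioo.ae_eq_zero_of_integral_contDiff_smul_eq_zero
      (hgc.locallyIntegrable.locallyIntegrableOn _) fun δ hδ _ hδs => ?_
    have h2 : ∫ x, δ x • g x = ∫ x in (0 : ℝ)..a, δ x • g x := by
      rw [intervalIntegral.integral_of_le ha.le, MeasureTheory.integral_Ioc_eq_integral_Ioo,
        MeasureTheory.setIntegral_eq_integral_of_forall_compl_eq_zero]
      intro x hx
      rw [image_eq_zero_of_notMem_tsupport fun h => hx (hδs h), zero_smul]
    have h3 : f' (∫ r in (0 : ℝ)..a, δ r • Set.IccExtend ha.le P r) = 0 :=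
      hfW (Submodule.subset_span ⟨δ, hδ, hδs, rfl⟩)
    have h4 := f'.intervalIntegral_comp_comm (μ := MeasureTheory.volume)
      ((hδ.continuous.smul hPc).intervalIntegrable (0 : ℝ) a)
    rw [h2]
    refine Eq.trans ?_ (h4.trans h3)
    refine intervalIntegral.integral_congr fun r _ => ?_
    exact (map_smul f' (δ r) _).symm
  have h2 : Set.EqOn g 0 (Set.Ioo 0 a) :=
    MeasureTheory.Measure.eqOn_open_of_ae_eq
      ((MeasureTheory.ae_restrict_iff' measurableSet_Ioo).2 h1) isOpen_Ioo
      hgc.continuousOn continuousOn_const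
  have h3 : Set.EqOn g 0 (closure (Set.Ioo 0 a)) := h2.closure hgc continuous_const
  rw [closure_Ioo ha.ne] at h3
  refine hft ?_
  have h4 := h3 t.2
  simp only [hg, Set.IccExtend_val] at h4
  exact h4

/-- The values of a path in a finite-dimensional space are combinations of finitely many of its
integrals against smooth functions supported in the interior of the interval. -/
theorem exists_weights [CompleteSpace F] (ha : 0 < a) (P : C(Set.Icc (0 : ℝ) a, F)) (S : Submodule ℝ F)
    [FiniteDimensional ℝ S] (hP : ∀ t, P t ∈ S) :
    ∃ (m : ℕ) (δ : Fin m → ℝ → ℝ),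
      (∀ j, ContDiff ℝ ∞ (δ j) ∧ tsupport (δ j) ⊆ Set.Ioo 0 a) ∧
      ∀ t, P t ∈ Submodule.span ℝ
        (Set.range fun j => ∫ r in (0 : ℝ)..a, δ j r • Set.IccExtend ha.le P r) := by
  -- The path is corestricted to `S`, where finite dimension is available both for the duality
  -- argument and for extracting finitely many weights.
  let Q : C(Set.Icc (0 : ℝ) a, S) := ⟨fun t => ⟨P t, hP t⟩, P.continuous.subtype_mk _⟩
  have hQc : Continuous (Set.IccExtend ha.le Q) := Q.continuous.Icc_extend'
  have : CompleteSpace S := FiniteDimensional.complete ℝ S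
  obtain ⟨f, hf, hspan, -⟩ := Submodule.exists_fun_fin_finrank_span_eq ℝ
    {x : S | ∃ δ : ℝ → ℝ, ContDiff ℝ ∞ δ ∧ tsupport δ ⊆ Set.Ioo 0 a ∧
      x = ∫ r in (0 : ℝ)..a, δ r • Set.IccExtend ha.le Q r}
  choose δ hδ1 hδ2 hδ3 using hf
  refine ⟨_, δ, fun j => ⟨hδ1 j, hδ2 j⟩, fun t => ?_⟩
  have h1 := mem_span_weighted_integral ha Q t
  rw [← hspan] at h1
  have h2 := Submodule.mem_map_of_mem (f := S.subtype) h1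
  rw [Submodule.map_span, ← Set.range_comp] at h2
  have h3 : (S.subtype ∘ f) =
      fun j => ∫ r in (0 : ℝ)..a, δ j r • Set.IccExtend ha.le P r := by
    funext j
    have h4 := S.subtypeL.intervalIntegral_comp_comm (μ := MeasureTheory.volume)
      (((hδ1 j).continuous.smul hQc).intervalIntegrable (0 : ℝ) a)
    rw [Function.comp, hδ3 j]
    refine h4.symm.trans ?_
    rfl
  rw [h3] at h2
  exact h2

end Weights

end ManeJets

namespace ManeJets

/-! ### Smoothness along families of potentials -/

section SmoothFamilies

variable {n : ℕ} {M : Type*} [TopologicalSpace M] [ChartedSpace (Coord n) M]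

theorem iteratedFDeriv_prodMk_right {E F G : Type*} [NormedAddCommGroup E] [NormedSpace ℝ E]
    [NormedAddCommGroup F] [NormedSpace ℝ F] [NormedAddCommGroup G] [NormedSpace ℝ G]
    {f : E × F → G} {m : ℕ} (hf : ContDiff ℝ m f) (s : E) (x : F) :
    iteratedFDeriv ℝ m (fun y => f (s, y)) x =
      (iteratedFDeriv ℝ m f (s, x)).compContinuousLinearMap
        fun _ => ContinuousLinearMap.inr ℝ E F := by
  have h1 : (fun y => f (s, y)) =
      (fun p => f ((s, 0) + p)) ∘ (ContinuousLinearMap.inr ℝ E F) := by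
    funext y
    simp
  have h2 : ContDiff ℝ m fun p => f ((s, 0) + p) := hf.comp (contDiff_const.add contDiff_id)
  rw [h1, ContinuousLinearMap.iteratedFDeriv_comp_right _ h2 _ le_rfl,
    iteratedFDeriv_comp_add_left]
  simp

/-- A smooth family of functions in a chart. -/
theorem contDiffOn_family {φ : OpenPartialHomeomorph M (Coord n)}
    (hφ : φ ∈ IsManifold.maximalAtlas (𝓡 (n + 1)) ∞ M) {𝓕 : Set (M → ℝ)} {m : ℕ}
    {U : Set (Fin m → ℝ)} {w : (Fin m → ℝ) → M → ℝ} (hw : IsSmoothFamily n 𝓕 U w) :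
    ContDiffOn ℝ ∞ (fun p : (Fin m → ℝ) × Coord n => w p.1 (φ.symm p.2)) (U ×ˢ φ.target) := by
  have h1 : ContMDiffOn 𝓘(ℝ, (Fin m → ℝ) × Coord n) (𝓘(ℝ, Fin m → ℝ).prod (𝓡 (n + 1))) ∞
      (fun p : (Fin m → ℝ) × Coord n => (p.1, φ.symm p.2)) (U ×ˢ φ.target) :=
    (contDiff_fst.contMDiff.contMDiffOn).prodMk
      ((contMDiffOn_symm_of_mem_maximalAtlas hφ).comp contDiff_snd.contMDiff.contMDiffOn
        fun p hp => hp.2)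
  exact (hw.2.comp h1 fun p hp => ⟨hp.1, trivial⟩).contDiffOn

/-- A map that is an affine function of the derivatives of order `m` along the axis is smooth. -/
theorem isSmoothMapOn_of_axis {J : Type} [NormedAddCommGroup J] [NormedSpace ℝ J]
    {φ : OpenPartialHomeomorph M (Coord n)}
    (hφ : φ ∈ IsManifold.maximalAtlas (𝓡 (n + 1)) ∞ M) {𝓕 : Set (M → ℝ)} {a : ℝ}
    (hax : ∀ t ∈ Set.Icc 0 a, (EuclideanSpace.single 0 t : Coord n) ∈ φ.target)
    {r : ℕ} {S : (M → ℝ) → J} (j₀ : J)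
    (Φ : C(Set.Icc (0 : ℝ) a, Coord n [×r]→L[ℝ] ℝ) →L[ℝ] J)
    (hS : ∀ u ∈ 𝓕, ∀ c : C(Set.Icc (0 : ℝ) a, Coord n [×r]→L[ℝ] ℝ),
      (∀ t, c t = iteratedFDeriv ℝ r (fun x => u (φ.symm x)) (EuclideanSpace.single 0 (t : ℝ))) →
      S u = j₀ + Φ c) :
    IsSmoothMapOn n 𝓕 S := by
  intro m U w hU hw s₀ hs₀
  obtain ⟨ρ, hρ, hρU⟩ := Metric.isOpen_iff.1 hU s₀ hs₀
  set K : Set ((Fin m → ℝ) × Coord n) := Metric.closedBall s₀ (ρ / 2) ×ˢ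
    ((fun t : ℝ => (EuclideanSpace.single 0 t : Coord n)) '' Set.Icc 0 a) with hK
  have hKc : IsCompact K :=
    (isCompact_closedBall _ _).prod (isCompact_Icc.image (continuous_axis n))
  have hKs : K ⊆ U ×ˢ φ.target := by
    rintro ⟨s, x⟩ ⟨hs, t, ht, rfl⟩
    refine ⟨hρU ?_, hax t ht⟩
    exact lt_of_le_of_lt (Metric.mem_closedBall.1 hs) (by linarith)
  -- After a cutoff near a compact set of parameters times the axis, the path of derivatives is a
  -- global smooth map `D` composed with a path depending affinely on `s`, so smoothness of
  -- composition operators applies.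
  obtain ⟨G, hG, -, hGe⟩ := exists_contDiff_eventuallyEq (m := ⊤) (hU.prod φ.open_target)
    (contDiffOn_family hφ hw) hKc hKs
  let D : C((Fin m → ℝ) × Coord n, Coord n [×r]→L[ℝ] ℝ) :=
    ⟨fun p => ContinuousMultilinearMap.compContinuousLinearMapL (𝕜 := ℝ)
        (fun _ => ContinuousLinearMap.inr ℝ (Fin m → ℝ) (Coord n)) (iteratedFDeriv ℝ r G p),
      (ContinuousLinearMap.continuous _).comp
        (hG.continuous_iteratedFDeriv (m := r) (by exact_mod_cast le_top))⟩
  have hD : ContDiff ℝ ∞ D := by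
    refine (ContinuousLinearMap.contDiff _).comp ?_
    exact hG.iteratedFDeriv_right (i := r) (m := ∞) (by exact_mod_cast le_top)
  let axis : C(Set.Icc (0 : ℝ) a, (Fin m → ℝ) × Coord n) :=
    ⟨fun t => (0, EuclideanSpace.single 0 (t : ℝ)),
      continuous_const.prodMk ((continuous_axis n).comp continuous_subtype_val)⟩
  have hpath : ContDiff ℝ ∞ fun s : Fin m → ℝ =>
      constPath a (ContinuousLinearMap.inl ℝ (Fin m → ℝ) (Coord n) s) + axis :=
    ((constPath a).comp (ContinuousLinearMap.inl ℝ (Fin m → ℝ) (Coord n)) :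
      (Fin m → ℝ) →L[ℝ] C(Set.Icc (0 : ℝ) a, (Fin m → ℝ) × Coord n)).contDiff.add contDiff_const
  have hcomp := (contDiff_comp (X := Set.Icc (0 : ℝ) a) (n := ⊤) D hD).comp hpath
  have hfin : ContDiff ℝ ∞ fun s : Fin m → ℝ => j₀ + Φ (D.comp
      (constPath a (ContinuousLinearMap.inl ℝ (Fin m → ℝ) (Coord n) s) + axis)) :=
    have hΦ : ContDiff ℝ ∞ Φ := ContinuousLinearMap.contDiff (𝕜 := ℝ)
      (E := C(Set.Icc (0 : ℝ) a, Coord n [×r]→L[ℝ] ℝ)) (F := J) Φ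
    contDiff_const.add (hΦ.comp hcomp)
  refine (hfin.contDiffAt.congr_of_eventuallyEq ?_).contDiffWithinAt
  filter_upwards [Metric.closedBall_mem_nhds s₀ (half_pos hρ)] with s hs
  have hsU : s ∈ U := hρU (lt_of_le_of_lt (Metric.mem_closedBall.1 hs) (by linarith))
  refine hS _ (hw.1 s hsU) _ fun t => ?_
  have h1 : (fun x => w s (φ.symm x)) =ᶠ[𝓝 (EuclideanSpace.single 0 (t : ℝ))]
      fun x => G (s, x) := by
    have h2 := hGe (s, EuclideanSpace.single 0 (t : ℝ)) ⟨hs, t, t.2, rfl⟩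
    have h3 : Filter.Tendsto (fun x : Coord n => (s, x)) (𝓝 (EuclideanSpace.single 0 (t : ℝ)))
        (𝓝 (s, EuclideanSpace.single 0 (t : ℝ))) := (Continuous.prodMk_right s).tendsto _
    exact (h3.eventually h2).mono fun x hx => hx.symm
  rw [(Filter.EventuallyEq.iteratedFDeriv ℝ h1 r).eq_of_nhds,
    iteratedFDeriv_prodMk_right (hG.of_le (by exact_mod_cast le_top))]
  have h4 : (constPath a (ContinuousLinearMap.inl ℝ (Fin m → ℝ) (Coord n) s) + axis) t =
      (s, EuclideanSpace.single 0 (t : ℝ)) := by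
    have h5 : constPath a (ContinuousLinearMap.inl ℝ (Fin m → ℝ) (Coord n) s) t = (s, 0) := rfl
    rw [ContinuousMap.add_apply, h5]
    simp [axis]
  rw [ContinuousMap.comp_apply, h4]
  rfl

end SmoothFamilies

end ManeJets

namespace ManeJets

open Asymptotics

/-! ### Construction of potentials on the manifold -/

section Extension

variable {n : ℕ} {M : Type*} [TopologicalSpace M] [ChartedSpace (Coord n) M]

open Classical in
/-- The function with expression `f` in the chart, extended by zero. -/
noncomputable def chartExt (φ : OpenPartialHomeomorph M (Coord n)) (f : Coord n → ℝ) (q : M) : ℝ :=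
  if q ∈ φ.source then f (φ q) else 0

omit [ChartedSpace (Coord n) M] in
theorem chartExt_of_mem {φ : OpenPartialHomeomorph M (Coord n)} (f : Coord n → ℝ) {q : M}
    (hq : q ∈ φ.source) : chartExt φ f q = f (φ q) := if_pos hq

omit [ChartedSpace (Coord n) M] in
theorem chartExt_of_notMem {φ : OpenPartialHomeomorph M (Coord n)} (f : Coord n → ℝ) {q : M}
    (hq : q ∉ φ.source) : chartExt φ f q = 0 := if_neg hq

omit [ChartedSpace (Coord n) M] in
theorem tsupport_chartExt_subset [T2Space M] {φ : OpenPartialHomeomorph M (Coord n)}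
    {f : Coord n → ℝ} (hf : HasCompactSupport f) (hft : tsupport f ⊆ φ.target) :
    tsupport (chartExt φ f) ⊆ φ.source := by
  have hK : IsCompact (φ.symm '' tsupport f) :=
    hf.isCompact.image_of_continuousOn (φ.continuousOn_symm.mono hft)
  refine (closure_minimal (fun q hq => ?_) hK.isClosed).trans ?_
  · by_cases h : q ∈ φ.source
    · rw [Function.mem_support, chartExt_of_mem f h] at hq
      exact ⟨φ q, subset_tsupport f hq, φ.left_inv h⟩
    · exact absurd (chartExt_of_notMem f h) hq
  · rintro _ ⟨x, hx, rfl⟩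
    exact φ.map_target (hft hx)

theorem contMDiff_chartExt [T2Space M] {φ : OpenPartialHomeomorph M (Coord n)}
    (hφ : φ ∈ IsManifold.maximalAtlas (𝓡 (n + 1)) ∞ M)
    {f : Coord n → ℝ} (hfs : ContDiff ℝ ∞ f) (hf : HasCompactSupport f)
    (hft : tsupport f ⊆ φ.target) :
    ContMDiff (𝓡 (n + 1)) 𝓘(ℝ, ℝ) ∞ (chartExt φ f) := by
  refine contMDiff_of_tsupport fun q hq => ?_
  have hqs := tsupport_chartExt_subset hf hft hq
  have h1 : ContMDiffAt (𝓡 (n + 1)) 𝓘(ℝ, ℝ) ∞ (fun q => f (φ q)) q :=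
    hfs.contMDiff.contMDiffAt.comp q
      ((contMDiffOn_of_mem_maximalAtlas hφ).contMDiffAt (φ.open_source.mem_nhds hqs))
  refine h1.congr_of_eventuallyEq ?_
  filter_upwards [φ.open_source.mem_nhds hqs] with p hp
  exact chartExt_of_mem f hp

theorem tsupport_prodFun_subset (δ : ℝ → ℝ) (β : EuclideanSpace ℝ (Fin n) → ℝ) :
    tsupport (prodFun δ β) ⊆
      {q : Coord n | q 0 ∈ tsupport δ ∧ tailCoord n q ∈ tsupport β} := by
  refine closure_minimal (fun q hq => ?_) ?_
  · rw [Function.mem_support, prodFun] at hq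
    exact ⟨subset_tsupport δ (left_ne_zero_of_mul hq),
      subset_tsupport β (right_ne_zero_of_mul hq)⟩
  · exact ((isClosed_tsupport δ).preimage
      (EuclideanSpace.proj (0 : Fin (n + 1)) : Coord n →L[ℝ] ℝ).continuous).inter
      ((isClosed_tsupport β).preimage (tailCoord n).continuous)

theorem norm_le_clock_add_tail (q : Coord n) : ‖q‖ ≤ |q 0| + ‖tailCoord n q‖ := by
  rw [EuclideanSpace.norm_eq, EuclideanSpace.norm_eq, Fin.sum_univ_succ]
  refine Real.sqrt_le_iff.2 ⟨by positivity, ?_⟩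
  have h1 := Real.sq_sqrt (show 0 ≤ ∑ i, ‖tailCoord n q i‖ ^ 2 by positivity)
  have h2 : ∑ i : Fin n, ‖q i.succ‖ ^ 2 = ∑ i, ‖tailCoord n q i‖ ^ 2 := rfl
  have h3 := mul_nonneg (abs_nonneg (q 0)) (Real.sqrt_nonneg (∑ i, ‖tailCoord n q i‖ ^ 2))
  rw [h2, Real.norm_eq_abs]
  nlinarith

theorem hasCompactSupport_prodFun {δ : ℝ → ℝ} {β : EuclideanSpace ℝ (Fin n) → ℝ} {a ε : ℝ}
    (hδ : tsupport δ ⊆ Set.Ioo 0 a) (hβ : tsupport β ⊆ Metric.ball 0 ε) :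
    HasCompactSupport (prodFun δ β) := by
  refine HasCompactSupport.of_support_subset_isCompact (isCompact_closedBall (0 : Coord n) (a + ε))
    fun q hq => ?_
  obtain ⟨h1, h2⟩ := tsupport_prodFun_subset δ β (subset_tsupport _ hq)
  have h3 := hδ h1
  have h4 : ‖tailCoord n q‖ < ε := by simpa using hβ h2
  rw [mem_closedBall_zero_iff]
  refine (norm_le_clock_add_tail q).trans ?_
  rw [abs_of_pos h3.1]
  linarith [h3.2]

/-- The product of a function of `x₀` and a function of `x` is a potential. -/
theorem isProductPotential_chartExt [T2Space M] {φ : OpenPartialHomeomorph M (Coord n)}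
    (hφ : φ ∈ IsManifold.maximalAtlas (𝓡 (n + 1)) ∞ M) {a ε : ℝ}
    (hφε : ∀ x : Coord n, x 0 ∈ Set.Icc 0 a →
      ‖(WithLp.toLp 2 fun i : Fin n => x i.succ : EuclideanSpace ℝ (Fin n))‖ ≤ ε → x ∈ φ.target)
    {δ : ℝ → ℝ} {β : EuclideanSpace ℝ (Fin n) → ℝ} (hδ : ContDiff ℝ ∞ δ)
    (hδs : tsupport δ ⊆ Set.Ioo 0 a) (hβ : ContDiff ℝ ∞ β) (hβs : tsupport β ⊆ Metric.ball 0 ε) :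
    IsProductPotential φ a ε δ β (chartExt φ (prodFun δ β)) := by
  have h1 := hasCompactSupport_prodFun hδs hβs
  have h2 : tsupport (prodFun δ β) ⊆ φ.target := fun q hq => by
    obtain ⟨h3, h4⟩ := tsupport_prodFun_subset δ β hq
    refine hφε q (Set.Ioo_subset_Icc_self (hδs h3)) ?_
    have h5 : ‖tailCoord n q‖ < ε := by simpa using hβs h4
    exact h5.le
  exact ⟨contMDiff_chartExt hφ (contDiff_prodFun hδ hβ) h1 h2, tsupport_chartExt_subset h1 h2,
    hδ, hδs, hβ, hβs, fun q hq => chartExt_of_mem _ hq⟩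

theorem IsProductPotential.eq_chartExt {φ : OpenPartialHomeomorph M (Coord n)} {a ε : ℝ}
    {δ : ℝ → ℝ} {β : EuclideanSpace ℝ (Fin n) → ℝ} {u : M → ℝ}
    (hu : IsProductPotential φ a ε δ β u) : u = chartExt φ (prodFun δ β) := by
  funext q
  by_cases hq : q ∈ φ.source
  · rw [chartExt_of_mem _ hq]
    exact hu.2.2.2.2.2.2 q hq
  · rw [chartExt_of_notMem _ hq]
    exact image_eq_zero_of_notMem_tsupport fun h => hq (hu.2.1 h)

theorem IsProductPotential.apply_symm {φ : OpenPartialHomeomorph M (Coord n)} {a ε : ℝ}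
    {δ : ℝ → ℝ} {β : EuclideanSpace ℝ (Fin n) → ℝ} {u : M → ℝ}
    (hu : IsProductPotential φ a ε δ β u) {x : Coord n} (hx : x ∈ φ.target) :
    u (φ.symm x) = prodFun δ β x := by
  rw [hu.eq_chartExt, chartExt_of_mem _ (φ.map_target hx), φ.right_inv hx]

theorem tsupport_sum_smul_subset {ι : Type*} (s : Finset ι) (c : ι → ℝ) (δ : ι → ℝ → ℝ) {O : Set ℝ}
    (h : ∀ j, tsupport (δ j) ⊆ O) : tsupport (fun r => ∑ j ∈ s, c j * δ j r) ⊆ O := by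
  classical
  induction s using Finset.induction_on with
  | empty => simp [tsupport]
  | insert j s hj ih =>
    simp only [Finset.sum_insert hj]
    refine (tsupport_add _ _).trans (Set.union_subset ?_ ih)
    exact (closure_mono fun r hr => right_ne_zero_of_mul hr).trans (h j)

/-- The affine family of potentials through `δ(x₀) β(x)` in given directions `δⱼ(x₀) β(x)`. -/
theorem isSmoothFamily_products [NeZero n] [T2Space M] {φ : OpenPartialHomeomorph M (Coord n)}
    (hφ : φ ∈ IsManifold.maximalAtlas (𝓡 (n + 1)) ∞ M) {a ε : ℝ}
    (hφε : ∀ x : Coord n, x 0 ∈ Set.Icc 0 a →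
      ‖(WithLp.toLp 2 fun i : Fin n => x i.succ : EuclideanSpace ℝ (Fin n))‖ ≤ ε → x ∈ φ.target)
    {k : ℕ} {δ : ℝ → ℝ} {β : EuclideanSpace ℝ (Fin n) → ℝ} (hδ : ContDiff ℝ ∞ δ)
    (hδs : tsupport δ ⊆ Set.Ioo 0 a) (hβ : ContDiff ℝ ∞ β) (hβs : tsupport β ⊆ Metric.ball 0 ε)
    (h0 : ∀ i ≤ k, iteratedFDeriv ℝ i β 0 = 0)
    (h1 : ∀ v : EuclideanSpace ℝ (Fin n),
      iteratedFDeriv ℝ (k + 1) β 0 (fun _ => v) = ((k + 1).factorial : ℝ) * v 0 ^ (k + 1))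
    {m : ℕ} {η : Fin m → ℝ → ℝ}
    (hη : ∀ j, ContDiff ℝ ∞ (η j) ∧ tsupport (η j) ⊆ Set.Ioo 0 a) :
    (∀ s : Fin m → ℝ, IsProductPotential φ a ε (fun r => δ r + ∑ j, s j * η j r) β
      (chartExt φ (prodFun (fun r => δ r + ∑ j, s j * η j r) β))) ∧
    IsSmoothFamily n (normalPotentials φ a ε k) Set.univ
      (fun s : Fin m → ℝ => chartExt φ (prodFun (fun r => δ r + ∑ j, s j * η j r) β)) := by
  have hprod : ∀ s : Fin m → ℝ, IsProductPotential φ a ε (fun r => δ r + ∑ j, s j * η j r) β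
      (chartExt φ (prodFun (fun r => δ r + ∑ j, s j * η j r) β)) := fun s => by
    refine isProductPotential_chartExt hφ hφε
      (hδ.add (ContDiff.sum fun j _ => contDiff_const.mul (hη j).1)) ?_ hβ hβs
    exact (tsupport_add _ _).trans
      (Set.union_subset hδs (tsupport_sum_smul_subset _ _ _ fun j => (hη j).2))
  refine ⟨hprod, fun s _ => ⟨_, β, hprod s, h0, h1⟩, ContMDiff.contMDiffOn ?_⟩
  have h2 : (fun p : (Fin m → ℝ) × M =>
      chartExt φ (prodFun (fun r => δ r + ∑ j, p.1 j * η j r) β) p.2) =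
      fun p => chartExt φ (prodFun δ β) p.2 + ∑ j, p.1 j * chartExt φ (prodFun (η j) β) p.2 := by
    funext p
    by_cases hq : p.2 ∈ φ.source
    · simp only [chartExt_of_mem _ hq, prodFun, add_mul, Finset.sum_mul, mul_assoc]
    · simp [chartExt_of_notMem _ hq]
  rw [h2]
  refine ((isProductPotential_chartExt hφ hφε hδ hδs hβ hβs).1.comp contMDiff_snd).add
    (ContMDiff.sum fun j _ => ContMDiff.mul ?_ ?_)
  · exact ((contDiff_apply ℝ ℝ j).contMDiff).comp contMDiff_fst
  · exact (isProductPotential_chartExt hφ hφε (hη j).1 (hη j).2 hβ hβs).1.comp contMDiff_snd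

/-- The product of a bump function and `x₁^(k+1)`: the bump is identically one near `0`, so the jet
is that of the monomial. -/
theorem exists_normal_bump [NeZero n] (k : ℕ) {ε : ℝ} (hε : 0 < ε) :
    ∃ β : EuclideanSpace ℝ (Fin n) → ℝ, ContDiff ℝ ∞ β ∧ tsupport β ⊆ Metric.ball 0 ε ∧
      (∀ i ≤ k, iteratedFDeriv ℝ i β 0 = 0) ∧
      ∀ v : EuclideanSpace ℝ (Fin n),
        iteratedFDeriv ℝ (k + 1) β 0 (fun _ => v) = ((k + 1).factorial : ℝ) * v 0 ^ (k + 1) := by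
  let χ : ContDiffBump (0 : EuclideanSpace ℝ (Fin n)) :=
    ⟨ε / 4, ε / 2, by positivity, by linarith⟩
  set β : EuclideanSpace ℝ (Fin n) → ℝ := fun x => χ x * x 0 ^ (k + 1) with hβ
  have hpow : ContDiff ℝ ∞ fun x : EuclideanSpace ℝ (Fin n) => x 0 ^ (k + 1) :=
    (EuclideanSpace.proj (0 : Fin n) : EuclideanSpace ℝ (Fin n) →L[ℝ] ℝ).contDiff.pow _
  have hβc : ContDiff ℝ ∞ β := χ.contDiff.mul hpow
  let B : EuclideanSpace ℝ (Fin n) [×(k + 1)]→L[ℝ] ℝ :=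
    (ContinuousMultilinearMap.mkPiAlgebra ℝ (Fin (k + 1)) ℝ).compContinuousLinearMap
      fun _ => (EuclideanSpace.proj (0 : Fin n) : EuclideanSpace ℝ (Fin n) →L[ℝ] ℝ)
  have hB : ∀ v, B v = ∏ i, v i 0 := fun v => by simp [B]
  have hBs : IsSymmForm (((k + 1).factorial : ℝ) • B) := fun σ v => by
    rw [smul_apply, smul_apply, hB, hB]
    exact congrArg (_ * ·) (Equiv.prod_comp σ fun i => v i 0)
  have hexp : (fun x => β x - (fun _ => (0 : ℝ)) x - (((k + 1).factorial : ℝ)⁻¹) •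
      (((k + 1).factorial : ℝ) • B) (fun _ => x)) =o[𝓝 0]
        fun x : EuclideanSpace ℝ (Fin n) => ‖x‖ ^ (k + 1) := by
    refine (isLittleO_zero _ _).congr' ?_ Filter.EventuallyEq.rfl
    filter_upwards [χ.eventuallyEq_one] with x hx
    have h1 : ((k + 1).factorial : ℝ) ≠ 0 := by positivity
    have h2 : β x = x 0 ^ (k + 1) := by
      rw [hβ]
      simp only [hx, Pi.one_apply, one_mul]
    rw [smul_apply, hB, smul_smul, inv_mul_cancel₀ h1, h2]
    simp
  obtain ⟨h1, h2⟩ := iteratedFDeriv_of_expansion (hβc.of_le (by exact_mod_cast le_top)).contDiffAt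
    contDiffAt_const hBs hexp
  refine ⟨β, hβc, ?_, fun i hi => ?_, fun v => ?_⟩
  · refine (closure_mono fun x hx => left_ne_zero_of_mul hx).trans ?_
    refine χ.tsupport_eq.subset.trans ?_
    exact Metric.closedBall_subset_ball (by change ε / 2 < ε; linarith)
  · rw [h1 i (by omega), iteratedFDeriv_fun_zero]
    rfl
  · rw [h2, iteratedFDeriv_fun_zero]
    simp only [Pi.zero_apply, zero_add, smul_apply, hB, smul_eq_mul]
    simp

/-- The normalization constrains `β` but not `δ`, so `δ = 0` is allowed as soon as some normalized
`β` exists. -/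
theorem zero_mem_normalPotentials [NeZero n] (φ : OpenPartialHomeomorph M (Coord n)) (a : ℝ)
    {ε : ℝ} (hε : 0 < ε) (k : ℕ) : (0 : M → ℝ) ∈ normalPotentials φ a ε k := by
  obtain ⟨β, h1, h2, h3, h4⟩ := exists_normal_bump (n := n) k hε
  refine ⟨0, β, ⟨contMDiff_const, ?_, contDiff_const, ?_, h1, h2, fun q _ => ?_⟩, h3, h4⟩
  · simp [tsupport]
  · simp [tsupport]
  · simp

end Extension

end ManeJets

namespace ManeJets

/-! ### The tangent space of the kernel, and affine families -/

section Forms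

variable {n k : ℕ}

variable (n) in
/-- The symmetric `m`-linear forms. -/
noncomputable def symmForms (m : ℕ) : Submodule ℝ (Sect n [×m]→L[ℝ] ℝ) where
  carrier := {B | IsSymmForm B}
  add_mem' := fun hB hC σ v => congrArg₂ (· + ·) (hB σ v) (hC σ v)
  zero_mem' := fun _ _ => rfl
  smul_mem' := fun c _ hB σ v => congrArg (c * ·) (hB σ v)

/-- The Hamiltonian vector fields of forms, as jets. -/
noncomputable def fieldJet (n k : ℕ) : (Sect n [×(k + 1)]→L[ℝ] ℝ) →L[ℝ] Jet n k :=
  (topJet n k).comp (raise n k)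

/-- Powers of linear forms span the symmetric forms. -/
def PowSpan {ι : Type*} (m : ℕ) (l : ι → Sect n →L[ℝ] ℝ) : Prop :=
  symmForms n m = Submodule.span ℝ (Set.range fun i => powForm m (l i))

theorem powSpan_of_span [NeZero n] {m : ℕ} {ι : Type*} [Fintype ι]
    {σ : ι → Matrix (Fin n ⊕ Fin n) (Fin n ⊕ Fin n) ℝ}
    (h : Submodule.span ℝ (Set.range fun i =>
      polyComp (MvPolynomial.X (Sum.inl 0) ^ m) (σ i)) =
        MvPolynomial.homogeneousSubmodule (Fin n ⊕ Fin n) ℝ m) :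
    PowSpan m fun i => rowForm (σ i) (Sum.inl 0) := by
  refine le_antisymm (fun B hB => ?_) ?_
  · obtain ⟨c, hc⟩ := exists_sum_powForm_of_span h hB
    exact (Submodule.mem_span_range_iff_exists_fun ℝ).2 ⟨c, hc.symm⟩
  · rw [Submodule.span_le]
    rintro _ ⟨i, rfl⟩
    exact isSymmForm_powForm m _

theorem PowSpan.finiteDimensional {ι : Type*} [Finite ι] {m : ℕ} {l : ι → Sect n →L[ℝ] ℝ}
    (h : PowSpan m l) : FiniteDimensional ℝ (symmForms n m) := by
  rw [h]
  exact FiniteDimensional.span_of_finite ℝ (Set.finite_range _)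

/-- The spanning hypothesis reduces an arbitrary symmetric form to a sum of powers, for which shears
provide a symplectic diffeomorphism. -/
theorem PowSpan.mem_jetKer {ι : Type*} [Fintype ι] (hk : 2 ≤ k) {l : ι → Sect n →L[ℝ] ℝ}
    (h : PowSpan (k + 1) l) {B : Sect n [×(k + 1)]→L[ℝ] ℝ} (hB : IsSymmForm B) :
    jet k id + fieldJet n k B ∈ jetKer n k := by
  have h1 : B ∈ symmForms n (k + 1) := hB
  rw [h, Submodule.mem_span_range_iff_exists_fun] at h1
  obtain ⟨c, rfl⟩ := h1
  exact mem_jetKer_of_sum_powForm hk c l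

/-- The tangent space of the kernel of the projection. -/
theorem PowSpan.tangentVectors_jetKer {ι : Type*} [Fintype ι] (hk : 2 ≤ k)
    {l : ι → Sect n →L[ℝ] ℝ} (h : PowSpan (k + 1) l) {j : Jet n k} (hj : j ∈ jetKer n k) :
    tangentVectors (jetKer n k) j = (symmForms n (k + 1)).map (fieldJet n k).toLinearMap := by
  have := h.finiteDimensional
  have hcl : IsClosed ((symmForms n (k + 1)).map (fieldJet n k).toLinearMap : Set (Jet n k)) :=
    Submodule.closed_of_finiteDimensional _
  obtain ⟨B₀, hB₀, hj₀⟩ := exists_form_of_mem_jetKer hk hj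
  ext v
  constructor
  · rintro ⟨c, hc0, hc, hcv⟩
    -- Difference quotients of a curve in the kernel lie in the direction space, which is
    -- finite-dimensional and hence closed. Conversely, straight lines in these directions stay in
    -- the kernel.
    refine hcl.mem_of_tendsto hcv.tendsto_slope (Filter.Eventually.of_forall fun s => ?_)
    obtain ⟨B, hB, hs⟩ := exists_form_of_mem_jetKer hk (hc s)
    refine ⟨(s - 0)⁻¹ • (B - B₀), (symmForms n (k + 1)).smul_mem _
      ((symmForms n (k + 1)).sub_mem hB hB₀), ?_⟩
    rw [slope_def_module, hc0, hs, hj₀]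
    simp [fieldJet]
  · rintro ⟨B, hB, rfl⟩
    refine ⟨fun s => j + s • fieldJet n k B, by simp, fun s => ?_, ?_⟩
    · have h1 : j + s • fieldJet n k B = jet k id + fieldJet n k (B₀ + s • B) := by
        rw [hj₀, map_add, map_smul, add_assoc]
        rfl
      change j + s • fieldJet n k B ∈ jetKer n k
      rw [h1]
      exact h.mem_jetKer hk ((symmForms n (k + 1)).add_mem hB₀
        ((symmForms n (k + 1)).smul_mem s hB))
    · have h1 := ((hasDerivAt_id (0 : ℝ)).smul_const (fieldJet n k B)).const_add j
      simpa using h1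

theorem span_range_const_smul {J ι : Type*} [AddCommGroup J] [Module ℝ J] {c : ℝ} (hc : c ≠ 0)
    (x : ι → J) :
    Submodule.span ℝ (Set.range fun i => c • x i) = Submodule.span ℝ (Set.range x) := by
  refine le_antisymm (Submodule.span_le.2 ?_) (Submodule.span_le.2 ?_)
  · rintro _ ⟨i, rfl⟩
    exact Submodule.smul_mem _ _ (Submodule.subset_span ⟨i, rfl⟩)
  · rintro _ ⟨i, rfl⟩
    have h1 := Submodule.smul_mem _ c⁻¹
      (Submodule.subset_span (R := ℝ) (s := Set.range fun i => c • x i) ⟨i, rfl⟩)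
    rwa [inv_smul_smul₀ hc] at h1

theorem range_fderiv_affine {J : Type*} [NormedAddCommGroup J] [NormedSpace ℝ J] {m : ℕ} (j : J)
    (x : Fin m → J) :
    DifferentiableAt ℝ (fun s : Fin m → ℝ => j + ∑ i, s i • x i) 0 ∧
      Set.range (fderiv ℝ (fun s : Fin m → ℝ => j + ∑ i, s i • x i) 0) =
        Submodule.span ℝ (Set.range x) := by
  let L : (Fin m → ℝ) →L[ℝ] J :=
    ∑ i, (ContinuousLinearMap.proj i : (Fin m → ℝ) →L[ℝ] ℝ).smulRight (x i)
  have hL : ∀ s, L s = ∑ i, s i • x i := fun s => by simp [L]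
  have h1 : HasFDerivAt (fun s : Fin m → ℝ => j + ∑ i, s i • x i) L 0 := by
    simp only [← hL]
    exact L.hasFDerivAt.const_add j
  refine ⟨h1.differentiableAt, ?_⟩
  rw [h1.fderiv]
  ext y
  rw [SetLike.mem_coe, Submodule.mem_span_range_iff_exists_fun]
  simp only [Set.mem_range, hL]

end Forms

end ManeJets


/-! ### The jet map and its submersion property -/

theorem proposition3 {n : ℕ} [NeZero n] {M : Type*} [TopologicalSpace M] [T2Space M]
    [CompactSpace M] [ChartedSpace (Coord n) M] [IsManifold (𝓡 (n + 1)) ∞ M]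
    (k : ℕ) (hk : 2 ≤ k)
    (H : Cotangent n M → ℝ)
    (hH : ContMDiff (cotangentModel n) 𝓘(ℝ, ℝ) ((k + 1 : ℕ) : WithTop ℕ∞) H)
    (a : ℝ) (ha : 0 < a)
    (φ : OpenPartialHomeomorph M (Coord n))
    (hφ : φ ∈ IsManifold.maximalAtlas (𝓡 (n + 1)) ∞ M)
    (θ : ℝ → Cotangent n M) (hθ : IsOrbitOn φ H θ (Set.Icc 0 a))
    (hφθ : ∀ t ∈ Set.Icc 0 a, φ (θ t).proj = EuclideanSpace.single 0 t)
    (α : Sect n → ℝ) (hα : IsSectParam φ H (k + 1) (θ 0) α)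
    (ε : ℝ) (hε : 0 < ε)
    (hφε : ∀ x : Coord n, x 0 ∈ Set.Icc 0 a →
      ‖(WithLp.toLp 2 fun i : Fin n => x i.succ : EuclideanSpace ℝ (Fin n))‖ ≤ ε → x ∈ φ.target)
    (hgen : IsGeneral (k + 1) 0 a (linPoincare φ H α (θ 0))) :
    (∀ u ∈ potentials φ a ε k,
      (∀ᶠ ξ in 𝓝 (sectCoord φ (θ 0)), ∃ w z',
        Crosses φ (perturb H u) 0 a (sectPoint φ α ξ) w ∧ Crosses φ H 0 a z' w) ∧
      ContDiffAt ℝ k (sectRel φ H a α (θ 0) u) 0 ∧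
      jetMap φ H a α (θ 0) k u ∈ jetKer n k) ∧
    IsSmoothMapOn n (potentials φ a ε k) (jetMap φ H a α (θ 0) k) ∧
    (0 : M → ℝ) ∈ normalPotentials φ a ε k ∧
    ∀ u ∈ normalPotentials φ a ε k,
      IsSubmersionAt n (normalPotentials φ a ε k) (jetKer n k) (jetMap φ H a α (θ 0) k) u := by
  have hax : ∀ t ∈ Set.Icc 0 a, (EuclideanSpace.single 0 t : Coord n) ∈ φ.target := fun t ht => by
    rw [← hφθ t ht]
    exact φ.map_source (hθ t ht).1
  obtain ⟨N, -, hN, hform⟩ := exists_jet_formula hk hH ha hφ hθ hφθ hα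
  obtain ⟨τ, hτ, -, -, hspan⟩ := hgen
  have hpow := powSpan_of_span hspan
  have hrow : ∀ (t : Set.Icc (0 : ℝ) a) v, N t v (Fin.succ 0) =
      rowForm (linPoincare φ H α (θ 0) t) (Sum.inl 0) v := fun t v => by
    rw [hN, rowForm_apply]
    rfl
  have hpot : ∀ u ∈ potentials φ a ε k,
      (∀ᶠ ξ in 𝓝 (sectCoord φ (θ 0)), ∃ w z',
        Crosses φ (perturb H u) 0 a (sectPoint φ α ξ) w ∧ Crosses φ H 0 a z' w) ∧
      ContDiffAt ℝ k (sectRel φ H a α (θ 0) u) 0 ∧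
      (∀ c : C(Set.Icc (0 : ℝ) a, Coord n [×(k + 1)]→L[ℝ] ℝ),
        (∀ t, c t = iteratedFDeriv ℝ (k + 1) (fun x => u (φ.symm x))
          (EuclideanSpace.single 0 (t : ℝ))) →
        jetMap φ H a α (θ 0) k u = jet k id + fieldJet n k (arcForm ha.le (k + 1) N c)) ∧
      jetMap φ H a α (θ 0) k u ∈ jetKer n k := by
    rintro u ⟨δ, β, hu, hβ0⟩
    have hV : ContDiff ℝ ∞ (prodFun δ β) := contDiff_prodFun hu.2.2.1 hu.2.2.2.2.1
    obtain ⟨h1, h2, h3⟩ := hform u (prodFun δ β) hV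
      (fun t _ => (iteratedFDeriv_prodFun hu.2.2.1 hu.2.2.2.2.1 hβ0 t).1)
      (fun x hx => hu.apply_symm hx)
    refine ⟨h1, h2, fun c hc => h3 c fun t => ?_, ?_⟩
    · have h4 : (fun x => u (φ.symm x)) =ᶠ[𝓝 (EuclideanSpace.single 0 (t : ℝ))] prodFun δ β := by
        filter_upwards [φ.open_target.mem_nhds (hax t t.2)] with x hx
        exact hu.apply_symm hx
      rw [hc, (Filter.EventuallyEq.iteratedFDeriv ℝ h4 (k + 1)).eq_of_nhds]
    · rw [h3 (axisForms a (k + 1) hV) fun t => rfl]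
      exact hpow.mem_jetKer hk
        (IsSymmForm.arcForm ha.le _ _ fun t => isSymmForm_axisForms (k + 1) hV t)
  have hker : ∀ u ∈ normalPotentials φ a ε k, jetMap φ H a α (θ 0) k u ∈ jetKer n k :=
    fun u ⟨δ, β, hu, hβ0, _⟩ => (hpot u ⟨δ, β, hu, hβ0⟩).2.2.2
  have hnormal : ∀ (δ : ℝ → ℝ) (β : EuclideanSpace ℝ (Fin n) → ℝ) (u : M → ℝ),
      IsProductPotential φ a ε δ β u → (∀ i ≤ k, iteratedFDeriv ℝ i β 0 = 0) →
      (∀ v : EuclideanSpace ℝ (Fin n),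
        iteratedFDeriv ℝ (k + 1) β 0 (fun _ => v) = ((k + 1).factorial : ℝ) * v 0 ^ (k + 1)) →
      jetMap φ H a α (θ 0) k u = jet k id + fieldJet n k (((k + 1).factorial : ℝ) •
        ∫ r in (0 : ℝ)..a, δ r • Set.IccExtend ha.le (powPath (k + 1) N) r) := by
    intro δ β u hu hβ0 hβ1
    have hV : ContDiff ℝ ∞ (prodFun δ β) := contDiff_prodFun hu.2.2.1 hu.2.2.2.2.1
    have h3 := (hform u (prodFun δ β) hV
      (fun t _ => (iteratedFDeriv_prodFun hu.2.2.1 hu.2.2.2.2.1 hβ0 t).1)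
      (fun x hx => hu.apply_symm hx)).2.2 (axisForms a (k + 1) hV) fun t => rfl
    rw [h3, arcForm_prodFun ha.le N hu.2.2.1 hu.2.2.2.2.1 hβ0 hβ1]
    rfl
  refine ⟨fun u hu => ⟨(hpot u hu).1, (hpot u hu).2.1, (hpot u hu).2.2.2⟩,
    isSmoothMapOn_of_axis hφ hax (jet k id) ((fieldJet n k).comp (arcForm ha.le (k + 1) N))
      fun u hu c hc => (hpot u hu).2.2.1 c hc,
    zero_mem_normalPotentials φ a hε k, fun u hu => ?_⟩
  have hku := hker u hu
  obtain ⟨δ, β, hu, hβ0, hβ1⟩ := hu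
  have hsymm : ∀ t, powPath (k + 1) N t ∈ symmForms n (k + 1) := fun t => by
    rw [powPath_apply (k + 1) N t (hrow t)]
    exact isSymmForm_powForm _ _
  have := hpow.finiteDimensional
  obtain ⟨m, η, hη, hηspan⟩ := exists_weights ha (powPath (k + 1) N) (symmForms n (k + 1)) hsymm
  set E : Fin m → (Sect n [×(k + 1)]→L[ℝ] ℝ) := fun j =>
    ∫ r in (0 : ℝ)..a, η j r • Set.IccExtend ha.le (powPath (k + 1) N) r with hE
  -- The integrals are symmetric. Conversely their span contains the power at every time, in
  -- particular at the times `τ i`, where generality makes the powers span all symmetric forms.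
  have hEspan : Submodule.span ℝ (Set.range E) = symmForms n (k + 1) := by
    refine le_antisymm ?_ ?_
    · rw [Submodule.span_le]
      rintro _ ⟨j, rfl⟩
      exact IsSymmForm.integral_powPath ha.le (k + 1) N (hη j).1.continuous
    · rw [hpow, Submodule.span_le]
      rintro _ ⟨i, rfl⟩
      have h1 := hηspan ⟨τ i, hτ i⟩
      rwa [powPath_apply (k + 1) N _ (hrow ⟨τ i, hτ i⟩)] at h1
  obtain ⟨hprod, hfam⟩ := isSmoothFamily_products hφ hφε hu.2.2.1 hu.2.2.2.1 hu.2.2.2.2.1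
    hu.2.2.2.2.2.1 hβ0 hβ1 hη
  have hw0 : chartExt φ (prodFun (fun r => δ r + ∑ j, (0 : Fin m → ℝ) j * η j r) β) = u := by
    simp only [Pi.zero_apply, zero_mul, Finset.sum_const_zero, add_zero]
    exact hu.eq_chartExt.symm
  -- Along the family only `δ` moves, with `β` fixed, so the jet is an affine function of `s` and
  -- its differential is the same at every `u`.
  have haff : (fun s : Fin m → ℝ => jetMap φ H a α (θ 0) k
      (chartExt φ (prodFun (fun r => δ r + ∑ j, s j * η j r) β))) =
      fun s => jetMap φ H a α (θ 0) k u +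
        ∑ j, s j • fieldJet n k (((k + 1).factorial : ℝ) • E j) := by
    funext s
    rw [hnormal _ β _ (hprod s) hβ0 hβ1, hnormal δ β u hu hβ0 hβ1, add_assoc]
    congr 1
    have hPc : Continuous (Set.IccExtend ha.le (powPath (k + 1) N)) :=
      (powPath (k + 1) N).continuous.Icc_extend'
    have h1 : (∫ r in (0 : ℝ)..a, (δ r + ∑ j, s j * η j r) •
        Set.IccExtend ha.le (powPath (k + 1) N) r) =
        (∫ r in (0 : ℝ)..a, δ r • Set.IccExtend ha.le (powPath (k + 1) N) r) +
          ∑ j, s j • E j := by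
      simp only [add_smul, Finset.sum_smul, mul_smul]
      rw [intervalIntegral.integral_add, intervalIntegral.integral_finsetSum]
      · simp only [intervalIntegral.integral_smul, hE]
      · exact fun j _ => (((hη j).1.continuous.smul hPc).const_smul (s j)).intervalIntegrable _ _
      · exact (hu.2.2.1.continuous.smul hPc).intervalIntegrable _ _
      · exact (continuous_finsetSum _ fun j _ =>
          ((hη j).1.continuous.smul hPc).const_smul (s j)).intervalIntegrable _ _
    rw [h1, smul_add, map_add, Finset.smul_sum, map_sum]
    congr 1
    refine Finset.sum_congr rfl fun j _ => ?_
    rw [smul_comm, map_smul]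
  obtain ⟨hdiff, hrange⟩ := range_fderiv_affine (jetMap φ H a α (θ 0) k u)
    fun j => fieldJet n k (((k + 1).factorial : ℝ) • E j)
  refine ⟨m, Set.univ, _, isOpen_univ, trivial, hfam, hw0, ?_, ?_⟩
  · rw [haff]
    exact hdiff
  · rw [haff, hrange, hpow.tangentVectors_jetKer hk hku, ← hEspan, Submodule.map_span,
      ← Set.range_comp]
    simp only [map_smul]
    rw [span_range_const_smul (by positivity)]
    rfl
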